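/- **Setting.** Let $(V,\otimes,I)$ be a closed symmetric monoidal category. A *duoidal category* is a category $D$ with two monoidal structures $(\square_0,e)$ and $(\square_1,v)$, a natural interchange $(A\square_1B)\square_0(C\square_1E)\to(A\square_0C)\square_1(B\square_0E)$ and morphisms $e\to e\square_1e$, $v\square_0v\to v$, $c:e\to v$, satisfying the usual associativity and unitality axioms and making $v$ a $\square_0$-monoid and $e$ a $\square_1$-comonoid; it is a *duoidal $V$-category* if it is $V$-enriched, $\square_0,\square_1$ are $V$-functors, and the constraints and the interchange are $V$-natural. Let $D$ be a duoidal $V$-category which, as a $V$-category, has cotensors by the objects of $V$ and small conical limits. A *duoid* in $D$ is an object $X$ with a $\square_0$-monoid structure $(\mu_0,\iota_0:e\to X)$ and a $\square_1$-monoid structure $(\mu_1,\iota_1:v\to X)$ such that $\iota_1$ is a morphism of $\square_0$-monoids (so $\iota_0=\iota_1c$) and $\mu_0(\mu_1\square_0\mu_1)=\mu_1(\mu_0\square_1\mu_0)\circ(\text{interchange})$. **Operads.** A *1-operad* $A$ in $D$ consists of objects $A(n)$, $n\ge0$, a unit $j:e\to A(1)$ and morphisms $\gamma:(A(k_1)\square_1\cdots\square_1A(k_n))\square_0A(n)\to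 A(k_1+\cdots+k_n)$ for all $n\ge0$ and $k_i\ge0$ (for $n=0$ the empty $\square_1$-product is $v$), associative (through the iterated interchange) and unital. The 1-operad $\mathrm{Ass}$ has $\mathrm{Ass}(n)=v$, with structure morphisms $c$ and those induced by $v\square_0v\to v$. $A$ is *multiplicative* if it is equipped with a morphism of 1-operads $m:\mathrm{Ass}\to A$, with components $m_n:v\to A(n)$. Then one has the operators * $d_0,d_{n+1}:A(n)\to A(n+1)$, the composites of $A(n)\cong(v\square_1A(n))\square_0e$, $((m_1\square_1\mathrm{id})\square_0m_2c)$ and $\gamma$, respectively of $A(n)\cong(A(n)\square_1v)\square_0e$, $((\mathrm{id}\square_1m_1)\square_0m_2c)$ and $\gamma$; * $d_i:A(n)\to A(n+1)$ for $1\le i\le n$, and $s_i:A(n+1)\to A(n)$ for $0\le i\le n$, the composites of $A(p)\cong e\square_0A(p)\xrightarrow{c\square_0\mathrm{id}}(v\square_1\cdots\square_1v)\square_0A(p)\xrightarrow{(m_{k_1}\square_1\cdots\square_1m_{k_p})\square_0\mathrm{id}}(A(k_1)\square_1\cdots\square_1A(k_p))\square_0A(p)$ and $\gamma$, where $p=n$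 and $(k_1,\dots,k_n)=(1^{i-1},2,1^{n-i})$ for $d_i$, and $p=n+1$ and $(k_1,\dots,k_{n+1})=(1^i,0,1^{n-i})$ for $s_i$. For a cosimplicial object $\varphi$ of $D$ and the constant cosimplicial object $\delta=I$ of $V$, the totalization of $\varphi$ is the $V$-enriched end $\int_{[n]\in\Delta}\varphi([n])^{\delta([n])}$, where $y^a$ denotes the cotensor. **Monoids.** A *monoidal $D$-category* is a category $K$ enriched in $(D,\square_0,e)$, with a monoidal structure $(\odot,\eta)$ on its underlying category, given by $D$-functors $\odot:K\times_1K\to K$ (the hom-objects of $K\times_1K$ are formed with $\square_1$) and $1_v\to K$ (where $1_v$ has one object, with endomorphism object $v$) such that the associativity and unit constraints are $D$-natural. A *monoid* in $K$ is a lax monoidal $D$-functor $1_v\to K$: an object $M$ with a monoid structure $\bar\mu:M\odot M\to M$, $\bar\nu:\eta\to M$ in the underlying category and a morphism of $\square_0$-monoids $u:v\to K(M,M)$ such that $\bar\mu$ and $\bar\nu$ are $D$-natural with respect to $u$. It determines a multiplicative structure on the endomorphism 1-operad $\mathrm{End}_M(n)=K(M^{\odot n},M)$, whose $n$-th component is $u$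 followed by precomposition with the iterated multiplication $M^{\odot n}\to M$. **Theorem.** (1) Let $A$ be a multiplicative 1-operad in $D$. The operators $d_i,s_i$ define a cosimplicial object $A:\Delta\to D$, $[n]\mapsto A(n)$. The Hochschild object $\mathrm{CH}_I(A)$, i.e. the totalization of this cosimplicial object with $\delta=I$, exists and carries a canonical duoid structure. Explicitly, if $\pi:\mathrm{CH}_I(A)\to A(0)$ is the projection, there is exactly one duoid structure on $\mathrm{CH}_I(A)$ with * $\pi\mu_0$ equal to $\mathrm{CH}_I(A)\square_0\mathrm{CH}_I(A)\xrightarrow{\pi\square_0\pi}A(0)\square_0A(0)\xrightarrow{d_0\square_0d_0}A(1)\square_0A(1)\xrightarrow{\gamma}A(1)\xrightarrow{s_0}A(0)$; * $\pi\mu_1$ equal to $\mathrm{CH}_I(A)\square_1\mathrm{CH}_I(A)\xrightarrow{\pi\square_1\pi}A(0)\square_1A(0)\cong(A(0)\square_1A(0))\square_0e\xrightarrow{\mathrm{id}\square_0m_2c}(A(0)\square_1A(0))\square_0A(2)\xrightarrow{\gamma}A(0)$; * $\pi\iota_1$ equal to $v\xrightarrow{m_1}A(1)\xrightarrow{s_0}A(0)$,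 and $\iota_0=\iota_1c$. (2) In particular, if $M$ is a monoid in a monoidal $D$-category $K$, then the center $Z(M)=\mathrm{CH}_I(\mathrm{End}_M)$, formed with the multiplicative structure determined by $M$, exists and carries a canonical duoid structure, namely the one described in (1). -/

import Mathlib

open CategoryTheory MonoidalCategory Opposite Limits

namespace DuoidalCenter

universe w w' v u v' u'

section DoubleMonoidal

/-- Two monoidal structures on one category: the inherited one is `(⊗, 𝟙_ D)`, written
`(□₀, e)` in the literature, and `snd` is `(□₁, v)`. -/
class DoubleMonoidalCategory (D : Type u) [Category.{v} D] extends MonoidalCategory D where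
  snd : MonoidalCategory D

variable {D : Type u} [Category.{v} D] [DoubleMonoidalCategory D]

/-- The second tensor product on objects. -/
def ten (X Y : D) : D := (DoubleMonoidalCategory.snd (D := D)).tensorObj X Y

infixr:70 " ⊠ " => ten

/-- The second tensor product on morphisms. -/
def tenHom {X X' Y Y' : D} (f : X ⟶ X') (g : Y ⟶ Y') : X ⊠ Y ⟶ X' ⊠ Y' :=
  (DoubleMonoidalCategory.snd (D := D)).tensorHom f g

infixr:70 " ⊠ₘ " => tenHom

variable (D) in
/-- The unit of the second tensor product. -/
def vUnit : D := (DoubleMonoidalCategory.snd (D := D)).tensorUnit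

/-- The associator of the second tensor product. -/
def assoc₁ (X Y Z : D) : (X ⊠ Y) ⊠ Z ≅ X ⊠ (Y ⊠ Z) :=
  (DoubleMonoidalCategory.snd (D := D)).associator X Y Z

/-- The left unitor of the second tensor product. -/
def left₁ (X : D) : vUnit D ⊠ X ≅ X := (DoubleMonoidalCategory.snd (D := D)).leftUnitor X

/-- The right unitor of the second tensor product. -/
def right₁ (X : D) : X ⊠ vUnit D ≅ X := (DoubleMonoidalCategory.snd (D := D)).rightUnitor X

@[simp] lemma ten_id (X Y : D) : 𝟙 X ⊠ₘ 𝟙 Y = 𝟙 (X ⊠ Y) :=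
  @MonoidalCategory.id_tensorHom_id D _ DoubleMonoidalCategory.snd X Y

@[simp] lemma ten_comp {X X' X'' Y Y' Y'' : D} (f : X ⟶ X') (f' : X' ⟶ X'')
    (g : Y ⟶ Y') (g' : Y' ⟶ Y'') :
    (f ⊠ₘ g) ≫ (f' ⊠ₘ g') = (f ≫ f') ⊠ₘ (g ≫ g') :=
  @MonoidalCategory.tensorHom_comp_tensorHom D _ DoubleMonoidalCategory.snd _ _ _ _ _ _ f g f' g'

@[simp] lemma ten_comp_assoc {X X' X'' Y Y' Y'' Z : D} (f : X ⟶ X') (f' : X' ⟶ X'')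
    (g : Y ⟶ Y') (g' : Y' ⟶ Y'') (h : X'' ⊠ Y'' ⟶ Z) :
    (f ⊠ₘ g) ≫ (f' ⊠ₘ g') ≫ h = ((f ≫ f') ⊠ₘ (g ≫ g')) ≫ h := by
  rw [← Category.assoc, ten_comp]

lemma assoc₁_nat {X X' Y Y' Z Z' : D} (f : X ⟶ X') (g : Y ⟶ Y') (h : Z ⟶ Z') :
    ((f ⊠ₘ g) ⊠ₘ h) ≫ (assoc₁ X' Y' Z').hom = (assoc₁ X Y Z).hom ≫ (f ⊠ₘ (g ⊠ₘ h)) :=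
  @MonoidalCategory.associator_naturality D _ DoubleMonoidalCategory.snd _ _ _ _ _ _ f g h

lemma left₁_nat {X X' : D} (f : X ⟶ X') :
    (𝟙 (vUnit D) ⊠ₘ f) ≫ (left₁ X').hom = (left₁ X).hom ≫ f := by
  have := @MonoidalCategory.leftUnitor_naturality D _ DoubleMonoidalCategory.snd _ _ f
  rw [← @MonoidalCategory.id_tensorHom D _ DoubleMonoidalCategory.snd] at this
  exact this

lemma right₁_nat {X X' : D} (f : X ⟶ X') :
    (f ⊠ₘ 𝟙 (vUnit D)) ≫ (right₁ X').hom = (right₁ X).hom ≫ f := by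
  have := @MonoidalCategory.rightUnitor_naturality D _ DoubleMonoidalCategory.snd _ _ f
  rw [← @MonoidalCategory.tensorHom_id D _ DoubleMonoidalCategory.snd] at this
  exact this

lemma left₁_assoc₁ (X Y : D) :
    (left₁ X).hom ⊠ₘ 𝟙 Y = (assoc₁ (vUnit D) X Y).hom ≫ (left₁ (X ⊠ Y)).hom := by
  have := @MonoidalCategory.leftUnitor_tensor_hom D _ DoubleMonoidalCategory.snd X Y
  rw [← @MonoidalCategory.tensorHom_id D _ DoubleMonoidalCategory.snd] at this
  change (left₁ (X ⊠ Y)).hom = (assoc₁ _ _ _).inv ≫ ((left₁ X).hom ⊠ₘ 𝟙 Y) at this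
  rw [this, Iso.hom_inv_id_assoc]

lemma left₁_unit : (left₁ (vUnit D)).hom = (right₁ (vUnit D)).hom :=
  @MonoidalCategory.unitors_equal D _ DoubleMonoidalCategory.snd

end DoubleMonoidal

/-- A duoidal category (also called a 2-monoidal category). -/
class DuoidalCategory (D : Type u) [Category.{v} D] extends DoubleMonoidalCategory D where
  /-- the interchange transformation -/
  inter (X Y Z W : D) : (X ⊠ Y) ⊗ (Z ⊠ W) ⟶ (X ⊗ Z) ⊠ (Y ⊗ W)
  inter_nat {X X' Y Y' Z Z' W W' : D} (f : X ⟶ X') (g : Y ⟶ Y') (h : Z ⟶ Z') (k : W ⟶ W') :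
    ((f ⊠ₘ g) ⊗ₘ (h ⊠ₘ k)) ≫ inter X' Y' Z' W' = inter X Y Z W ≫ ((f ⊗ₘ h) ⊠ₘ (g ⊗ₘ k))
  /-- the map `e ⟶ e □₁ e` -/
  eComul : 𝟙_ D ⟶ 𝟙_ D ⊠ 𝟙_ D
  /-- the map `v □₀ v ⟶ v` -/
  vMul : vUnit D ⊗ vUnit D ⟶ vUnit D
  /-- the map `e ⟶ v` -/
  unitMap : 𝟙_ D ⟶ vUnit D
  inter_assoc₀ (A B C E F G : D) :
    (inter A B C E ⊗ₘ 𝟙 (F ⊠ G)) ≫ inter (A ⊗ C) (B ⊗ E) F G ≫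
        ((α_ A C F).hom ⊠ₘ (α_ B E G).hom) =
      (α_ (A ⊠ B) (C ⊠ E) (F ⊠ G)).hom ≫ (𝟙 (A ⊠ B) ⊗ₘ inter C E F G) ≫
        inter A B (C ⊗ F) (E ⊗ G)
  inter_assoc₁ (A B C E F G : D) :
    inter (A ⊠ B) C (E ⊠ F) G ≫ (inter A B E F ⊠ₘ 𝟙 (C ⊗ G)) ≫
        (assoc₁ (A ⊗ E) (B ⊗ F) (C ⊗ G)).hom =
      ((assoc₁ A B C).hom ⊗ₘ (assoc₁ E F G).hom) ≫ inter A (B ⊠ C) E (F ⊠ G) ≫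
        (𝟙 (A ⊗ E) ⊠ₘ inter B C F G)
  eComul_left (A B : D) :
    (eComul ⊗ₘ 𝟙 (A ⊠ B)) ≫ inter (𝟙_ D) (𝟙_ D) A B ≫ ((λ_ A).hom ⊠ₘ (λ_ B).hom) =
      (λ_ (A ⊠ B)).hom
  eComul_right (A B : D) :
    (𝟙 (A ⊠ B) ⊗ₘ eComul) ≫ inter A B (𝟙_ D) (𝟙_ D) ≫ ((ρ_ A).hom ⊠ₘ (ρ_ B).hom) =
      (ρ_ (A ⊠ B)).hom
  vMul_left (A B : D) :
    inter (vUnit D) A (vUnit D) B ≫ (vMul ⊠ₘ 𝟙 (A ⊗ B)) ≫ (left₁ (A ⊗ B)).hom =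
      (left₁ A).hom ⊗ₘ (left₁ B).hom
  vMul_right (A B : D) :
    inter A (vUnit D) B (vUnit D) ≫ (𝟙 (A ⊗ B) ⊠ₘ vMul) ≫ (right₁ (A ⊗ B)).hom =
      (right₁ A).hom ⊗ₘ (right₁ B).hom
  /-- `v` is a monoid for the first tensor product -/
  vMul_assoc : (vMul ⊗ₘ 𝟙 (vUnit D)) ≫ vMul =
    (α_ (vUnit D) (vUnit D) (vUnit D)).hom ≫ (𝟙 (vUnit D) ⊗ₘ vMul) ≫ vMul
  unitMap_vMul : (unitMap ⊗ₘ 𝟙 (vUnit D)) ≫ vMul = (λ_ (vUnit D)).hom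
  vMul_unitMap : (𝟙 (vUnit D) ⊗ₘ unitMap) ≫ vMul = (ρ_ (vUnit D)).hom
  /-- `e` is a comonoid for the second tensor product -/
  eComul_assoc : eComul ≫ (eComul ⊠ₘ 𝟙 (𝟙_ D)) ≫ (assoc₁ (𝟙_ D) (𝟙_ D) (𝟙_ D)).hom =
    eComul ≫ (𝟙 (𝟙_ D) ⊠ₘ eComul)
  counit_eComul : eComul ≫ (unitMap ⊠ₘ 𝟙 (𝟙_ D)) ≫ (left₁ (𝟙_ D)).hom = 𝟙 (𝟙_ D)
  eComul_counit : eComul ≫ (𝟙 (𝟙_ D) ⊠ₘ unitMap) ≫ (right₁ (𝟙_ D)).hom = 𝟙 (𝟙_ D)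

open DuoidalCategory

/-- A duoid structure on an object `X`: a monoid structure for each tensor product such that
`v ⟶ X` is a morphism of monoids for the first one and the interchange diagram commutes. -/
@[ext]
structure DuoidStruct {D : Type u} [Category.{v} D] [DuoidalCategory D] (X : D) where
  mul₀ : X ⊗ X ⟶ X
  one₀ : 𝟙_ D ⟶ X
  mul₁ : X ⊠ X ⟶ X
  one₁ : vUnit D ⟶ X
  one_mul₀ : (one₀ ⊗ₘ 𝟙 X) ≫ mul₀ = (λ_ X).hom
  mul_one₀ : (𝟙 X ⊗ₘ one₀) ≫ mul₀ = (ρ_ X).hom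
  mul_assoc₀ : (mul₀ ⊗ₘ 𝟙 X) ≫ mul₀ = (α_ X X X).hom ≫ (𝟙 X ⊗ₘ mul₀) ≫ mul₀
  one_mul₁ : (one₁ ⊠ₘ 𝟙 X) ≫ mul₁ = (left₁ X).hom
  mul_one₁ : (𝟙 X ⊠ₘ one₁) ≫ mul₁ = (right₁ X).hom
  mul_assoc₁ : (mul₁ ⊠ₘ 𝟙 X) ≫ mul₁ = (assoc₁ X X X).hom ≫ (𝟙 X ⊠ₘ mul₁) ≫ mul₁
  unitMap_one₁ : unitMap ≫ one₁ = one₀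
  vMul_one₁ : vMul ≫ one₁ = (one₁ ⊗ₘ one₁) ≫ mul₀
  interchange : (mul₁ ⊗ₘ mul₁) ≫ mul₀ = inter X X X X ≫ (mul₀ ⊠ₘ mul₀) ≫ mul₁

section Enrichment

variable (V : Type u') [Category.{v'} V] [MonoidalCategory V] [SymmetricCategory V]
  (D : Type u) [Category.{v} D]

/-- For a category `D` with a `V`-enrichment, an enrichment over `V` of a monoidal structure
`m` on `D`: the tensor product is a `V`-functor and the constraints are `V`-natural. -/
structure MonoidalEnrichment [EnrichedOrdinaryCategory V D] (m : MonoidalCategory D) where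
  tensor (X X' Y Y' : D) :
    (X ⟶[V] X') ⊗ (Y ⟶[V] Y') ⟶ (m.tensorObj X Y ⟶[V] m.tensorObj X' Y')
  tensor_comp (X X' X'' Y Y' Y'' : D) :
    (tensor X X' Y Y' ⊗ₘ tensor X' X'' Y' Y'') ≫ eComp V _ _ _ =
      tensorμ (X ⟶[V] X') (Y ⟶[V] Y') (X' ⟶[V] X'') (Y' ⟶[V] Y'') ≫
        (eComp V X X' X'' ⊗ₘ eComp V Y Y' Y'') ≫ tensor X X'' Y Y''
  tensor_homEquiv {X X' Y Y' : D} (f : X ⟶ X') (g : Y ⟶ Y') :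
    eHomEquiv V (m.tensorHom f g) =
      (λ_ (𝟙_ V)).inv ≫ (eHomEquiv V f ⊗ₘ eHomEquiv V g) ≫ tensor X X' Y Y'
  associator_natural (X X' Y Y' Z Z' : D) :
    (tensor X X' Y Y' ⊗ₘ 𝟙 (Z ⟶[V] Z')) ≫ tensor _ _ Z Z' ≫
        eHomWhiskerLeft V _ (m.associator X' Y' Z').hom =
      (α_ _ _ _).hom ≫ (𝟙 (X ⟶[V] X') ⊗ₘ tensor Y Y' Z Z') ≫ tensor X X' _ _ ≫
        eHomWhiskerRight V (m.associator X Y Z).hom _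
  leftUnitor_natural (X X' : D) :
    (λ_ (X ⟶[V] X')).inv ≫ (eId V m.tensorUnit ⊗ₘ 𝟙 (X ⟶[V] X')) ≫ tensor _ _ X X' ≫
        eHomWhiskerLeft V _ (m.leftUnitor X').hom =
      eHomWhiskerRight V (m.leftUnitor X).hom X'
  rightUnitor_natural (X X' : D) :
    (ρ_ (X ⟶[V] X')).inv ≫ (𝟙 (X ⟶[V] X') ⊗ₘ eId V m.tensorUnit) ≫ tensor X X' _ _ ≫
        eHomWhiskerLeft V _ (m.rightUnitor X').hom =
      eHomWhiskerRight V (m.rightUnitor X).hom X'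

/-- A duoidal `V`-category: both tensor products are `V`-functors, and the constraints and the
interchange transformation are `V`-natural. -/
class DuoidalVCategory [DuoidalCategory D] [EnrichedOrdinaryCategory V D] where
  enr₀ : MonoidalEnrichment V D DoubleMonoidalCategory.toMonoidalCategory
  enr₁ : MonoidalEnrichment V D DoubleMonoidalCategory.snd
  inter_natural (A A' B B' C C' E E' : D) :
    (enr₁.tensor A A' B B' ⊗ₘ enr₁.tensor C C' E E') ≫
        enr₀.tensor (A ⊠ B) (A' ⊠ B') (C ⊠ E) (C' ⊠ E') ≫
        eHomWhiskerLeft V ((A ⊠ B) ⊗ (C ⊠ E)) (inter A' B' C' E') =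
      tensorμ (A ⟶[V] A') (B ⟶[V] B') (C ⟶[V] C') (E ⟶[V] E') ≫
        (enr₀.tensor A A' C C' ⊗ₘ enr₀.tensor B B' E E') ≫
        enr₁.tensor (A ⊗ C) (A' ⊗ C') (B ⊗ E) (B' ⊗ E') ≫
        eHomWhiskerRight V (inter A B C E) ((A' ⊗ C') ⊠ (B' ⊗ E'))

end Enrichment

section Totalization

variable (V : Type u') [Category.{v'} V] [MonoidalCategory V] [SymmetricCategory V]
  [MonoidalClosed V] {D : Type u} [Category.{v} D] [EnrichedOrdinaryCategory V D]

variable {V} in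
/-- A cotensor `y ^ a`: an object with isomorphisms `D(x, y ^ a) ≅ V(a, D(x, y))`, natural in
`x`, written through the universal element `ev : a ⟶ D(y ^ a, y)`. -/
structure Cotensor (a : V) (y : D) where
  obj : D
  ev : a ⟶ (obj ⟶[V] y)
  isIso (x : D) : IsIso (MonoidalClosed.curry
    ((β_ a (x ⟶[V] obj)).hom ≫ ((x ⟶[V] obj) ◁ ev) ≫ eComp V x obj y))

lemma Cotensor.existsUnique {a : V} {y : D} (c : Cotensor a y) {x : D} (h : a ⟶ (x ⟶[V] y)) :
    ∃! k : x ⟶ c.obj, c.ev ≫ eHomWhiskerRight V k y = h := by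
  have key : ∀ k : x ⟶ c.obj, eHomEquiv V k ≫ MonoidalClosed.curry
      ((β_ a (x ⟶[V] c.obj)).hom ≫ ((x ⟶[V] c.obj) ◁ c.ev) ≫ eComp V x c.obj y) =
      MonoidalClosed.curry ((ρ_ a).hom ≫ c.ev ≫ eHomWhiskerRight V k y) := by
    intro k
    rw [← MonoidalClosed.curry_natural_left]
    congr 1
    simp only [eHomWhiskerRight, BraidedCategory.braiding_naturality_right_assoc,
      braiding_tensorUnit_right]
    rw [← whisker_exchange_assoc]
    simp
  have hi := c.isIso x
  refine ⟨(eHomEquiv V).symm (MonoidalClosed.curry ((ρ_ a).hom ≫ h) ≫ inv (MonoidalClosed.curry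
    ((β_ a (x ⟶[V] c.obj)).hom ≫ ((x ⟶[V] c.obj) ◁ c.ev) ≫ eComp V x c.obj y))), ?_, ?_⟩
  · have := key ((eHomEquiv V).symm (MonoidalClosed.curry ((ρ_ a).hom ≫ h) ≫
      inv (MonoidalClosed.curry ((β_ a (x ⟶[V] c.obj)).hom ≫ ((x ⟶[V] c.obj) ◁ c.ev) ≫
        eComp V x c.obj y))))
    rw [Equiv.apply_symm_apply, Category.assoc, IsIso.inv_hom_id, Category.comp_id] at this
    have := MonoidalClosed.curry_injective this
    exact ((cancel_epi _).1 this).symm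
  · intro k hk
    rw [Equiv.eq_symm_apply, ← hk, ← key, Category.assoc, IsIso.hom_inv_id, Category.comp_id]

/-- The morphism `x ⟶ y ^ a` given by `a ⟶ D(x, y)`. -/
noncomputable def Cotensor.lift {a : V} {y : D} (c : Cotensor a y) {x : D}
    (h : a ⟶ (x ⟶[V] y)) : x ⟶ c.obj := (c.existsUnique V h).choose

lemma Cotensor.lift_ev {a : V} {y : D} (c : Cotensor a y) {x : D} (h : a ⟶ (x ⟶[V] y)) :
    c.ev ≫ eHomWhiskerRight V (c.lift V h) y = h := (c.existsUnique V h).choose_spec.1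

lemma Cotensor.hom_ext {a : V} {y : D} (c : Cotensor a y) {x : D} {k k' : x ⟶ c.obj}
    (h : c.ev ≫ eHomWhiskerRight V k y = c.ev ≫ eHomWhiskerRight V k' y) : k = k' :=
  (c.existsUnique V (c.ev ≫ eHomWhiskerRight V k' y)).unique h rfl

variable (D) in
/-- `D` has (chosen) cotensors by all objects of `V`. -/
class Cotensored where
  cot (a : V) (y : D) : Cotensor a y

variable (D) in
/-- The functor `(a, y) ↦ y ^ a`. -/
noncomputable def cotensorFunctor [Cotensored V D] : Vᵒᵖ ⥤ D ⥤ D where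
  obj a :=
    { obj y := (Cotensored.cot a.unop y).obj
      map {y y'} f := (Cotensored.cot a.unop y').lift V
        ((Cotensored.cot a.unop y).ev ≫ eHomWhiskerLeft V _ f)
      map_id y := (Cotensored.cot a.unop y).hom_ext V (by simp [Cotensor.lift_ev])
      map_comp {y y' y''} f g := (Cotensored.cot a.unop y'').hom_ext V (by
        rw [Cotensor.lift_ev, eHomWhiskerRight_comp, ← Category.assoc _ (eHomWhiskerRight V _ _),
          Cotensor.lift_ev, Category.assoc, eHom_whisker_exchange, ← Category.assoc,
          Cotensor.lift_ev, Category.assoc, eHomWhiskerLeft_comp]) }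
  map {a b} g :=
    { app y := (Cotensored.cot b.unop y).lift V (g.unop ≫ (Cotensored.cot a.unop y).ev)
      naturality y y' f := (Cotensored.cot b.unop y').hom_ext V (by
        simp only [eHomWhiskerRight_comp]
        rw [← Category.assoc, Cotensor.lift_ev, ← Category.assoc, Cotensor.lift_ev,
          Category.assoc, Category.assoc, Cotensor.lift_ev, eHom_whisker_exchange,
          ← Category.assoc _ (eHomWhiskerRight V _ _), Cotensor.lift_ev, Category.assoc]) }
  map_id a := by
    ext y
    exact (Cotensored.cot a.unop y).hom_ext V (by simp [Cotensor.lift_ev])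
  map_comp {a b c} g h := by
    ext y
    refine (Cotensored.cot c.unop y).hom_ext V ?_
    dsimp
    rw [Cotensor.lift_ev, eHomWhiskerRight_comp, ← Category.assoc _ (eHomWhiskerRight V _ _),
      Cotensor.lift_ev, Category.assoc, Category.assoc, Cotensor.lift_ev]

/-- The bifunctor `(m, n) ↦ φ(n) ^ δ(m)`. -/
noncomputable def cotensorBifunctor [Cotensored V D] (δ : CosimplicialObject V)
    (φ : CosimplicialObject D) : SimplexCategoryᵒᵖ ⥤ SimplexCategory ⥤ D :=
  δ.op ⋙ cotensorFunctor V D ⋙ (Functor.whiskeringLeft _ _ _).obj φ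

/-- A `δ`-totalization of `φ`: an object with the universal property of the `V`-enriched end
`∫_n φ(n) ^ δ(n)`, i.e. a wedge which is sent by every `D(x, -) : D ⥤ V` to an end in `V`. -/
structure Totalization [Cotensored V D] (δ : CosimplicialObject V)
    (φ : CosimplicialObject D) where
  wedge : Wedge (cotensorBifunctor V δ φ)
  isEnd (x : D) : Nonempty (IsLimit ((eCoyoneda V x).mapCone wedge))

/-- The constant cosimplicial object at the unit of `V`. -/
def unitCosimplicial : CosimplicialObject V := (Functor.const SimplexCategory).obj (𝟙_ V)

variable {V} in
/-- The canonical projection from a totalization with `δ = I` to the value at `[n]`. -/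
noncomputable def Totalization.proj [Cotensored V D] {φ : CosimplicialObject D}
    (T : Totalization V (unitCosimplicial V) φ) (n : ℕ) : T.wedge.pt ⟶ φ.obj (SimplexCategory.mk n) :=
  T.wedge.ι (SimplexCategory.mk n) ≫ (eHomEquiv V).symm (Cotensored.cot (𝟙_ V) (φ.obj (SimplexCategory.mk n))).ev

end Totalization

section Iterated

variable {D : Type u} [Category.{v} D] [DuoidalCategory D]

/-- `A i₁ ⊠ (A i₂ ⊠ ⋯ (A iₙ ⊠ v))`; the empty product is `v`. -/
abbrev itens {ι : Type*} (A : ι → D) : List ι → D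
  | [] => vUnit D
  | i :: l => A i ⊠ itens A l

def itensMap {ι : Type*} {A B : ι → D} (f : ∀ i, A i ⟶ B i) :
    ∀ l : List ι, itens A l ⟶ itens B l
  | [] => 𝟙 _
  | i :: l => f i ⊠ₘ itensMap f l

def itensReindex {ι κ : Type*} (A : κ → D) (f : ι → κ) :
    ∀ l : List ι, itens (fun i => A (f i)) l ⟶ itens A (l.map f)
  | [] => 𝟙 _
  | i :: l => 𝟙 (A (f i)) ⊠ₘ itensReindex A f l

def itensAppend {ι : Type*} (A : ι → D) :
    ∀ l l' : List ι, itens A l ⊠ itens A l' ⟶ itens A (l ++ l')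
  | [], l' => (left₁ (itens A l')).hom
  | i :: l, l' => (assoc₁ (A i) (itens A l) (itens A l')).hom ≫ (𝟙 (A i) ⊠ₘ itensAppend A l l')

def itensFlatten {ι : Type*} (A : ι → D) :
    ∀ L : List (List ι), itens (fun l => itens A l) L ⟶ itens A L.flatten
  | [] => 𝟙 _
  | l :: L => (𝟙 (itens A l) ⊠ₘ itensFlatten A L) ≫ itensAppend A l L.flatten

/-- The iterated interchange `(⊠ᵢ A i) ⊗ (⊠ᵢ B i) ⟶ ⊠ᵢ (A i ⊗ B i)`. -/
def itensInter {ι : Type*} (A B : ι → D) :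
    ∀ l : List ι, itens A l ⊗ itens B l ⟶ itens (fun i => A i ⊗ B i) l
  | [] => vMul
  | i :: l => inter (A i) (itens A l) (B i) (itens B l) ≫ (𝟙 (A i ⊗ B i) ⊠ₘ itensInter A B l)

/-- The morphism `e ⟶ e ⊠ ⋯ ⊠ e ⟶ A 1 ⊠ ⋯ ⊠ A 1` induced by `j : e ⟶ A 1`. -/
def unitList (A : ℕ → D) (j : 𝟙_ D ⟶ A 1) : ∀ k : ℕ, 𝟙_ D ⟶ itens A (List.replicate k 1)
  | 0 => unitMap
  | k + 1 => eComul ≫ (j ⊠ₘ unitList A j k)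

/-- The morphism `v ≅ v ⊠ ⋯ ⊠ v ⟶ A i₁ ⊠ ⋯ ⊠ A iₙ` induced by morphisms `v ⟶ A i`. -/
def vList {ι : Type*} {A : ι → D} (m : ∀ i, vUnit D ⟶ A i) : ∀ l : List ι, vUnit D ⟶ itens A l
  | [] => 𝟙 _
  | i :: l => (left₁ (vUnit D)).inv ≫ (m i ⊠ₘ vList m l)

/-- The isomorphism `v ⊠ ⋯ ⊠ v ≅ v`. -/
def vCollapse {ι : Type*} : ∀ l : List ι, itens (fun _ : ι => vUnit D) l ⟶ vUnit D
  | [] => 𝟙 _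
  | _ :: l => (𝟙 (vUnit D) ⊠ₘ vCollapse l) ≫ (left₁ (vUnit D)).hom

/-- Transport along an equality of indices. -/
def castHom {ι : Type*} (A : ι → D) {i j : ι} (h : i = j) : A i ⟶ A j :=
  eqToHom (congrArg A h)

@[simp] lemma castHom_rfl {ι : Type*} (A : ι → D) {i : ι} (h : i = i) : castHom A h = 𝟙 _ := rfl

end Iterated

section Operads

variable (D : Type u) [Category.{v} D] [DuoidalCategory D]

lemma sum_flatten_eq (L : List (List ℕ)) : (L.map List.sum).sum = L.flatten.sum := by
  rw [List.sum_flatten]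

lemma length_flatten_eq (L : List (List ℕ)) : (L.map List.length).sum = L.flatten.length := by
  rw [List.length_flatten]

/-- A 1-operad in a duoidal category. The composition is
`γ : (A k₁ ⊠ ⋯ ⊠ A kₙ) ⊗ A n ⟶ A (k₁ + ⋯ + kₙ)` for all lists `[k₁, …, kₙ]`, including the
empty one, for which it is the action `v ⊗ A 0 ⟶ A 0` of `v` on `A 0`. -/
structure OneOperad where
  obj : ℕ → D
  γ (ks : List ℕ) : itens obj ks ⊗ obj ks.length ⟶ obj ks.sum
  unit : 𝟙_ D ⟶ obj 1
  /-- The two composites from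
  `(⊠ᵢ ⊠ⱼ A lᵢⱼ) ⊗ ((⊠ᵢ A kᵢ) ⊗ A n)` to `A (∑ lᵢⱼ)`, where `kᵢ` is the length of `lᵢ`. -/
  assoc (L : List (List ℕ)) :
    (itensFlatten obj L ⊗ₘ ((itensReindex obj List.length L ⊗ₘ
        castHom obj (List.length_map List.length).symm) ≫ γ (L.map List.length) ≫
        castHom obj (length_flatten_eq L))) ≫ γ L.flatten =
      (α_ (itens (fun l => itens obj l) L) (itens (fun l => obj l.length) L)
          (obj L.length)).inv ≫
        ((itensInter (fun l => itens obj l) (fun l => obj l.length) L ≫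
          itensMap γ L ≫ itensReindex obj List.sum L) ⊗ₘ
          castHom obj (List.length_map List.sum).symm) ≫
        γ (L.map List.sum) ≫ castHom obj (sum_flatten_eq L)
  unit_comp (k : ℕ) :
    (unitList obj unit k ⊗ₘ castHom obj List.length_replicate.symm) ≫
        γ (List.replicate k 1) ≫ castHom obj (by simp) = (λ_ (obj k)).hom
  comp_unit (k : ℕ) :
    ((right₁ (obj k)).inv ⊗ₘ unit) ≫ γ [k] = (ρ_ (obj k)).hom

variable {D}

/-- A morphism of 1-operads. -/
structure OperadHom (A B : OneOperad D) where
  app (n : ℕ) : A.obj n ⟶ B.obj n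
  app_unit : A.unit ≫ app 1 = B.unit
  app_γ (ks : List ℕ) :
    A.γ ks ≫ app ks.sum = (itensMap app ks ⊗ₘ app ks.length) ≫ B.γ ks

lemma vCollapse_append {ι : Type*} (l l' : List ι) :
    itensAppend (fun _ : ι => vUnit D) l l' ≫ vCollapse (l ++ l') =
      (vCollapse l ⊠ₘ vCollapse l') ≫ (left₁ (vUnit D)).hom := by
  induction l with
  | nil => simp [itensAppend, vCollapse, left₁_nat]
  | cons i l ih =>
    simp only [itensAppend, vCollapse, List.cons_append, Category.assoc, ten_comp_assoc, ih,
      Category.comp_id]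
    rw [show (𝟙 (vUnit D) ⊠ₘ (vCollapse l ⊠ₘ vCollapse l') ≫ (left₁ (vUnit D)).hom) =
      (𝟙 (vUnit D) ⊠ₘ (vCollapse l ⊠ₘ vCollapse l')) ≫ (𝟙 (vUnit D) ⊠ₘ (left₁ (vUnit D)).hom)
      by simp, Category.assoc, ← Category.assoc, ← assoc₁_nat, Category.assoc, left₁_nat,
      ← Category.assoc _ (left₁ _).hom, ← left₁_assoc₁, ← Category.assoc, ten_comp]
    simp

lemma vCollapse_flatten {ι : Type*} (L : List (List ι)) :
    itensFlatten (fun _ : ι => vUnit D) L ≫ vCollapse L.flatten =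
      itensMap (fun l => vCollapse l) L ≫ vCollapse L := by
  induction L with
  | nil => simp [itensFlatten, vCollapse, itensMap]
  | cons l L ih =>
    simp only [itensFlatten, List.flatten_cons, Category.assoc, vCollapse_append, itensMap,
      vCollapse, ten_comp_assoc, ih]
    simp

lemma vCollapse_inter {ι : Type*} (l : List ι) :
    itensInter (fun _ : ι => vUnit D) (fun _ : ι => vUnit D) l ≫
        itensMap (fun _ : ι => vMul) l ≫ vCollapse l =
      (vCollapse l ⊗ₘ vCollapse l) ≫ vMul := by
  induction l with
  | nil => simp [itensInter, vCollapse, itensMap]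
  | cons i l ih =>
    have h := vMul_left (vUnit D) (vUnit D)
    simp only [itensInter, itensMap, vCollapse, Category.assoc, ten_comp_assoc, ih,
      Category.id_comp, Category.comp_id]
    rw [← tensorHom_comp_tensorHom, Category.assoc, ← h]
    simp only [Category.assoc]
    rw [← left₁_nat, ← Category.assoc _ (inter _ _ _ _), inter_nat]
    simp

lemma vCollapse_reindex {ι κ : Type*} (f : ι → κ) (l : List ι) :
    itensReindex (fun _ : κ => vUnit D) f l ≫ vCollapse (l.map f) = vCollapse l := by
  induction l with
  | nil => exact Category.id_comp _
  | cons i l ih =>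
    change (𝟙 (vUnit D) ⊠ₘ itensReindex (fun _ : κ => vUnit D) f l) ≫
      (𝟙 (vUnit D) ⊠ₘ vCollapse (l.map f)) ≫ (left₁ (vUnit D)).hom =
      (𝟙 (vUnit D) ⊠ₘ vCollapse l) ≫ (left₁ (vUnit D)).hom
    rw [ten_comp_assoc, ih, Category.comp_id]

lemma castHom_const {ι : Type*} (X : D) {i j : ι} (h : i = j) :
    castHom (fun _ : ι => X) h = 𝟙 X := by subst h; rfl

lemma itensMap_comp {ι : Type*} {A B C : ι → D} (f : ∀ i, A i ⟶ B i) (g : ∀ i, B i ⟶ C i)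
    (l : List ι) : itensMap f l ≫ itensMap g l = itensMap (fun i => f i ≫ g i) l := by
  induction l with
  | nil => simp [itensMap]
  | cons i l ih => simp [itensMap, ih]

lemma itensInter_nat {ι : Type*} {A A' B B' : ι → D} (f : ∀ i, A i ⟶ A' i) (g : ∀ i, B i ⟶ B' i)
    (l : List ι) : (itensMap f l ⊗ₘ itensMap g l) ≫ itensInter A' B' l =
      itensInter A B l ≫ itensMap (fun i => f i ⊗ₘ g i) l := by
  induction l with
  | nil => simp [itensMap, itensInter]
  | cons i l ih =>
    simp only [itensMap, itensInter, Category.assoc, ten_comp]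
    rw [← Category.assoc, inter_nat, Category.assoc, ten_comp, ih]
    simp

lemma itensMap_id {ι : Type*} (A : ι → D) (l : List ι) :
    itensMap (fun i => 𝟙 (A i)) l = 𝟙 _ := by
  induction l with
  | nil => rfl
  | cons i l ih => simp [itensMap, ih, itens]

lemma vCollapse_unitList (k : ℕ) :
    unitList (fun _ => vUnit D) unitMap k ≫ vCollapse (List.replicate k 1) = unitMap := by
  induction k with
  | zero => simp [unitList, vCollapse]
  | succ k ih =>
    simp only [unitList, List.replicate_succ, vCollapse, Category.assoc, ten_comp_assoc, ih,
      Category.comp_id]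
    rw [show (unitMap (D := D) ⊠ₘ unitMap) = (unitMap ⊠ₘ 𝟙 _) ≫ (𝟙 _ ⊠ₘ unitMap) by simp,
      Category.assoc, left₁_nat, ← Category.assoc, ← Category.assoc,
      Category.assoc eComul, counit_eComul, Category.id_comp]

variable (D) in
/-- The associativity 1-operad, with all components equal to `v`. -/
def assOperad : OneOperad D where
  obj _ := vUnit D
  γ ks := (vCollapse ks ⊗ₘ 𝟙 (vUnit D)) ≫ vMul
  unit := unitMap
  assoc L := by
    simp only [castHom_const, Category.comp_id]
    rw [← itensMap_comp, ← Category.assoc (_ ⊗ₘ _) (_ ⊗ₘ _) vMul, tensorHom_comp_tensorHom,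
      tensorHom_comp_tensorHom_assoc]
    simp only [Category.comp_id, Category.assoc, vCollapse_reindex, vCollapse_flatten]
    have h := itensInter_nat (fun l : List ℕ => vCollapse (D := D) l)
      (fun l : List ℕ => 𝟙 (vUnit D)) L
    rw [itensMap_id] at h
    rw [← Category.assoc (itensInter _ _ _), ← h, tensorHom_comp_tensorHom_assoc]
    simp only [Category.assoc, Category.id_comp, vCollapse_reindex]
    rw [vCollapse_inter, tensorHom_comp_tensorHom_assoc]
    simp only [Category.id_comp]
    rw [show ((itensMap (fun l : List ℕ => vCollapse (D := D) l) L ≫ vCollapse L) ⊗ₘ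
        (vCollapse L ⊗ₘ 𝟙 (vUnit D)) ≫ vMul) =
        ((itensMap (fun l : List ℕ => vCollapse (D := D) l) L ≫ vCollapse L) ⊗ₘ
        (vCollapse L ⊗ₘ 𝟙 (vUnit D))) ≫ (𝟙 _ ⊗ₘ vMul) by
          rw [tensorHom_comp_tensorHom, Category.comp_id]]
    rw [show (((itensMap (fun l : List ℕ => vCollapse (D := D) l) L ≫ vCollapse L) ⊗ₘ
        vCollapse L) ≫ vMul) ⊗ₘ 𝟙 (vUnit D) =
        (((itensMap (fun l : List ℕ => vCollapse (D := D) l) L ≫ vCollapse L) ⊗ₘ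
        vCollapse L) ⊗ₘ 𝟙 (vUnit D)) ≫ (vMul ⊗ₘ 𝟙 _) by
          rw [tensorHom_comp_tensorHom, Category.comp_id]]
    rw [Category.assoc, Category.assoc, vMul_assoc, associator_naturality_assoc,
      Iso.inv_hom_id_assoc]
  unit_comp k := by
    simp only [castHom_const, Category.comp_id]
    rw [tensorHom_comp_tensorHom_assoc, vCollapse_unitList, Category.id_comp, unitMap_vMul]
  comp_unit k := by
    rw [tensorHom_comp_tensorHom_assoc]
    have : (right₁ (vUnit D)).inv ≫ vCollapse [k] = 𝟙 _ := by
      simp [vCollapse, left₁_unit]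
    rw [this, Category.comp_id, vMul_unitMap]

end Operads

section Cosimplicial

variable {D : Type u} [Category.{v} D] [DuoidalCategory D] {A : OneOperad D}

/-- The components `v ⟶ A n` of a multiplicative structure `assOperad D ⟶ A`. -/
def OperadHom.mulMap (m : OperadHom (assOperad D) A) (n : ℕ) : vUnit D ⟶ A.obj n := m.app n

/-- The composite `A n ≅ e ⊗ A n ⟶ (v ⊠ ⋯ ⊠ v) ⊗ A n ⟶ (A k₁ ⊠ ⋯ ⊠ A kₙ) ⊗ A n ⟶ A (∑ kᵢ)`. -/
def OperadHom.inner (m : OperadHom (assOperad D) A) (ks : List ℕ) {p q : ℕ}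
    (hp : p = ks.length) (hq : ks.sum = q) : A.obj p ⟶ A.obj q :=
  (λ_ (A.obj p)).inv ≫ ((unitMap ≫ vList m.mulMap ks) ⊗ₘ castHom A.obj hp) ≫ A.γ ks ≫
    castHom A.obj hq

/-- The composite `A n ≅ (v ⊠ A n) ⊗ e ⟶ (A 1 ⊠ A n) ⊗ A 2 ⟶ A (n + 1)`. -/
def OperadHom.cofaceFirst (m : OperadHom (assOperad D) A) (n : ℕ) :
    A.obj n ⟶ A.obj (n + 1) :=
  (ρ_ (A.obj n)).inv ≫
    (((left₁ (A.obj n)).inv ≫ (m.mulMap 1 ⊠ₘ (right₁ (A.obj n)).inv)) ⊗ₘ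
      (unitMap ≫ m.mulMap 2)) ≫
    A.γ [1, n] ≫ castHom A.obj (show [1, n].sum = n + 1 by simp [add_comm])

/-- The composite `A n ≅ (A n ⊠ v) ⊗ e ⟶ (A n ⊠ A 1) ⊗ A 2 ⟶ A (n + 1)`. -/
def OperadHom.cofaceLast (m : OperadHom (assOperad D) A) (n : ℕ) :
    A.obj n ⟶ A.obj (n + 1) :=
  (ρ_ (A.obj n)).inv ≫
    (((right₁ (A.obj n)).inv ≫ (𝟙 (A.obj n) ⊠ₘ (m.mulMap 1 ≫ (right₁ (A.obj 1)).inv))) ⊗ₘ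
      (unitMap ≫ m.mulMap 2)) ≫
    A.γ [n, 1] ≫ castHom A.obj (show [n, 1].sum = n + 1 by simp)

/-- The coface operators `dᵢ : A n ⟶ A (n + 1)`, `0 ≤ i ≤ n + 1`, of a multiplicative operad. -/
def OperadHom.coface (m : OperadHom (assOperad D) A) (n : ℕ) (i : Fin (n + 2)) :
    A.obj n ⟶ A.obj (n + 1) :=
  if h₀ : i.val = 0 then m.cofaceFirst n
  else if h₁ : i.val = n + 1 then m.cofaceLast n
  else m.inner (List.replicate (i.val - 1) 1 ++ 2 :: List.replicate (n - i.val) 1)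
    (by have := i.isLt; simp; omega) (by have := i.isLt; simp; omega)

/-- The codegeneracy operators `sᵢ : A (n + 1) ⟶ A n`, `0 ≤ i ≤ n`, of a multiplicative
operad. -/
def OperadHom.codegeneracy (m : OperadHom (assOperad D) A) (n : ℕ) (i : Fin (n + 1)) :
    A.obj (n + 1) ⟶ A.obj n :=
  m.inner (List.replicate i.val 1 ++ 0 :: List.replicate (n - i.val) 1)
    (by have := i.isLt; simp; omega) (by have := i.isLt; simp; omega)

/-- A cosimplicial object with value `A n` at `[n]` and with the coface and codegeneracy operators
of the multiplicative operad `A`. These operators generate the simplicial category, so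
the cosimplicial object is unique up to a unique isomorphism. -/
structure InducedCosimplicial (m : OperadHom (assOperad D) A) where
  X : CosimplicialObject D
  iso (n : ℕ) : X.obj (SimplexCategory.mk n) ≅ A.obj n
  δ_iso (n : ℕ) (i : Fin (n + 2)) : X.δ i ≫ (iso (n + 1)).hom = (iso n).hom ≫ m.coface n i
  σ_iso (n : ℕ) (i : Fin (n + 1)) : X.σ i ≫ (iso n).hom = (iso (n + 1)).hom ≫ m.codegeneracy n i

end Cosimplicial

section MonoidalDCategory

variable (D : Type u) [Category.{v} D] [DuoidalCategory D]

/-- A monoidal `D`-category: a category `K` enriched over `(D, ⊗, e)` with a monoidal structure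
on its underlying category, whose tensor product is a `D`-functor `K ×₁ K ⟶ K`, where `×₁` is
formed with `⊠`, whose unit is a `D`-functor from the unit `D`-category `1_v`, and whose
constraints are `D`-natural. -/
class MonoidalDCategory (K : Type w) [Category.{w'} K] [EnrichedOrdinaryCategory D K]
    [MonoidalCategory K] where
  tensor (X X' Y Y' : K) : (X ⟶[D] X') ⊠ (Y ⟶[D] Y') ⟶ ((X ⊗ Y) ⟶[D] (X' ⊗ Y'))
  unit : vUnit D ⟶ (𝟙_ K ⟶[D] 𝟙_ K)
  tensor_comp (X X' X'' Y Y' Y'' : K) :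
    (tensor X X' Y Y' ⊗ₘ tensor X' X'' Y' Y'') ≫ eComp D _ _ _ =
      inter (X ⟶[D] X') (Y ⟶[D] Y') (X' ⟶[D] X'') (Y' ⟶[D] Y'') ≫
        (eComp D X X' X'' ⊠ₘ eComp D Y Y' Y'') ≫ tensor X X'' Y Y''
  tensor_homEquiv {X X' Y Y' : K} (f : X ⟶ X') (g : Y ⟶ Y') :
    eHomEquiv D (f ⊗ₘ g) = eComul ≫ (eHomEquiv D f ⊠ₘ eHomEquiv D g) ≫ tensor X X' Y Y'
  unit_comp : (unit ⊗ₘ unit) ≫ eComp D _ _ _ = vMul ≫ unit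
  unit_id : unitMap ≫ unit = eId D (𝟙_ K)
  associator_natural (X X' Y Y' Z Z' : K) :
    (tensor X X' Y Y' ⊠ₘ 𝟙 (Z ⟶[D] Z')) ≫ tensor _ _ Z Z' ≫
        eHomWhiskerLeft D _ (α_ X' Y' Z').hom =
      (assoc₁ _ _ _).hom ≫ (𝟙 (X ⟶[D] X') ⊠ₘ tensor Y Y' Z Z') ≫ tensor X X' _ _ ≫
        eHomWhiskerRight D (α_ X Y Z).hom _
  leftUnitor_natural (X X' : K) :
    (left₁ (X ⟶[D] X')).inv ≫ (unit ⊠ₘ 𝟙 (X ⟶[D] X')) ≫ tensor _ _ X X' ≫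
        eHomWhiskerLeft D _ (λ_ X').hom =
      eHomWhiskerRight D (λ_ X).hom X'
  rightUnitor_natural (X X' : K) :
    (right₁ (X ⟶[D] X')).inv ≫ (𝟙 (X ⟶[D] X') ⊠ₘ unit) ≫ tensor X X' _ _ ≫
        eHomWhiskerLeft D _ (ρ_ X').hom =
      eHomWhiskerRight D (ρ_ X).hom X'

variable {K : Type w} [Category.{w'} K] [EnrichedOrdinaryCategory D K] [MonoidalCategory K]
  [MonoidalDCategory D K]

/-- A monoid in a monoidal `D`-category, i.e. a lax monoidal `D`-functor `1_v ⟶ K`: an object `M`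
with a monoid structure in the underlying monoidal category and a morphism of monoids
`u : v ⟶ K(M, M)` for which the unit and the multiplication are `D`-natural. -/
structure DMonoid (M : K) extends MonObj M where
  u : vUnit D ⟶ (M ⟶[D] M)
  u_id : unitMap ≫ u = eId D M
  u_comp : (u ⊗ₘ u) ≫ eComp D M M M = vMul ≫ u
  u_one : u ≫ eHomWhiskerRight D one M = MonoidalDCategory.unit ≫ eHomWhiskerLeft D (𝟙_ K) one
  u_mul : u ≫ eHomWhiskerRight D mul M =
    (left₁ (vUnit D)).inv ≫ (u ⊠ₘ u) ≫ MonoidalDCategory.tensor M M M M ≫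
      eHomWhiskerLeft D (M ⊗ M) mul

/-- The tensor power `X ⊗ (X ⊗ ⋯ (X ⊗ 𝟙))`. -/
abbrev tpow (X : K) : ℕ → K
  | 0 => 𝟙_ K
  | n + 1 => X ⊗ tpow X n

/-- The canonical isomorphism `X ^ a ⊗ X ^ b ≅ X ^ (a + b)`. -/
def tpowAdd (X : K) : ∀ a b c : ℕ, a + b = c → (tpow X a ⊗ tpow X b ≅ tpow X c)
  | 0, b, c, h => λ_ (tpow X b) ≪≫ eqToIso (congrArg (tpow X) (by omega))
  | a + 1, b, 0, h => absurd h (by omega)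
  | a + 1, b, c + 1, h =>
    α_ X (tpow X a) (tpow X b) ≪≫ whiskerLeftIso X (tpowAdd X a b c (by omega))

lemma tensor_pre {X X' X'' Y Y' Y'' : K} (f : X ⟶ X') (g : Y ⟶ Y') :
    (eHomWhiskerRight D f X'' ⊠ₘ eHomWhiskerRight D g Y'') ≫
        MonoidalDCategory.tensor X X'' Y Y'' =
      MonoidalDCategory.tensor X' X'' Y' Y'' ≫ eHomWhiskerRight D (f ⊗ₘ g) (X'' ⊗ Y'') := by
  have h : (λ_ (X' ⟶[D] X'')).inv ⊠ₘ (λ_ (Y' ⟶[D] Y'')).inv =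
      (λ_ _).inv ≫ (eComul ⊗ₘ 𝟙 _) ≫ inter _ _ _ _ := by
    rw [Iso.eq_inv_comp, ← eComul_left]
    simp
  simp only [eHomWhiskerRight, MonoidalDCategory.tensor_homEquiv]
  rw [← ten_comp, ← ten_comp, h, ← tensorHom_id, ← tensorHom_id]
  simp only [Category.assoc]
  rw [← Category.assoc (inter _ _ _ _), ← inter_nat, Category.assoc,
    ← MonoidalDCategory.tensor_comp, tensorHom_comp_tensorHom_assoc,
    tensorHom_comp_tensorHom_assoc, leftUnitor_inv_naturality_assoc,
    ← id_tensorHom, ← tensorHom_id, tensorHom_comp_tensorHom_assoc]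
  simp only [Category.assoc, Category.id_comp, Category.comp_id, ten_id]

lemma tensor_post {X X' X'' Y Y' Y'' : K} (f : X' ⟶ X'') (g : Y' ⟶ Y'') :
    (eHomWhiskerLeft D X f ⊠ₘ eHomWhiskerLeft D Y g) ≫
        MonoidalDCategory.tensor X X'' Y Y'' =
      MonoidalDCategory.tensor X X' Y Y' ≫ eHomWhiskerLeft D (X ⊗ Y) (f ⊗ₘ g) := by
  have h : (ρ_ (X ⟶[D] X')).inv ⊠ₘ (ρ_ (Y ⟶[D] Y')).inv =
      (ρ_ _).inv ≫ (𝟙 _ ⊗ₘ eComul) ≫ inter _ _ _ _ := by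
    rw [Iso.eq_inv_comp, ← eComul_right]
    simp
  simp only [eHomWhiskerLeft, MonoidalDCategory.tensor_homEquiv]
  rw [← ten_comp, ← ten_comp, h, ← id_tensorHom, ← id_tensorHom]
  simp only [Category.assoc]
  rw [← Category.assoc (inter _ _ _ _), ← inter_nat, Category.assoc,
    ← MonoidalDCategory.tensor_comp, tensorHom_comp_tensorHom_assoc,
    tensorHom_comp_tensorHom_assoc, rightUnitor_inv_naturality_assoc,
    ← id_tensorHom, ← tensorHom_id, tensorHom_comp_tensorHom_assoc]
  simp only [Category.assoc, Category.id_comp, Category.comp_id, ten_id]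

lemma tensor_pre_left {X X' X'' Y Y'' : K} (f : X ⟶ X') :
    (eHomWhiskerRight D f X'' ⊠ₘ 𝟙 (Y ⟶[D] Y'')) ≫ MonoidalDCategory.tensor X X'' Y Y'' =
      MonoidalDCategory.tensor X' X'' Y Y'' ≫ eHomWhiskerRight D (f ▷ Y) (X'' ⊗ Y'') := by
  have := tensor_pre D (X'' := X'') (Y'' := Y'') f (𝟙 Y)
  simpa only [eHomWhiskerRight_id, tensorHom_id] using this

lemma tensor_pre_right {X X'' Y Y' Y'' : K} (g : Y ⟶ Y') :
    (𝟙 (X ⟶[D] X'') ⊠ₘ eHomWhiskerRight D g Y'') ≫ MonoidalDCategory.tensor X X'' Y Y'' =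
      MonoidalDCategory.tensor X X'' Y' Y'' ≫ eHomWhiskerRight D (X ◁ g) (X'' ⊗ Y'') := by
  have := tensor_pre D (X'' := X'') (Y'' := Y'') (𝟙 X) g
  simpa only [eHomWhiskerRight_id, id_tensorHom] using this

lemma tensor_post_right {X X'' Y Y' Y'' : K} (g : Y' ⟶ Y'') :
    (𝟙 (X ⟶[D] X'') ⊠ₘ eHomWhiskerLeft D Y g) ≫ MonoidalDCategory.tensor X X'' Y Y'' =
      MonoidalDCategory.tensor X X'' Y Y' ≫ eHomWhiskerLeft D (X ⊗ Y) (X'' ◁ g) := by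
  have := tensor_post D (X := X) (Y := Y) (𝟙 X'') g
  simpa only [eHomWhiskerLeft_id, id_tensorHom] using this

lemma tpowAdd_assoc (X : K) (a b c p q r : ℕ) (h₁ : a + b = p) (h₂ : p + c = r) (h₃ : b + c = q)
    (h₄ : a + q = r) :
    (tpowAdd X a b p h₁).hom ▷ tpow X c ≫ (tpowAdd X p c r h₂).hom =
      (α_ _ _ _).hom ≫ tpow X a ◁ (tpowAdd X b c q h₃).hom ≫ (tpowAdd X a q r h₄).hom := by
  induction a generalizing p r with
  | zero =>
    obtain rfl : b = p := by omega
    obtain rfl : q = r := by omega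
    subst h₃
    simp [tpowAdd]
  | succ a ih =>
    obtain ⟨p, rfl⟩ : ∃ p', p = p' + 1 := ⟨a + b, by omega⟩
    obtain ⟨r, rfl⟩ : ∃ r', r = r' + 1 := ⟨p + c, by omega⟩
    have := ih p r (by omega) (by omega) (by omega)
    simp only [tpowAdd, Iso.trans_hom, whiskerLeftIso_hom, comp_whiskerRight, Category.assoc,
      whisker_assoc, Iso.inv_hom_id_assoc]
    rw [← MonoidalCategory.whiskerLeft_comp, this]
    simp

/-- The morphism `⊠ᵢ K(X ^ kᵢ, X) ⟶ K(X ^ (k₁ + ⋯ + kₙ), X ^ n)` given by the tensor product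
of `K`. -/
def tensorList {ι : Type*} (X : K) (κ : ι → ℕ) :
    ∀ (l : List ι) (s n : ℕ), (l.map κ).sum = s → l.length = n →
      (itens (fun i => tpow X (κ i) ⟶[D] X) l ⟶ (tpow X s ⟶[D] tpow X n))
  | [], 0, 0, _, _ => MonoidalDCategory.unit
  | [], s + 1, _, h, _ => absurd h (by simp)
  | [], 0, n + 1, _, h => absurd h (by simp)
  | i :: l, _, 0, _, h => absurd h (by simp)
  | i :: l, s, n + 1, h, h' =>
    (𝟙 (tpow X (κ i) ⟶[D] X) ⊠ₘ
        tensorList X κ l (l.map κ).sum n rfl (by simpa using h')) ≫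
      MonoidalDCategory.tensor (tpow X (κ i)) X (tpow X (l.map κ).sum) (tpow X n) ≫
      eHomWhiskerRight D (tpowAdd X (κ i) (l.map κ).sum s (by simpa using h)).inv
        (X ⊗ tpow X n)

lemma tensorList_nil {ι : Type*} (X : K) (κ : ι → ℕ) (h : (([] : List ι).map κ).sum = 0)
    (h' : ([] : List ι).length = 0) :
    tensorList D X κ [] 0 0 h h' = MonoidalDCategory.unit := by
  simp only [tensorList]

lemma tensorList_cons {ι : Type*} (X : K) (κ : ι → ℕ) (i : ι) (l : List ι) (s n t : ℕ)
    (h : ((i :: l).map κ).sum = s) (h' : (i :: l).length = n + 1) (ht : (l.map κ).sum = t)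
    (hn : l.length = n) (hs : κ i + t = s) :
    tensorList D X κ (i :: l) s (n + 1) h h' =
      (𝟙 (tpow X (κ i) ⟶[D] X) ⊠ₘ tensorList D X κ l t n ht hn) ≫
        MonoidalDCategory.tensor (tpow X (κ i)) X (tpow X t) (tpow X n) ≫
        eHomWhiskerRight D (tpowAdd X (κ i) t s hs).inv (X ⊗ tpow X n) := by
  subst ht
  rw [tensorList]

lemma tensorList_reindex {ι : Type*} (X : K) (κ : ι → ℕ) (l : List ι) (s n : ℕ)
    (h₁ : ((l.map κ).map id).sum = s) (h₂ : (l.map κ).length = n)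
    (h₃ : (l.map κ).sum = s) (h₄ : l.length = n) :
    itensReindex (fun k : ℕ => tpow X k ⟶[D] X) κ l ≫ tensorList D X id (l.map κ) s n h₁ h₂ =
      tensorList D X κ l s n h₃ h₄ := by
  induction l generalizing s n with
  | nil =>
    obtain rfl : s = 0 := by simpa using h₃.symm
    obtain rfl : n = 0 := by simpa using h₄.symm
    rw [tensorList_nil]
    erw [tensorList_nil]
    exact Category.id_comp _
  | cons i l ih =>
    obtain ⟨n, rfl⟩ : ∃ n', n = n' + 1 := ⟨l.length, by simpa using h₄.symm⟩
    have ih' := ih (l.map κ).sum n (by simp) (by simpa using h₂) rfl (by simpa using h₄)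
    rw [tensorList_cons D X κ i l s n (l.map κ).sum h₃ h₄ rfl (by simpa using h₄)
      (by simpa using h₃), ← ih']
    refine (congrArg (fun f => itensReindex (fun k : ℕ => tpow X k ⟶[D] X) κ (i :: l) ≫ f)
      (tensorList_cons D X id (κ i) (l.map κ) s n (l.map κ).sum h₁ h₂ (by simp)
        (by simpa using h₂) (by simpa using h₃))).trans ?_
    refine (ten_comp_assoc _ _ _ _ _).trans ?_
    change (𝟙 (tpow X (κ i) ⟶[D] X) ≫ 𝟙 (tpow X (κ i) ⟶[D] X) ⊠ₘ _) ≫ _ = _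
    rw [Category.comp_id]
    rfl

lemma tensorList_append {ι : Type*} (X : K) (κ : ι → ℕ) (l l' : List ι) (s n s₁ s₂ n₁ n₂ : ℕ)
    (h : ((l ++ l').map κ).sum = s) (h' : (l ++ l').length = n)
    (h₁ : (l.map κ).sum = s₁) (h₂ : l.length = n₁)
    (h₃ : (l'.map κ).sum = s₂) (h₄ : l'.length = n₂) (hs : s₁ + s₂ = s) (hn : n₁ + n₂ = n) :
    itensAppend (fun i => tpow X (κ i) ⟶[D] X) l l' ≫ tensorList D X κ (l ++ l') s n h h' =
      (tensorList D X κ l s₁ n₁ h₁ h₂ ⊠ₘ tensorList D X κ l' s₂ n₂ h₃ h₄) ≫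
        MonoidalDCategory.tensor (tpow X s₁) (tpow X n₁) (tpow X s₂) (tpow X n₂) ≫
        eHomWhiskerRight D (tpowAdd X s₁ s₂ s hs).inv _ ≫
        eHomWhiskerLeft D _ (tpowAdd X n₁ n₂ n hn).hom := by
  induction l generalizing s n s₁ n₁ with
  | nil =>
    obtain rfl : s₁ = 0 := by simpa using h₁.symm
    obtain rfl : n₁ = 0 := by simpa using h₂.symm
    obtain rfl : s₂ = s := by omega
    obtain rfl : n₂ = n := by omega
    rw [tensorList_nil]
    simp only [itensAppend, tpowAdd, List.nil_append]
    have key := MonoidalDCategory.leftUnitor_natural (D := D) (tpow X s₂) (tpow X n₂)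
    rw [Iso.inv_comp_eq] at key
    rw [show (MonoidalDCategory.unit (D := D) (K := K) ⊠ₘ tensorList D X κ l' s₂ n₂ h₃ h₄) =
      (𝟙 _ ⊠ₘ tensorList D X κ l' s₂ n₂ h₃ h₄) ≫ (MonoidalDCategory.unit ⊠ₘ 𝟙 _) by simp]
    simp only [eqToIso_refl, Iso.trans_refl]
    rw [← eHom_whisker_exchange, Category.assoc, ← Category.assoc (MonoidalDCategory.tensor _ _ _ _),
      ← Category.assoc (_ ⊠ₘ _) (_ ≫ _), key, Category.assoc, ← eHomWhiskerRight_comp,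
      Iso.inv_hom_id, eHomWhiskerRight_id, Category.comp_id, left₁_nat]
  | cons i l ih =>
    obtain ⟨n₁, rfl⟩ : ∃ n', n₁ = n' + 1 := ⟨l.length, by simpa using h₂.symm⟩
    obtain ⟨n, rfl⟩ : ∃ n', n = n' + 1 := ⟨n₁ + n₂, by omega⟩
    set t := (l.map κ).sum with ht
    have hl : l.length = n₁ := by simpa using h₂
    have hs₁ : κ i + t = s₁ := by simpa using h₁
    have hl' : (l ++ l').length = n := Nat.succ.inj h'
    have ih' := ih (t + s₂) n t n₁ (by simp [h₃, ht]) hl' rfl hl rfl (by omega)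
    rw [tensorList_cons D X κ i l s₁ n₁ t h₁ h₂ rfl hl hs₁]
    have hc := tensorList_cons D X κ i (l ++ l') s n (t + s₂) h h' (by simp [h₃, ht])
      hl' (by omega)
    refine (congrArg (fun f => itensAppend (fun i => tpow X (κ i) ⟶[D] X) (i :: l) l' ≫ f)
      hc).trans ?_
    simp only [itensAppend, Category.assoc]
    rw [ten_comp_assoc, Category.id_comp, ih']
    have co := tpowAdd_assoc X (κ i) t s₂ s₁ (t + s₂) s hs₁ hs rfl (by omega)
    have co' : (tpowAdd X (κ i) (t + s₂) s (by omega)).inv ≫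
        (𝟙 _ ⊗ₘ (tpowAdd X t s₂ (t + s₂) rfl).inv) =
        (tpowAdd X s₁ s₂ s hs).inv ≫ ((tpowAdd X (κ i) t s₁ hs₁).inv ⊗ₘ 𝟙 _) ≫
          (α_ _ _ _).hom := by
      rw [Iso.inv_comp_eq, ← cancel_epi (tpow X (κ i) ◁ (tpowAdd X t s₂ (t + s₂) rfl).hom),
        ← cancel_epi (α_ _ _ _).hom]
      simp only [← Category.assoc] at co ⊢
      rw [← co]
      simp
    have hA := MonoidalDCategory.associator_natural (D := D) (tpow X (κ i)) X (tpow X t)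
      (tpow X n₁) (tpow X s₂) (tpow X n₂)
    have e₁ : (𝟙 (tpow X (κ i) ⟶[D] X) ⊠ₘ
        (tensorList D X κ l t n₁ rfl hl ⊠ₘ tensorList D X κ l' s₂ n₂ h₃ h₄) ≫
          MonoidalDCategory.tensor (tpow X t) (tpow X n₁) (tpow X s₂) (tpow X n₂) ≫
          eHomWhiskerRight D (tpowAdd X t s₂ (t + s₂) rfl).inv _ ≫
          eHomWhiskerLeft D _ (tpowAdd X n₁ n₂ n (by omega)).hom) =
        (𝟙 _ ⊠ₘ (tensorList D X κ l t n₁ rfl hl ⊠ₘ tensorList D X κ l' s₂ n₂ h₃ h₄)) ≫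
        (𝟙 _ ⊠ₘ MonoidalDCategory.tensor (tpow X t) (tpow X n₁) (tpow X s₂) (tpow X n₂)) ≫
        (𝟙 _ ⊠ₘ eHomWhiskerRight D (tpowAdd X t s₂ (t + s₂) rfl).inv _) ≫
        (𝟙 _ ⊠ₘ eHomWhiskerLeft D _ (tpowAdd X n₁ n₂ n (by omega)).hom) := by
      simp only [ten_comp, Category.comp_id]
    have e₂ : ((𝟙 (tpow X (κ i) ⟶[D] X) ⊠ₘ tensorList D X κ l t n₁ rfl hl) ≫
          MonoidalDCategory.tensor (tpow X (κ i)) X (tpow X t) (tpow X n₁) ≫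
          eHomWhiskerRight D (tpowAdd X (κ i) t s₁ hs₁).inv (X ⊗ tpow X n₁) ⊠ₘ
          tensorList D X κ l' s₂ n₂ h₃ h₄) =
        ((𝟙 (tpow X (κ i) ⟶[D] X) ⊠ₘ tensorList D X κ l t n₁ rfl hl) ⊠ₘ
          tensorList D X κ l' s₂ n₂ h₃ h₄) ≫
        (MonoidalDCategory.tensor (tpow X (κ i)) X (tpow X t) (tpow X n₁) ⊠ₘ 𝟙 _) ≫
        (eHomWhiskerRight D (tpowAdd X (κ i) t s₁ hs₁).inv (X ⊗ tpow X n₁) ⊠ₘ 𝟙 _) := by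
      simp only [ten_comp, Category.comp_id]
    rw [e₁, e₂]
    simp only [Category.assoc]
    rw [← Category.assoc (𝟙 _ ⊠ₘ eHomWhiskerLeft D _ _), tensor_post_right, Category.assoc,
      ← Category.assoc (𝟙 _ ⊠ₘ eHomWhiskerRight D _ _), tensor_pre_right, Category.assoc,
      ← Category.assoc (eHomWhiskerRight D _ _ ⊠ₘ 𝟙 _), tensor_pre_left, Category.assoc]
    rw [← Category.assoc (assoc₁ _ _ _).hom, ← assoc₁_nat, Category.assoc]
    congr 1
    have : (tpowAdd X (n₁ + 1) n₂ (n + 1) hn).hom =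
        (α_ _ _ _).hom ≫ X ◁ (tpowAdd X n₁ n₂ n (by omega)).hom := rfl
    rw [this, eHomWhiskerLeft_comp, eHom_whisker_exchange, ← eHomWhiskerRight_comp_assoc,
      ← id_tensorHom (tpow X (κ i)), co', ← tensorHom_id]
    simp only [eHomWhiskerRight_comp, Category.assoc]
    rw [← eHom_whisker_exchange_assoc, ← eHom_whisker_exchange_assoc, ← reassoc_of% hA]

/-- The composition `⊠ᵢ K(X ^ kᵢ, X) ⊗ K(X ^ n, X) ⟶ K(X ^ (k₁ + ⋯ + kₙ), X)` of the endomorphism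
operad. -/
def endComp (X : K) (ks : List ℕ) :
    itens (fun k => tpow X k ⟶[D] X) ks ⊗ (tpow X ks.length ⟶[D] X) ⟶
      (tpow X ks.sum ⟶[D] X) :=
  (tensorList D X id ks ks.sum ks.length (by simp) rfl ⊗ₘ 𝟙 _) ≫ eComp D _ _ _

lemma endComp_cast (X : K) (ks : List ℕ) (s n : ℕ) (h₁ : (ks.map id).sum = s)
    (h₂ : ks.length = n) (h₃ : n = ks.length) (h₄ : ks.sum = s) :
    (𝟙 _ ⊗ₘ castHom (fun k => tpow X k ⟶[D] X) h₃) ≫ endComp D X ks ≫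
        castHom (fun k => tpow X k ⟶[D] X) h₄ =
      (tensorList D X id ks s n h₁ h₂ ⊗ₘ 𝟙 _) ≫ eComp D _ _ _ := by
  subst h₂ h₄
  simp [endComp]

lemma tensorList_flatten (X : K) (L : List (List ℕ)) (s n p : ℕ)
    (h₁ : (L.flatten.map id).sum = s) (h₂ : L.flatten.length = n)
    (h₃ : (L.map List.length).sum = n) (h₄ : L.length = p) (h₅ : (L.map List.sum).sum = s) :
    ((itensFlatten (fun k => tpow X k ⟶[D] X) L ≫ tensorList D X id L.flatten s n h₁ h₂) ⊗ₘ
        tensorList D X List.length L n p h₃ h₄) ≫ eComp D _ _ _ =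
      itensInter (fun l => itens (fun k => tpow X k ⟶[D] X) l)
          (fun l => tpow X l.length ⟶[D] X) L ≫
        itensMap (endComp D X) L ≫ tensorList D X List.sum L s p h₅ h₄ := by
  induction L generalizing s n p with
  | nil =>
    obtain rfl : s = 0 := by simpa using h₁.symm
    obtain rfl : n = 0 := by simpa using h₂.symm
    obtain rfl : p = 0 := by simpa using h₄.symm
    simp only [tensorList_nil, itensFlatten, itensInter, itensMap]
    erw [tensorList_nil]
    exact (congrArg (fun f => (f ⊗ₘ MonoidalDCategory.unit) ≫ eComp D _ _ _)
      (Category.id_comp (MonoidalDCategory.unit (D := D) (K := K)))).trans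
      (MonoidalDCategory.unit_comp.trans (congrArg (fun f => vMul ≫ f) (Category.id_comp _).symm))
  | cons l L ih =>
    obtain ⟨p, rfl⟩ : ∃ p', p = p' + 1 := ⟨L.length, by simpa using h₄.symm⟩
    have hp : L.length = p := Nat.succ.inj h₄
    set t := (L.map List.sum).sum with ht
    set q := (L.map List.length).sum with hq
    have hs : l.sum + t = s := by simpa using h₅
    have hn : l.length + q = n := by simpa using h₃
    have hf : (L.flatten.map id).sum = t := by simp [ht, List.sum_flatten]
    have hg : L.flatten.length = q := by simp [hq, List.length_flatten]
    have ih' := ih t q p hf hg rfl hp rfl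
    have hA := tensorList_append D X id l L.flatten s n l.sum t l.length q h₁ h₂ (by simp) rfl
      hf hg hs hn
    rw [tensorList_cons D X List.length l L n p q h₃ h₄ rfl hp hn,
      tensorList_cons D X List.sum l L s p t h₅ h₄ rfl hp hs]
    have hB : itensFlatten (fun k => tpow X k ⟶[D] X) (l :: L) ≫
        tensorList D X id (l :: L).flatten s n h₁ h₂ =
        (tensorList D X id l l.sum l.length (by simp) rfl ⊠ₘ
          (itensFlatten (fun k => tpow X k ⟶[D] X) L ≫ tensorList D X id L.flatten t q hf hg)) ≫
        MonoidalDCategory.tensor (tpow X l.sum) (tpow X l.length) (tpow X t) (tpow X q) ≫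
        eHomWhiskerRight D (tpowAdd X l.sum t s hs).inv _ ≫
        eHomWhiskerLeft D _ (tpowAdd X l.length q n hn).hom := by
      refine (Category.assoc _ _ _).trans ?_
      refine (congrArg (fun f => (𝟙 _ ⊠ₘ itensFlatten _ L) ≫ f) hA).trans ?_
      rw [ten_comp_assoc, Category.id_comp]
      rfl
    rw [hB]
    set G := itensFlatten (fun k => tpow X k ⟶[D] X) L ≫ tensorList D X id L.flatten t q hf hg
    set α := tpowAdd X l.length q n hn
    have e₁ : (((tensorList D X id l l.sum l.length (by simp) rfl ⊠ₘ G) ≫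
        MonoidalDCategory.tensor (tpow X l.sum) (tpow X l.length) (tpow X t) (tpow X q) ≫
        eHomWhiskerRight D (tpowAdd X l.sum t s hs).inv _ ≫ eHomWhiskerLeft D _ α.hom) ⊗ₘ
        ((𝟙 (tpow X l.length ⟶[D] X) ⊠ₘ tensorList D X List.length L q p rfl hp) ≫
        MonoidalDCategory.tensor (tpow X l.length) X (tpow X q) (tpow X p) ≫
        eHomWhiskerRight D α.inv (X ⊗ tpow X p))) =
      ((tensorList D X id l l.sum l.length (by simp) rfl ⊠ₘ G) ⊗ₘ
        (𝟙 (tpow X l.length ⟶[D] X) ⊠ₘ tensorList D X List.length L q p rfl hp)) ≫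
      (MonoidalDCategory.tensor (tpow X l.sum) (tpow X l.length) (tpow X t) (tpow X q) ⊗ₘ
        MonoidalDCategory.tensor (tpow X l.length) X (tpow X q) (tpow X p)) ≫
      (eHomWhiskerRight D (tpowAdd X l.sum t s hs).inv _ ▷ _) ≫
      (eHomWhiskerLeft D _ α.hom ▷ _) ≫ (_ ◁ eHomWhiskerRight D α.inv (X ⊗ tpow X p)) := by
      simp only [← tensorHom_id, ← id_tensorHom, tensorHom_comp_tensorHom, Category.comp_id,
        Category.id_comp, Category.assoc]
    refine (congrArg (fun f => f ≫ eComp D (tpow X s) (tpow X n) (X ⊗ tpow X p)) e₁).trans ?_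
    simp only [Category.assoc]
    rw [eHom_whisker_cancel, ← eComp_eHomWhiskerRight, ← Category.assoc (_ ⊗ₘ _) (eComp _ _ _ _),
      MonoidalDCategory.tensor_comp]
    simp only [Category.assoc]
    rw [← Category.assoc (_ ⊗ₘ _) (inter _ _ _ _), inter_nat, Category.assoc, ten_comp_assoc, ih']
    simp only [itensInter, itensMap, Category.assoc]
    rw [ten_comp_assoc, ten_comp_assoc]
    simp only [Category.id_comp, Category.comp_id, Category.assoc]
    rfl

lemma eHomEquiv_pre {X Y Z : K} (g : X ⟶ Y) (f : Y ⟶ Z) :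
    eHomEquiv D f ≫ eHomWhiskerRight D g Z = eHomEquiv D (g ≫ f) := by
  rw [eHomWhiskerRight, eHomEquiv_comp, leftUnitor_inv_naturality_assoc,
    ← tensorHom_def'_assoc]

lemma tpowAdd_zero (X : K) (k : ℕ) : (tpowAdd X k 0 k rfl).hom = (ρ_ (tpow X k)).hom := by
  induction k with
  | zero => simp [tpowAdd, unitors_equal]
  | succ k ih =>
    simp only [tpowAdd, Iso.trans_hom, whiskerLeftIso_hom, ih]
    simp

lemma unitList_tensorList (X : K) (k : ℕ) (h : ((List.replicate k 1).map id).sum = k)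
    (h' : (List.replicate k 1).length = k) :
    unitList (fun n => tpow X n ⟶[D] X) (eHomEquiv D (ρ_ X).hom) k ≫
      tensorList D X id (List.replicate k 1) k k h h' = eId D (tpow X k) := by
  induction k with
  | zero =>
    erw [tensorList_nil]
    exact MonoidalDCategory.unit_id
  | succ k ih =>
    have hc : tensorList D X id (1 :: List.replicate k 1) (k + 1) (k + 1) h h' =
        (𝟙 (tpow X 1 ⟶[D] X) ⊠ₘ tensorList D X id (List.replicate k 1) k k (by simp) (by simp)) ≫
        MonoidalDCategory.tensor (tpow X 1) X (tpow X k) (tpow X k) ≫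
        eHomWhiskerRight D (tpowAdd X 1 k (k + 1) (by omega)).inv (X ⊗ tpow X k) :=
      tensorList_cons D X id 1 (List.replicate k 1) (k + 1) k k h h' (by simp) (by simp)
        (by simp [add_comm])
    refine (congrArg (fun f => unitList (fun n => tpow X n ⟶[D] X) (eHomEquiv D (ρ_ X).hom)
      (k + 1) ≫ f) hc).trans ?_
    simp only [unitList, Category.assoc]
    rw [ten_comp_assoc, ih, ← eHomEquiv_id, Category.comp_id]
    have := MonoidalDCategory.tensor_homEquiv (D := D) (ρ_ X).hom (𝟙 (tpow X k))
    rw [← Category.assoc, ← Category.assoc]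
    rw [Category.assoc eComul]
    refine (congrArg (fun f => f ≫ eHomWhiskerRight D
      (tpowAdd X 1 k (k + 1) (by omega)).inv _) this.symm).trans ?_
    rw [eHomEquiv_pre, ← eHomEquiv_id]
    congr 1
    rw [Iso.inv_comp_eq]
    simp [tpowAdd]

/-- The endomorphism 1-operad of `X`, with components `K(X ^ n, X)`. -/
def endOperad (X : K) : OneOperad D where
  obj n := tpow X n ⟶[D] X
  γ := endComp D X
  unit := eHomEquiv D (ρ_ X).hom
  assoc L := by
    have h₁ := endComp_cast D X (L.map List.length) L.flatten.length L.length
      (by simp [List.length_flatten]) (by simp) (List.length_map List.length).symm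
      (length_flatten_eq L)
    have h₂ := endComp_cast D X (L.map List.sum) L.flatten.sum L.length
      (by simp [List.sum_flatten]) (by simp) (List.length_map List.sum).symm
      (sum_flatten_eq L)
    have r₁ := tensorList_reindex D X List.length L L.flatten.length L.length
      (by simp [List.length_flatten]) (by simp) (length_flatten_eq L) rfl
    have r₂ := tensorList_reindex D X List.sum L L.flatten.sum L.length
      (by simp [List.sum_flatten]) (by simp) (sum_flatten_eq L) rfl
    have k := tensorList_flatten D X L L.flatten.sum L.flatten.length L.length (by simp) rfl
      (length_flatten_eq L) rfl (sum_flatten_eq L)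
    have s₁ : (itensReindex (fun k => tpow X k ⟶[D] X) List.length L ⊗ₘ
        castHom (fun k => tpow X k ⟶[D] X) (List.length_map List.length).symm) ≫
        endComp D X (L.map List.length) ≫
        castHom (fun k => tpow X k ⟶[D] X) (length_flatten_eq L) =
        (tensorList D X List.length L L.flatten.length L.length (length_flatten_eq L) rfl ⊗ₘ
          𝟙 _) ≫ eComp D _ _ _ := by
      rw [← r₁, ← Category.comp_id (𝟙 (tpow X L.length ⟶[D] X)), ← tensorHom_comp_tensorHom,
        Category.assoc, ← h₁, tensorHom_comp_tensorHom_assoc, Category.comp_id, Category.id_comp]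
    have s₂ : ∀ {Z : D} (g : Z ⟶ itens (fun l => tpow X (List.sum l) ⟶[D] X) L),
        ((g ≫ itensReindex (fun k => tpow X k ⟶[D] X) List.sum L) ⊗ₘ
        castHom (fun k => tpow X k ⟶[D] X) (List.length_map List.sum).symm) ≫
        endComp D X (L.map List.sum) ≫
        castHom (fun k => tpow X k ⟶[D] X) (sum_flatten_eq L) =
        ((g ≫ tensorList D X List.sum L L.flatten.sum L.length (sum_flatten_eq L) rfl) ⊗ₘ
          𝟙 _) ≫ eComp D _ _ _ := by
      intro Z g
      rw [← r₂, ← Category.assoc g, ← Category.comp_id (𝟙 (tpow X L.length ⟶[D] X)),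
        ← tensorHom_comp_tensorHom, Category.assoc, ← h₂, tensorHom_comp_tensorHom_assoc,
        Category.comp_id, Category.id_comp]
    rw [s₁]
    have s₂' := s₂ (itensInter (fun l => itens (fun k => tpow X k ⟶[D] X) l)
          (fun l => tpow X l.length ⟶[D] X) L ≫ itensMap (endComp D X) L)
    simp only [Category.assoc] at s₂'
    rw [s₂', ← k]
    rw [show ((itensFlatten (fun k => tpow X k ⟶[D] X) L ≫ tensorList D X id L.flatten
        L.flatten.sum L.flatten.length (by simp) rfl ⊗ₘ
        tensorList D X List.length L L.flatten.length L.length (length_flatten_eq L) rfl) ≫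
        eComp D _ _ _) ⊗ₘ 𝟙 (tpow X L.length ⟶[D] X) =
      ((itensFlatten (fun k => tpow X k ⟶[D] X) L ≫ tensorList D X id L.flatten
        L.flatten.sum L.flatten.length (by simp) rfl ⊗ₘ
        tensorList D X List.length L L.flatten.length L.length (length_flatten_eq L) rfl) ⊗ₘ
        𝟙 (tpow X L.length ⟶[D] X)) ≫ (eComp D _ _ _ ▷ _) by
      rw [← tensorHom_id, tensorHom_comp_tensorHom, Category.comp_id]]
    rw [Category.assoc, ← associator_inv_naturality_assoc, e_assoc, endComp,
      tensorHom_comp_tensorHom_assoc, ← id_tensorHom, tensorHom_comp_tensorHom_assoc,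
      Category.comp_id, Category.comp_id]
  unit_comp k := by
    rw [← Category.comp_id (unitList _ _ k), ← Category.id_comp (castHom _ _),
      ← tensorHom_comp_tensorHom, Category.assoc,
      endComp_cast D X (List.replicate k 1) k k (by simp) (by simp) (by simp) (by simp),
      tensorHom_comp_tensorHom_assoc, unitList_tensorList]
    have := e_id_comp D (tpow X k) X
    rw [Iso.inv_comp_eq] at this
    simpa using this
  comp_unit k := by
    have hc : tensorList D X id [k] [k].sum [k].length (by simp) rfl =
        (𝟙 (tpow X k ⟶[D] X) ⊠ₘ MonoidalDCategory.unit) ≫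
        MonoidalDCategory.tensor (tpow X k) X (𝟙_ K) (𝟙_ K) ≫
        eHomWhiskerRight D (tpowAdd X k 0 k rfl).inv (X ⊗ 𝟙_ K) := by
      refine (tensorList_cons D X id k [] [k].sum 0 0 (by simp) rfl rfl rfl (by simp)).trans ?_
      exact congrArg (fun f => (𝟙 (tpow X k ⟶[D] X) ⊠ₘ f) ≫
        MonoidalDCategory.tensor (tpow X k) X (𝟙_ K) (𝟙_ K) ≫
        eHomWhiskerRight D (tpowAdd X k 0 k rfl).inv (X ⊗ 𝟙_ K)) (tensorList_nil D X id rfl rfl)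
    have hr := MonoidalDCategory.rightUnitor_natural (D := D) (tpow X k) X
    have he : ∀ {A : D} {Y : K} (f : A ⟶ (Y ⟶[D] (X ⊗ 𝟙_ K))),
        (f ⊗ₘ eHomEquiv D (ρ_ X).hom) ≫ eComp D _ _ _ =
        (ρ_ A).hom ≫ f ≫ eHomWhiskerLeft D _ (ρ_ X).hom := by
      intro A Y f
      rw [eHomWhiskerLeft, ← rightUnitor_naturality_assoc, Iso.hom_inv_id_assoc, tensorHom_def_assoc]
    rw [show endComp D X [k] = _ from rfl, endComp]
    refine (tensorHom_comp_tensorHom_assoc _ _ _ _ _).trans ?_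
    refine (congrArg (fun f => ((right₁ (tpow X k ⟶[D] X)).inv ≫
      tensorList D X id [k] [k].sum [k].length (by simp) rfl ⊗ₘ f) ≫ eComp D _ _ _)
      (Category.comp_id (eHomEquiv D (ρ_ X).hom))).trans ?_
    refine (congrArg (fun f => ((right₁ (tpow X k ⟶[D] X)).inv ≫ f ⊗ₘ
      eHomEquiv D (ρ_ X).hom) ≫ eComp D _ _ _) hc).trans ?_
    refine (he _).trans ?_
    change (ρ_ _).hom ≫ ((right₁ (tpow X k ⟶[D] X)).inv ≫ (𝟙 _ ⊠ₘ MonoidalDCategory.unit) ≫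
      MonoidalDCategory.tensor (tpow X k) X (𝟙_ K) (𝟙_ K) ≫
      eHomWhiskerRight D (tpowAdd X k 0 k rfl).inv (X ⊗ 𝟙_ K)) ≫
      eHomWhiskerLeft D (tpow X k) (ρ_ X).hom = (ρ_ (tpow X k ⟶[D] X)).hom
    simp only [Category.assoc]
    rw [← eHom_whisker_exchange, reassoc_of% hr, ← eHomWhiskerRight_comp, ← tpowAdd_zero,
      Iso.inv_hom_id, eHomWhiskerRight_id, Category.comp_id]

lemma eComp_middle {W X Y Z : K} (g : X ⟶ Y) :
    ((W ⟶[D] X) ◁ eHomWhiskerRight D g Z) ≫ eComp D W X Z =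
      (eHomWhiskerLeft D W g ▷ (Y ⟶[D] Z)) ≫ eComp D W Y Z := by
  simp only [eHomWhiskerLeft, eHomWhiskerRight, MonoidalCategory.whiskerLeft_comp,
    comp_whiskerRight, Category.assoc]
  rw [← e_assoc, associator_inv_naturality_middle_assoc]
  simp

variable {D}

/-- The iterated multiplication `M ^ n ⟶ M`. -/
def DMonoid.mulPow {M : K} (S : DMonoid D M) : ∀ n : ℕ, tpow M n ⟶ M
  | 0 => S.one
  | n + 1 => (M ◁ S.mulPow n) ≫ S.mul

lemma DMonoid.mulPow_add {M : K} (S : DMonoid D M) (a b c : ℕ) (h : a + b = c) :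
    (tpowAdd M a b c h).hom ≫ S.mulPow c = (S.mulPow a ⊗ₘ S.mulPow b) ≫ S.mul := by
  induction a generalizing c with
  | zero =>
    obtain rfl : b = c := by omega
    have := S.one_mul
    simp only [tpowAdd, DMonoid.mulPow]
    rw [tensorHom_def', Category.assoc, this]
    simp
  | succ a ih =>
    obtain ⟨c, rfl⟩ : ∃ c', c = c' + 1 := ⟨a + b, by omega⟩
    have := S.mul_assoc
    simp only [tpowAdd, DMonoid.mulPow, Iso.trans_hom, whiskerLeftIso_hom, Category.assoc]
    rw [← MonoidalCategory.whiskerLeft_comp_assoc, ih,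
      show (M ◁ S.mulPow a ≫ S.mul ⊗ₘ S.mulPow b) =
        ((M ◁ S.mulPow a) ⊗ₘ S.mulPow b) ≫ (S.mul ▷ M) by
          rw [← tensorHom_id, tensorHom_comp_tensorHom, Category.comp_id], Category.assoc, this]
    rw [← id_tensorHom, ← id_tensorHom, ← id_tensorHom, associator_naturality_assoc,
      tensorHom_comp_tensorHom_assoc, Category.id_comp]

lemma DMonoid.tensorList_mulPow {M : K} (S : DMonoid D M) (l : List ℕ) (s n : ℕ)
    (h : (l.map id).sum = s) (h' : l.length = n) :
    itensMap (fun k => S.u ≫ eHomWhiskerRight D (S.mulPow k) M) l ≫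
        tensorList D M id l s n h h' ≫ eHomWhiskerLeft D _ (S.mulPow n) =
      vCollapse l ≫ S.u ≫ eHomWhiskerRight D (S.mulPow s) M := by
  induction l generalizing s n with
  | nil =>
    obtain rfl : s = 0 := by simpa using h.symm
    obtain rfl : n = 0 := by simpa using h'.symm
    refine (Category.id_comp _).trans ?_
    refine Eq.trans ?_ (Category.id_comp _).symm
    rw [tensorList_nil]
    exact S.u_one.symm
  | cons k l ih =>
    obtain ⟨n, rfl⟩ : ∃ n', n = n' + 1 := ⟨l.length, by simpa using h'.symm⟩
    have hn : l.length = n := Nat.succ.inj h'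
    obtain ⟨t, ht⟩ : ∃ t, (l.map id).sum = t := ⟨_, rfl⟩
    have hs : k + t = s := by rw [← h, ← ht]; simp
    have hc : tensorList D M id (k :: l) s (n + 1) h h' =
        (𝟙 (tpow M k ⟶[D] M) ⊠ₘ tensorList D M id l t n ht hn) ≫
        MonoidalDCategory.tensor (tpow M k) M (tpow M t) (tpow M n) ≫
        eHomWhiskerRight D (tpowAdd M k t s hs).inv (M ⊗ tpow M n) :=
      tensorList_cons D M id k l s n t h h' ht hn hs
    have ih' := ih t n ht hn
    rw [hc]
    simp only [itensMap, vCollapse, Category.assoc]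
    rw [ten_comp_assoc, Category.comp_id, ← eHom_whisker_exchange]
    have hm : eHomWhiskerLeft D (tpow M k ⊗ tpow M t) (S.mulPow (n + 1)) =
        eHomWhiskerLeft D _ (M ◁ S.mulPow n) ≫ eHomWhiskerLeft D _ S.mul := by
      rw [← eHomWhiskerLeft_comp]
      rfl
    rw [hm, Category.assoc, ← reassoc_of% (tensor_post_right D (S.mulPow n)), ten_comp_assoc,
      Category.comp_id]
    simp only [Category.assoc]
    rw [ih']
    have e₁ : (S.u ≫ eHomWhiskerRight D (S.mulPow k) M ⊠ₘ
        vCollapse l ≫ S.u ≫ eHomWhiskerRight D (S.mulPow t) M) =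
        (𝟙 _ ⊠ₘ vCollapse l) ≫ (S.u ⊠ₘ S.u) ≫
        (eHomWhiskerRight D (S.mulPow k) M ⊠ₘ eHomWhiskerRight D (S.mulPow t) M) := by
      simp only [ten_comp, Category.id_comp]
    have hu := S.u_mul
    rw [Iso.eq_inv_comp] at hu
    rw [e₁]
    simp only [Category.assoc]
    rw [reassoc_of% (tensor_pre D (S.mulPow k) (S.mulPow t)), ← eHom_whisker_exchange_assoc,
      ← reassoc_of% hu, ← eHomWhiskerRight_comp, ← eHomWhiskerRight_comp, Category.assoc,
      ← S.mulPow_add k t s hs,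
      Iso.inv_hom_id_assoc]

/-- The multiplicative structure of the endomorphism operad of a monoid. -/
def DMonoid.toOperadHom {M : K} (S : DMonoid D M) : OperadHom (assOperad D) (endOperad D M) where
  app n := S.u ≫ eHomWhiskerRight D (S.mulPow n) M
  app_unit := by
    refine (Category.assoc _ _ _).symm.trans ?_
    refine (congrArg (fun f => f ≫ eHomWhiskerRight D (S.mulPow 1) M) S.u_id).trans ?_
    rw [← eHomEquiv_id, eHomEquiv_pre, Category.comp_id]
    exact congrArg (eHomEquiv D) S.mul_one
  app_γ ks := by
    change ((vCollapse ks ⊗ₘ 𝟙 (vUnit D)) ≫ vMul) ≫ S.u ≫ eHomWhiskerRight D (S.mulPow ks.sum) M =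
      (itensMap (fun k => S.u ≫ eHomWhiskerRight D (S.mulPow k) M) ks ⊗ₘ
        (S.u ≫ eHomWhiskerRight D (S.mulPow ks.length) M)) ≫ endComp D M ks
    have key := S.tensorList_mulPow ks ks.sum ks.length (by simp) rfl
    rw [endComp, tensorHom_comp_tensorHom_assoc, Category.comp_id]
    have e₁ : (itensMap (fun k => S.u ≫ eHomWhiskerRight D (S.mulPow k) M) ks ≫
        tensorList D M id ks ks.sum ks.length (by simp) rfl ⊗ₘ
        S.u ≫ eHomWhiskerRight D (S.mulPow ks.length) M) =
        ((itensMap (fun k => S.u ≫ eHomWhiskerRight D (S.mulPow k) M) ks ≫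
        tensorList D M id ks ks.sum ks.length (by simp) rfl) ⊗ₘ S.u) ≫
        (_ ◁ eHomWhiskerRight D (S.mulPow ks.length) M) := by
      rw [← id_tensorHom, tensorHom_comp_tensorHom, Category.comp_id]
    rw [e₁]
    simp only [Category.assoc]
    rw [eComp_middle, ← tensorHom_id, tensorHom_comp_tensorHom_assoc, Category.comp_id]
    simp only [Category.assoc]
    rw [key]
    have e₂ : (vCollapse ks ≫ S.u ≫ eHomWhiskerRight D (S.mulPow ks.sum) M ⊗ₘ S.u) =
        (vCollapse ks ⊗ₘ 𝟙 _) ≫ (S.u ⊗ₘ S.u) ≫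
          (eHomWhiskerRight D (S.mulPow ks.sum) M ▷ _) := by
      rw [← tensorHom_id, tensorHom_comp_tensorHom, tensorHom_comp_tensorHom, Category.comp_id,
        Category.id_comp]
    rw [e₂]
    simp only [Category.assoc]
    rw [← eComp_eHomWhiskerRight, reassoc_of% S.u_comp]

end MonoidalDCategory

/-- The duoid structure `S` on the Hochschild object `T` has the canonical structure morphisms:
composed with the projection `π : T ⟶ A 0`, the two multiplications, the unit `v ⟶ T` and
the unit `e ⟶ T` are the displayed composites. -/
structure IsCanonicalDuoid {V : Type u'} [Category.{v'} V] [MonoidalCategory V]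
    [SymmetricCategory V] [MonoidalClosed V] {D : Type u} [Category.{v} D] [DuoidalCategory D]
    [EnrichedOrdinaryCategory V D] [Cotensored V D] {A : OneOperad D}
    {m : OperadHom (assOperad D) A} {C : InducedCosimplicial m}
    (T : Totalization V (unitCosimplicial V) C.X) (S : DuoidStruct T.wedge.pt) : Prop where
  /-- `T ⊗ T ⟶ A 0 ⊗ A 0 ⟶ A 1 ⊗ A 1 ⟶ A 1 ⟶ A 0` -/
  mul₀_proj : S.mul₀ ≫ T.proj 0 ≫ (C.iso 0).hom =
    ((T.proj 0 ≫ (C.iso 0).hom ≫ m.coface 0 0 ≫ (right₁ (A.obj 1)).inv) ⊗ₘ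
      (T.proj 0 ≫ (C.iso 0).hom ≫ m.coface 0 0)) ≫ A.γ [1] ≫ m.codegeneracy 0 0
  /-- `T ⊠ T ⟶ A 0 ⊠ A 0 ≅ (A 0 ⊠ A 0) ⊗ e ⟶ (A 0 ⊠ A 0) ⊗ v ⟶ (A 0 ⊠ A 0) ⊗ A 2 ⟶ A 0` -/
  mul₁_proj : S.mul₁ ≫ T.proj 0 ≫ (C.iso 0).hom =
    ((T.proj 0 ≫ (C.iso 0).hom) ⊠ₘ (T.proj 0 ≫ (C.iso 0).hom)) ≫ (ρ_ (A.obj 0 ⊠ A.obj 0)).inv ≫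
      ((𝟙 (A.obj 0) ⊠ₘ (right₁ (A.obj 0)).inv) ⊗ₘ (unitMap ≫ m.mulMap 2)) ≫ A.γ [0, 0]
  /-- `v ⟶ A 1 ⟶ A 0` -/
  one₁_proj : S.one₁ ≫ T.proj 0 ≫ (C.iso 0).hom = m.mulMap 1 ≫ m.codegeneracy 0 0
  /-- `e ⟶ v ⟶ T` -/
  one₀_eq : S.one₀ = unitMap ≫ S.one₁

end DuoidalCenter

open DuoidalCenter

universe w w' v u v' u'

/-! Since δ is constant at the unit I and y^I ≅ y, the totalization is the conical limit of the
cosimplicial object over Δ. A limit over Δ is the equalizer of the two cofaces out of level 0: each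
leg is reached from [0] along a vertex, and any two vertices of [n] are joined by an edge. So π
exhibits Z = CH_I(A) as the equalizer of d_0, d_1 : A(0) ⇉ A(1) (`Totalization.isCenter`). In
particular π is monic, which gives uniqueness at once and lets each duoid axiom be checked after
composing with π. What remains is existence, `IsCenter.existsUnique_duoidStruct`, a computation with
"elements" of A.

Inserting e → v → A(2) in the composition gives products A(a) ⊠ A(b) → A(a+b) (`mu`), associative
and with unit m_0, for which m_j m_k = m_{j+k}. The outer cofaces are left and right multiplication
by m_1, so Z consists of the f in A(0) with m_1 f = f m_1. It is a centre, and it is closed under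
the product.

The other multiplication lives in A(1), which is a ⊗-monoid under composition and acts on every A(n)
(`act`). Let d : A(1) → A(2) be the middle coface (`doubling`), and call x in A(1) balanced if m_1 x
= d x = x m_1. If f is central, m_1 f is balanced; conversely s_0 of a balanced x is central, and
multiplying it by m_1 returns x. Balanced elements are closed under composition (`Balanced.act`), so
the ⊗-monoid structure of A(1) passes to Z along f ↦ m_1 f. The duoid interchange follows from (m_1
f)(m_1 g) = d(m_1 f g) (`mu_lmul_doubling`), the operadic interchange (`inter_act`), and two rules
which move d from the second factor of a composite to the first and then out of the composite
(`doubling_act₂`, `act_doubling`).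

The identities used for A come from the operad axioms and from m being an operad map. Associativity
concerns three levels (leaves, middle vertices, root), and putting the elements e → v → A(n) on one
or two of them gives the needed formulas. With units on the leaves and in the middle one obtains the
composition law of the inner operators (`inner_inner`).

For the cosimplicial object no generators and relations are needed. A map f : [p] → [q] acts by
multiplying with m_1 on both sides and then applying the inner operator of the list of gaps f(0),
f(1) − f(0), …, q − f(p). Partial sums turn composition of inner operators into composition of
functions, so functoriality is arithmetic (`framed_comp`). -/

namespace DuoidalCenter

open DuoidalCategory

/-! ### Families of units e → A(i) and the iterated interchange -/

section Units

variable {D : Type u} [Category.{v} D] [DuoidalCategory D]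

lemma tensorHom_split {X X' Y Y' : D} (f : X ⟶ X') (g : Y ⟶ Y') :
    (f ⊗ₘ g) = (f ⊗ₘ 𝟙 Y) ≫ (𝟙 X' ⊗ₘ g) := by
  rw [tensorHom_comp_tensorHom, Category.comp_id, Category.id_comp]

lemma tensorHom_split' {X X' Y Y' : D} (f : X ⟶ X') (g : Y ⟶ Y') :
    (f ⊗ₘ g) = (𝟙 X ⊗ₘ g) ≫ (f ⊗ₘ 𝟙 Y') := by
  rw [tensorHom_comp_tensorHom, Category.comp_id, Category.id_comp]

lemma tensorHom_comp_right {X X' Y Y' Y'' : D} (f : X ⟶ X') (g : Y ⟶ Y') (h : Y' ⟶ Y'') :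
    (f ⊗ₘ (g ≫ h)) = (𝟙 X ⊗ₘ g) ≫ (f ⊗ₘ h) := by
  rw [tensorHom_comp_tensorHom, Category.id_comp]

lemma tensorHom_comp_left {X X' X'' Y Y' : D} (f : X ⟶ X') (g : X' ⟶ X'') (h : Y ⟶ Y') :
    ((f ≫ g) ⊗ₘ h) = (f ⊗ₘ 𝟙 Y) ≫ (g ⊗ₘ h) := by
  rw [tensorHom_comp_tensorHom, Category.id_comp]

lemma tenHom_split {X X' Y Y' : D} (f : X ⟶ X') (g : Y ⟶ Y') :
    (f ⊠ₘ g) = (f ⊠ₘ 𝟙 Y) ≫ (𝟙 X' ⊠ₘ g) := by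
  rw [ten_comp, Category.comp_id, Category.id_comp]

lemma tenHom_split' {X X' Y Y' : D} (f : X ⟶ X') (g : Y ⟶ Y') :
    (f ⊠ₘ g) = (𝟙 X ⊠ₘ g) ≫ (f ⊠ₘ 𝟙 Y') := by
  rw [ten_comp, Category.comp_id, Category.id_comp]

lemma tenHom_comp_right {X X' Y Y' Y'' : D} (f : X ⟶ X') (g : Y ⟶ Y') (h : Y' ⟶ Y'') :
    (f ⊠ₘ (g ≫ h)) = (𝟙 X ⊠ₘ g) ≫ (f ⊠ₘ h) := by
  rw [ten_comp, Category.id_comp]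

lemma tenHom_comp_left {X X' X'' Y Y' : D} (f : X ⟶ X') (g : X' ⟶ X'') (h : Y ⟶ Y') :
    ((f ≫ g) ⊠ₘ h) = (f ⊠ₘ 𝟙 Y) ≫ (g ⊠ₘ h) := by
  rw [ten_comp, Category.id_comp]

lemma eComul_unitMap :
    eComul (D := D) ≫ (unitMap ⊠ₘ unitMap) = unitMap ≫ (left₁ (vUnit D)).inv := by
  rw [Iso.eq_comp_inv, show (unitMap (D := D) ⊠ₘ unitMap) = (unitMap ⊠ₘ 𝟙 _) ≫ (𝟙 _ ⊠ₘ unitMap) by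
    simp, Category.assoc, Category.assoc, left₁_nat, ← Category.assoc, ← Category.assoc,
    Category.assoc eComul, counit_eComul, Category.id_comp]

lemma left₁_inv_nat {X X' : D} (f : X ⟶ X') :
    f ≫ (left₁ X').inv = (left₁ X).inv ≫ (𝟙 (vUnit D) ⊠ₘ f) := by
  rw [Iso.comp_inv_eq, Category.assoc, left₁_nat, Iso.inv_hom_id_assoc]

lemma right₁_inv_nat {X X' : D} (f : X ⟶ X') :
    f ≫ (right₁ X').inv = (right₁ X).inv ≫ (f ⊠ₘ 𝟙 (vUnit D)) := by
  rw [Iso.comp_inv_eq, Category.assoc, right₁_nat, Iso.inv_hom_id_assoc]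

/-- The morphism `e ⟶ e ⊠ ⋯ ⊠ e ⟶ A i₁ ⊠ ⋯ ⊠ A iₙ` induced by morphisms `e ⟶ A i`. -/
def eList {ι : Type*} {A : ι → D} (f : ∀ i, 𝟙_ D ⟶ A i) : ∀ l : List ι, 𝟙_ D ⟶ itens A l
  | [] => unitMap
  | i :: l => eComul ≫ (f i ⊠ₘ eList f l)

/-- `⊠ᵢ A i ⟶ ⊠ᵢ B (κ i)`, with target indexed by the mapped list. -/
def itensTo {ι κ : Type*} {A : ι → D} {B : κ → D} {σ : ι → κ} (f : ∀ i, A i ⟶ B (σ i)) :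
    ∀ l : List ι, itens A l ⟶ itens B (l.map σ)
  | [] => 𝟙 _
  | i :: l => f i ⊠ₘ itensTo f l

lemma itensMap_reindex {ι κ : Type*} {A : ι → D} {B : κ → D} {σ : ι → κ}
    (f : ∀ i, A i ⟶ B (σ i)) (l : List ι) :
    itensMap f l ≫ itensReindex B σ l = itensTo f l := by
  induction l with
  | nil => exact Category.id_comp _
  | cons i l ih =>
    refine (ten_comp _ _ _ _).trans ?_
    rw [ih, Category.comp_id]
    rfl

lemma itensMap_to {ι κ : Type*} {A B : ι → D} {C : κ → D} {σ : ι → κ}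
    (f : ∀ i, A i ⟶ B i) (g : ∀ i, B i ⟶ C (σ i)) (l : List ι) :
    itensMap f l ≫ itensTo g l = itensTo (fun i => f i ≫ g i) l := by
  rw [← itensMap_reindex, ← itensMap_reindex, ← itensMap_comp, Category.assoc]

lemma eList_map {ι : Type*} {A B : ι → D} (f : ∀ i, 𝟙_ D ⟶ A i) (h : ∀ i, A i ⟶ B i)
    (l : List ι) : eList f l ≫ itensMap h l = eList (fun i => f i ≫ h i) l := by
  induction l with
  | nil => exact Category.comp_id _
  | cons i l ih => simp [eList, itensMap, ih]

lemma eList_reindex {ι κ : Type*} {A : κ → D} (f : ∀ i, 𝟙_ D ⟶ A i) (σ : ι → κ) (l : List ι) :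
    eList (fun i => f (σ i)) l ≫ itensReindex A σ l = eList f (l.map σ) := by
  induction l with
  | nil => exact Category.comp_id _
  | cons i l ih =>
    refine (Category.assoc _ _ _).trans ?_
    refine (congrArg (fun g => eComul ≫ g) (ten_comp _ _ _ _)).trans ?_
    rw [ih, Category.comp_id]
    rfl

lemma eList_to {ι κ : Type*} {A : ι → D} {B : κ → D} {σ : ι → κ} (f : ∀ i, 𝟙_ D ⟶ A i)
    (h : ∀ i, A i ⟶ B (σ i)) (g : ∀ k, 𝟙_ D ⟶ B k) (hg : ∀ i, f i ≫ h i = g (σ i))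
    (l : List ι) : eList f l ≫ itensTo h l = eList g (l.map σ) := by
  rw [← itensMap_reindex, ← Category.assoc, eList_map, ← eList_reindex]
  simp only [hg]

lemma eList_append {ι : Type*} {A : ι → D} (f : ∀ i, 𝟙_ D ⟶ A i) (l l' : List ι) :
    eComul ≫ (eList f l ⊠ₘ eList f l') ≫ itensAppend A l l' = eList f (l ++ l') := by
  induction l with
  | nil =>
    simp only [eList, itensAppend, List.nil_append]
    rw [show (unitMap (D := D) ⊠ₘ eList f l') = (unitMap ⊠ₘ 𝟙 _) ≫ (𝟙 _ ⊠ₘ eList f l') by simp,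
      Category.assoc, left₁_nat, reassoc_of% counit_eComul (D := D)]
  | cons i l ih =>
    simp only [eList, itensAppend, List.cons_append]
    rw [← ih, show (eComul ≫ (f i ⊠ₘ eList f l) ⊠ₘ eList f l') =
      (eComul ⊠ₘ 𝟙 _) ≫ ((f i ⊠ₘ eList f l) ⊠ₘ eList f l') by simp, Category.assoc,
      ← Category.assoc (_ ⊠ₘ _) (assoc₁ _ _ _).hom, assoc₁_nat, Category.assoc,
      reassoc_of% eComul_assoc (D := D), ten_comp, ten_comp]
    simp

lemma eList_flatten {ι : Type*} {A : ι → D} (f : ∀ i, 𝟙_ D ⟶ A i) (L : List (List ι)) :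
    eList (fun l => eList f l) L ≫ itensFlatten A L = eList f L.flatten := by
  induction L with
  | nil => exact Category.comp_id _
  | cons l L ih =>
    simp only [eList, itensFlatten, List.flatten_cons, Category.assoc]
    rw [ten_comp_assoc, ih, Category.comp_id, eList_append]

/-- Induction on the list, with `unitMap_vMul` as the empty case and `eComul_left` as the binary
one. Units occupying a whole level of an operadic composite can thus be distributed over the
individual subtrees. -/
lemma eList_inter_left {ι : Type*} {A B : ι → D} (f : ∀ i, 𝟙_ D ⟶ A i) (l : List ι) :
    (eList f l ⊗ₘ 𝟙 (itens B l)) ≫ itensInter A B l =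
      (λ_ _).hom ≫ itensMap (fun i => (λ_ (B i)).inv ≫ (f i ⊗ₘ 𝟙 (B i))) l := by
  induction l with
  | nil => simp only [eList, itensInter, itensMap, itens, unitMap_vMul, Category.comp_id]
  | cons i l ih =>
    have h := eComul_left (B i) (itens B l)
    simp only [eList, itensInter, itensMap]
    rw [← h, show (eComul ≫ (f i ⊠ₘ eList f l) ⊗ₘ 𝟙 (B i ⊠ itens B l)) =
      (eComul ⊗ₘ 𝟙 _) ≫ ((f i ⊠ₘ eList f l) ⊗ₘ (𝟙 (B i) ⊠ₘ 𝟙 (itens B l))) by simp]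
    simp only [Category.assoc]
    rw [← Category.assoc (_ ⊗ₘ _) (inter _ _ _ _), inter_nat, Category.assoc, ten_comp, ten_comp,
      ih]
    simp

lemma eList_inter_right {ι : Type*} {A B : ι → D} (f : ∀ i, 𝟙_ D ⟶ B i) (l : List ι) :
    (𝟙 (itens A l) ⊗ₘ eList f l) ≫ itensInter A B l =
      (ρ_ _).hom ≫ itensMap (fun i => (ρ_ (A i)).inv ≫ (𝟙 (A i) ⊗ₘ f i)) l := by
  induction l with
  | nil => simp only [eList, itensInter, itensMap, itens, vMul_unitMap, Category.comp_id]
  | cons i l ih =>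
    have h := eComul_right (A i) (itens A l)
    simp only [eList, itensInter, itensMap]
    rw [← h, show (𝟙 (A i ⊠ itens A l) ⊗ₘ eComul ≫ (f i ⊠ₘ eList f l)) =
      (𝟙 _ ⊗ₘ eComul) ≫ ((𝟙 (A i) ⊠ₘ 𝟙 (itens A l)) ⊗ₘ (f i ⊠ₘ eList f l)) by simp]
    simp only [Category.assoc]
    rw [← Category.assoc (_ ⊗ₘ _) (inter _ _ _ _), inter_nat, Category.assoc, ten_comp, ten_comp,
      ih]
    simp

lemma unitMap_vList {ι : Type*} {A : ι → D} (m : ∀ i, vUnit D ⟶ A i) (l : List ι) :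
    unitMap ≫ vList m l = eList (fun i => unitMap ≫ m i) l := by
  induction l with
  | nil => exact Category.comp_id _
  | cons i l ih =>
    simp only [vList, eList]
    rw [← Category.assoc, ← eComul_unitMap, Category.assoc, ten_comp, ih]

lemma eList_unitList {A : ℕ → D} (f : ∀ n, 𝟙_ D ⟶ A n) (k : ℕ) :
    unitList A (f 1) k = eList f (List.replicate k 1) := by
  induction k with
  | zero => rfl
  | succ k ih => simp only [unitList, ih, List.replicate_succ, eList]

end Units

end DuoidalCenter

namespace DuoidalCenter

open DuoidalCategory

/-! ### Operad associativity with units on some of its three levels -/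

section Patterns

variable {D : Type u} [Category.{v} D] [DuoidalCategory D] {A : OneOperad D}

/-- The operad composition with free choice of the arities up to equality. -/
def OneOperad.gam (A : OneOperad D) (ks : List ℕ) {n s : ℕ} (hn : n = ks.length)
    (hs : ks.sum = s) : itens A.obj ks ⊗ A.obj n ⟶ A.obj s :=
  (𝟙 _ ⊗ₘ castHom A.obj hn) ≫ A.γ ks ≫ castHom A.obj hs

lemma OneOperad.gam_rfl (A : OneOperad D) (ks : List ℕ) : A.gam ks rfl rfl = A.γ ks := by
  simp [OneOperad.gam]

/-- The associativity axiom with its casts hidden in `gam`. Each arity equation is a free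
hypothesis, so specialising to concrete lists needs no transport. -/
lemma OneOperad.gam_assoc (A : OneOperad D) (L : List (List ℕ)) {n q s : ℕ}
    (h₁ : n = (L.map List.length).length) (h₂ : (L.map List.length).sum = q)
    (h₃ : q = L.flatten.length) (h₄ : L.flatten.sum = s)
    (h₅ : n = (L.map List.sum).length) (h₆ : (L.map List.sum).sum = s) :
    (itensFlatten A.obj L ⊗ₘ
        ((itensReindex A.obj List.length L ⊗ₘ 𝟙 (A.obj n)) ≫ A.gam (L.map List.length) h₁ h₂)) ≫
        A.gam L.flatten h₃ h₄ =
      (α_ _ _ _).inv ≫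
        ((itensInter (fun l => itens A.obj l) (fun l => A.obj l.length) L ≫
          itensTo A.γ L) ⊗ₘ 𝟙 _) ≫ A.gam (L.map List.sum) h₅ h₆ := by
  obtain rfl : n = L.length := by simpa using h₁
  subst h₃ h₄
  have h := A.assoc L
  simp only [OneOperad.gam, castHom_rfl, Category.comp_id, id_tensorHom_id, Category.id_comp]
  rw [← itensMap_reindex, tensorHom_comp_tensorHom_assoc, tensorHom_comp_tensorHom_assoc]
  simp only [Category.comp_id, Category.id_comp]
  exact h

/-- The composite `e ⟶ v ⟶ A n`. -/
def OperadHom.unitMul (m : OperadHom (assOperad D) A) (n : ℕ) : 𝟙_ D ⟶ A.obj n :=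
  unitMap ≫ m.mulMap n

variable (m : OperadHom (assOperad D) A)

lemma OperadHom.inner_eq (ks : List ℕ) {p q : ℕ} (hp : p = ks.length) (hq : ks.sum = q) :
    m.inner ks hp hq = (λ_ _).inv ≫ (eList m.unitMul ks ⊗ₘ 𝟙 _) ≫ A.gam ks hp hq := by
  subst hp hq
  rw [OperadHom.inner, OneOperad.gam_rfl, unitMap_vList]
  simp only [castHom_rfl, Category.comp_id]
  rfl

/-- The product `A k₁ ⊠ ⋯ ⊠ A kₙ ⟶ A (∑ kᵢ)` given by composition with `e ⟶ v ⟶ A n`. -/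
def OperadHom.prod (ks : List ℕ) {s : ℕ} (hs : ks.sum = s) : itens A.obj ks ⟶ A.obj s :=
  (ρ_ _).inv ≫ (𝟙 _ ⊗ₘ m.unitMul ks.length) ≫ A.gam ks rfl hs

lemma OperadHom.prod_eq (ks : List ℕ) {n s : ℕ} (hn : n = ks.length) (hs : ks.sum = s) :
    (ρ_ _).inv ≫ (𝟙 _ ⊗ₘ m.unitMul n) ≫ A.gam ks hn hs = m.prod ks hs := by
  subst hn; rfl

/-- Associativity with units on the middle level: the root undergoes an inner operator on one side,
each block of leaves is multiplied out on the other. -/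
lemma OperadHom.flatten_inner_gam (L : List (List ℕ)) {n q s : ℕ}
    (h₁ : n = (L.map List.length).length) (h₂ : (L.map List.length).sum = q)
    (h₃ : q = L.flatten.length) (h₄ : L.flatten.sum = s)
    (h₅ : n = (L.map List.sum).length) (h₆ : (L.map List.sum).sum = s) :
    (itensFlatten A.obj L ⊗ₘ m.inner (L.map List.length) h₁ h₂) ≫ A.gam L.flatten h₃ h₄ =
      (itensTo (fun l => m.prod l rfl) L ⊗ₘ 𝟙 _) ≫ A.gam (L.map List.sum) h₅ h₆ := by
  have h := A.gam_assoc L h₁ h₂ h₃ h₄ h₅ h₆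
  have hx : m.inner (L.map List.length) h₁ h₂ = (λ_ _).inv ≫
      (eList (fun l : List ℕ => m.unitMul l.length) L ⊗ₘ 𝟙 _) ≫
      (itensReindex A.obj List.length L ⊗ₘ 𝟙 (A.obj n)) ≫ A.gam (L.map List.length) h₁ h₂ := by
    rw [OperadHom.inner_eq, tensorHom_comp_tensorHom_assoc, eList_reindex, Category.comp_id]
  rw [hx, tensorHom_comp_right, tensorHom_comp_right]
  simp only [Category.assoc]
  rw [h, associator_inv_naturality_assoc, tensorHom_comp_tensorHom_assoc,
    ← Category.assoc (𝟙 _ ⊗ₘ eList _ L), eList_inter_right]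
  simp only [Category.assoc, Category.comp_id]
  rw [itensMap_to]
  have e : (fun l : List ℕ => ((ρ_ (itens A.obj l)).inv ≫ (𝟙 _ ⊗ₘ m.unitMul l.length)) ≫ A.γ l) =
      fun l => m.prod l rfl := by
    funext l
    rw [OperadHom.prod, OneOperad.gam_rfl, Category.assoc]
  rw [e, show ((ρ_ (itens (fun l => itens A.obj l) L)).hom ≫
    itensTo (fun l => m.prod l rfl) L ⊗ₘ 𝟙 (A.obj n)) =
    ((ρ_ _).hom ⊗ₘ 𝟙 _) ≫ (itensTo (fun l => m.prod l rfl) L ⊗ₘ 𝟙 (A.obj n)) by simp]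
  simp

/-- Associativity with units on the leaves: inner operators applied to the middle vertices combine
into one inner operator on the composite. -/
lemma OperadHom.inner_gam (L : List (List ℕ)) {n q s : ℕ}
    (h₁ : n = (L.map List.length).length) (h₂ : (L.map List.length).sum = q)
    (h₃ : q = L.flatten.length) (h₄ : L.flatten.sum = s)
    (h₅ : n = (L.map List.sum).length) (h₆ : (L.map List.sum).sum = s) :
    (itensTo (fun l => m.inner l rfl rfl) L ⊗ₘ 𝟙 _) ≫ A.gam (L.map List.sum) h₅ h₆ =
      (itensReindex A.obj List.length L ⊗ₘ 𝟙 (A.obj n)) ≫ A.gam (L.map List.length) h₁ h₂ ≫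
        m.inner L.flatten h₃ h₄ := by
  have h := A.gam_assoc L h₁ h₂ h₃ h₄ h₅ h₆
  have hx : (itensReindex A.obj List.length L ⊗ₘ 𝟙 (A.obj n)) ≫ A.gam (L.map List.length) h₁ h₂ ≫
      m.inner L.flatten h₃ h₄ = (λ_ _).inv ≫ (eList (fun l => eList m.unitMul l) L ⊗ₘ 𝟙 _) ≫
      (itensFlatten A.obj L ⊗ₘ
        ((itensReindex A.obj List.length L ⊗ₘ 𝟙 (A.obj n)) ≫ A.gam (L.map List.length) h₁ h₂)) ≫
        A.gam L.flatten h₃ h₄ := by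
    rw [OperadHom.inner_eq, tensorHom_comp_tensorHom_assoc, eList_flatten, Category.id_comp,
      ← Category.assoc, leftUnitor_inv_naturality_assoc, ← id_tensorHom,
      tensorHom_comp_tensorHom_assoc, Category.id_comp, Category.comp_id]
  rw [hx, h, ← id_tensorHom_id, associator_inv_naturality_assoc, tensorHom_comp_tensorHom_assoc,
    ← Category.assoc (eList _ L ⊗ₘ _), eList_inter_left]
  simp only [Category.assoc, Category.comp_id]
  rw [itensMap_to]
  have e : (fun l : List ℕ => ((λ_ (A.obj l.length)).inv ≫ (eList m.unitMul l ⊗ₘ 𝟙 _)) ≫ A.γ l) =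
      fun l => m.inner l rfl rfl := by
    funext l
    rw [OperadHom.inner_eq, OneOperad.gam_rfl, Category.assoc]
  rw [e, show ((λ_ (itens (fun l => A.obj (List.length l)) L)).hom ≫
    itensTo (fun l => m.inner l rfl rfl) L ⊗ₘ 𝟙 (A.obj n)) =
    ((λ_ _).hom ⊗ₘ 𝟙 _) ≫ (itensTo (fun l => m.inner l rfl rfl) L ⊗ₘ 𝟙 (A.obj n)) by simp]
  simp

/-- Associativity with a unit at the root. Leaves and middle vertices both stay free, so the
interchange survives; this is the source of the compatibility between the two tensor products. -/
lemma OperadHom.inter_prod (L : List (List ℕ)) {q s : ℕ}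
    (h₂ : (L.map List.length).sum = q)
    (h₃ : q = L.flatten.length) (h₄ : L.flatten.sum = s) (h₆ : (L.map List.sum).sum = s) :
    itensInter (fun l => itens A.obj l) (fun l => A.obj l.length) L ≫ itensTo A.γ L ≫
        m.prod (L.map List.sum) h₆ =
      (itensFlatten A.obj L ⊗ₘ (itensReindex A.obj List.length L ≫
        m.prod (L.map List.length) h₂)) ≫ A.gam L.flatten h₃ h₄ := by
  have h := A.gam_assoc L (n := L.length) (by simp) h₂ h₃ h₄ (by simp) h₆
  have hx : itensReindex A.obj List.length L ≫ m.prod (L.map List.length) h₂ =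
      (ρ_ _).inv ≫ (𝟙 _ ⊗ₘ m.unitMul L.length) ≫
      (itensReindex A.obj List.length L ⊗ₘ 𝟙 (A.obj L.length)) ≫
        A.gam (L.map List.length) (by simp) h₂ := by
    rw [← m.prod_eq (L.map List.length) (n := L.length) (by simp) h₂,
      rightUnitor_inv_naturality_assoc, ← tensorHom_id, tensorHom_comp_tensorHom_assoc,
      tensorHom_comp_tensorHom_assoc]
    simp only [Category.comp_id, Category.id_comp]
  rw [hx, tensorHom_comp_right, tensorHom_comp_right]
  simp only [Category.assoc]
  rw [h, associator_inv_naturality_assoc, tensorHom_comp_tensorHom_assoc,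
    ← m.prod_eq (L.map List.sum) (n := L.length) (by simp) h₆]
  simp only [← Category.assoc (itensInter _ _ L)]
  rw [rightUnitor_inv_naturality_assoc, ← tensorHom_id, tensorHom_comp_tensorHom_assoc]
  simp

lemma vList_itensMap {ι : Type*} {A B : ι → D} (f : ∀ i, vUnit D ⟶ A i) (h : ∀ i, A i ⟶ B i)
    (l : List ι) : vList f l ≫ itensMap h l = vList (fun i => f i ≫ h i) l := by
  induction l with
  | nil => exact Category.comp_id _
  | cons i l ih => simp [vList, itensMap, ih]

lemma vList_vCollapse {ι : Type*} (l : List ι) :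
    vList (fun _ : ι => 𝟙 (vUnit D)) l ≫ vCollapse l = 𝟙 _ := by
  induction l with
  | nil => exact Category.comp_id _
  | cons i l ih => simp [vList, vCollapse, ih]

lemma OperadHom.mulMap_gam (ks : List ℕ) {n s : ℕ} (hn : n = ks.length) (hs : ks.sum = s) :
    (itensMap m.mulMap ks ⊗ₘ m.mulMap n) ≫ A.gam ks hn hs =
      (vCollapse ks ⊗ₘ 𝟙 _) ≫ vMul ≫ m.mulMap s := by
  subst hn hs
  rw [OneOperad.gam_rfl, ← Category.assoc]
  exact (m.app_γ ks).symm

/-- Because m is an operad map, the computation takes place in Ass, where the copies of v collapse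
to one and the inserted unit e is absorbed by `unitMap_vMul`. -/
lemma OperadHom.mulMap_inner (ks : List ℕ) {p q : ℕ} (hp : p = ks.length) (hq : ks.sum = q) :
    m.mulMap p ≫ m.inner ks hp hq = m.mulMap q := by
  rw [OperadHom.inner_eq, leftUnitor_inv_naturality_assoc, ← id_tensorHom,
    tensorHom_comp_tensorHom_assoc, Category.comp_id, Category.id_comp,
    show m.unitMul = fun k => unitMap ≫ 𝟙 _ ≫ m.mulMap k by
      funext k; rw [Category.id_comp]; rfl, ← unitMap_vList, ← vList_itensMap,
    ← Category.assoc unitMap, tensorHom_comp_left _ (itensMap _ _), Category.assoc, m.mulMap_gam,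
    tensorHom_comp_tensorHom_assoc, Category.assoc, vList_vCollapse, Category.comp_id,
    Category.comp_id, reassoc_of% unitMap_vMul (D := D), Iso.inv_hom_id_assoc]

lemma OperadHom.unitMul_inner (ks : List ℕ) {p q : ℕ} (hp : p = ks.length) (hq : ks.sum = q) :
    m.unitMul p ≫ m.inner ks hp hq = m.unitMul q := by
  rw [OperadHom.unitMul, Category.assoc, mulMap_inner, OperadHom.unitMul]

lemma OperadHom.mulMap_prod (ks : List ℕ) {s : ℕ} (hs : ks.sum = s) :
    itensMap m.mulMap ks ≫ m.prod ks hs = vCollapse ks ≫ m.mulMap s := by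
  rw [OperadHom.prod, rightUnitor_inv_naturality_assoc, ← tensorHom_id,
    tensorHom_comp_tensorHom_assoc, Category.comp_id, Category.id_comp, OperadHom.unitMul,
    tensorHom_comp_right,
    Category.assoc, m.mulMap_gam, tensorHom_comp_tensorHom_assoc, Category.comp_id,
    Category.id_comp, tensorHom_split,
    Category.assoc, reassoc_of% vMul_unitMap (D := D)]
  simp

/-- Units in the middle and at the root; the inner operator on the root disappears by
`unitMul_inner`. It is the general associativity of the product. -/
lemma OperadHom.prod_flatten (L : List (List ℕ)) {s : ℕ} (h₄ : L.flatten.sum = s)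
    (h₆ : (L.map List.sum).sum = s) :
    itensFlatten A.obj L ≫ m.prod L.flatten h₄ =
      itensTo (fun l => m.prod l rfl) L ≫ m.prod (L.map List.sum) h₆ := by
  have h := m.flatten_inner_gam L (n := L.length) (q := L.flatten.length) (by simp)
    (by simp [List.length_flatten]) rfl h₄ (by simp) h₆
  have h' := congrArg (fun f => (ρ_ _).inv ≫ (𝟙 _ ⊗ₘ m.unitMul L.length) ≫ f) h
  simp only [tensorHom_comp_tensorHom_assoc, m.unitMul_inner, Category.id_comp,
    Category.comp_id] at h'
  rw [tensorHom_split, tensorHom_split (itensTo _ _),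
    Category.assoc, Category.assoc, tensorHom_id, tensorHom_id,
    ← rightUnitor_inv_naturality_assoc, ← rightUnitor_inv_naturality_assoc, m.prod_eq,
    m.prod_eq] at h'
  exact h'

/-- Units on the leaves and at the root: inner operators act blockwise on products. -/
lemma OperadHom.prod_inner (L : List (List ℕ)) {q s : ℕ}
    (h₂ : (L.map List.length).sum = q)
    (h₃ : q = L.flatten.length) (h₄ : L.flatten.sum = s) (h₆ : (L.map List.sum).sum = s) :
    itensReindex A.obj List.length L ≫ m.prod (L.map List.length) h₂ ≫ m.inner L.flatten h₃ h₄ =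
      itensTo (fun l => m.inner l rfl rfl) L ≫ m.prod (L.map List.sum) h₆ := by
  have h := m.inner_gam L (n := L.length) (by simp) h₂ h₃ h₄ (by simp) h₆
  have h' := congrArg (fun f => (ρ_ _).inv ≫ (𝟙 _ ⊗ₘ m.unitMul L.length) ≫ f) h
  simp only [tensorHom_comp_tensorHom_assoc, Category.id_comp, Category.comp_id] at h'
  rw [tensorHom_split, tensorHom_split (itensReindex _ _ _),
    Category.assoc, Category.assoc, tensorHom_id, tensorHom_id,
    ← rightUnitor_inv_naturality_assoc, ← rightUnitor_inv_naturality_assoc, m.prod_eq] at h'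
  rw [h', ← m.prod_eq (L.map List.length) (n := L.length) (by simp) h₂]
  simp only [Category.assoc]

/-- Units on the leaves and in the middle. The functoriality of the cosimplicial object rests on
this composition law. -/
lemma OperadHom.inner_inner (L : List (List ℕ)) {n q s : ℕ}
    (h₁ : n = (L.map List.length).length) (h₂ : (L.map List.length).sum = q)
    (h₃ : q = L.flatten.length) (h₄ : L.flatten.sum = s)
    (h₅ : n = (L.map List.sum).length) (h₆ : (L.map List.sum).sum = s) :
    m.inner (L.map List.length) h₁ h₂ ≫ m.inner L.flatten h₃ h₄ =
      m.inner (L.map List.sum) h₅ h₆ := by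
  have h := m.inner_gam L h₁ h₂ h₃ h₄ h₅ h₆
  have h' := congrArg (fun f => (λ_ _).inv ≫
    (eList (fun l : List ℕ => m.unitMul l.length) L ⊗ₘ 𝟙 _) ≫ f) h
  simp only [tensorHom_comp_tensorHom_assoc, eList_reindex, Category.id_comp] at h'
  rw [eList_to (fun l : List ℕ => m.unitMul l.length) _ m.unitMul
    (fun l => m.unitMul_inner l rfl rfl)] at h'
  rw [m.inner_eq (L.map List.length), m.inner_eq (L.map List.sum), h']
  simp only [Category.assoc]

/-- The operad unit equals `unitMul 1`, as m preserves units, so this is the unit law `unit_comp`.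
-/
lemma OperadHom.inner_replicate_one (k : ℕ) (hp : k = (List.replicate k 1).length)
    (hq : (List.replicate k 1).sum = k) : m.inner (List.replicate k 1) hp hq = 𝟙 _ := by
  have h := A.unit_comp k
  have hu : A.unit = m.unitMul 1 := m.app_unit.symm
  rw [hu, eList_unitList m.unitMul] at h
  rw [m.inner_eq, OneOperad.gam, tensorHom_comp_tensorHom_assoc, Category.comp_id,
    Category.id_comp, Iso.inv_comp_eq, Category.comp_id]
  exact h

lemma OperadHom.prod_singleton (k : ℕ) (hs : [k].sum = k) :
    (right₁ (A.obj k)).inv ≫ m.prod [k] hs = 𝟙 _ := by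
  have h := A.comp_unit k
  have hu : A.unit = m.unitMul 1 := m.app_unit.symm
  have e : A.gam [k] rfl hs = A.γ [k] := by
    simp only [OneOperad.gam, castHom_rfl, id_tensorHom_id, Category.id_comp]
    exact Category.comp_id _
  have h' : ((right₁ (A.obj k)).inv ⊗ₘ m.unitMul 1) ≫ A.gam [k] rfl hs = (ρ_ (A.obj k)).hom := by
    rw [e, ← hu]; exact h
  rw [OperadHom.prod, rightUnitor_inv_naturality_assoc, ← tensorHom_id,
    tensorHom_comp_tensorHom_assoc, Category.comp_id, Category.id_comp]
  exact (congrArg (fun f => (ρ_ _).inv ≫ f) h').trans (Iso.inv_hom_id _)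

lemma OperadHom.prod_nil (hs : ([] : List ℕ).sum = 0) : m.prod [] hs = m.mulMap 0 := by
  have h := m.mulMap_prod [] hs
  exact (Category.id_comp _).symm.trans (h.trans (Category.id_comp _))

end Patterns

end DuoidalCenter

namespace DuoidalCenter

open DuoidalCategory

/-- Proved in a category with a single monoidal structure, where coherence is automatic, in order to
be applied to the structure `snd` of D. -/
lemma unitors_coherence {C : Type u} [Category.{v} C] [MonoidalCategory C] (X Y Z : C) :
    ((𝟙 X ⊗ₘ (ρ_ Y).inv) ⊗ₘ (ρ_ Z).inv) ≫ (α_ X (Y ⊗ 𝟙_ C) (Z ⊗ 𝟙_ C)).hom ≫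
        (𝟙 X ⊗ₘ ((α_ Y (𝟙_ C) (Z ⊗ 𝟙_ C)).hom ≫ (𝟙 Y ⊗ₘ (λ_ (Z ⊗ 𝟙_ C)).hom))) =
      (α_ X Y Z).hom ≫ ((ρ_ X).inv ⊗ₘ (𝟙 Y ⊗ₘ (ρ_ Z).inv)) ≫
        (α_ X (𝟙_ C) (Y ⊗ (Z ⊗ 𝟙_ C))).hom ≫ (𝟙 X ⊗ₘ (λ_ (Y ⊗ (Z ⊗ 𝟙_ C))).hom) := by
  monoidal

/-! ### Unitors, interchange and lists with one or two entries -/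

section Append

variable {D : Type u} [Category.{v} D] [DuoidalCategory D]

lemma right₁_assoc₁ (X Y : D) :
    (assoc₁ X Y (vUnit D)).hom ≫ (𝟙 X ⊠ₘ (right₁ Y).hom) = (right₁ (X ⊠ Y)).hom := by
  have := @MonoidalCategory.rightUnitor_tensor_hom D _ DoubleMonoidalCategory.snd X Y
  rw [← @MonoidalCategory.id_tensorHom D _ DoubleMonoidalCategory.snd] at this
  exact this.symm

lemma triangle₁ (X Y : D) :
    (assoc₁ X (vUnit D) Y).hom ≫ (𝟙 X ⊠ₘ (left₁ Y).hom) = (right₁ X).hom ⊠ₘ 𝟙 Y := by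
  have := @MonoidalCategory.triangle D _ DoubleMonoidalCategory.snd X Y
  rw [← @MonoidalCategory.id_tensorHom D _ DoubleMonoidalCategory.snd,
    ← @MonoidalCategory.tensorHom_id D _ DoubleMonoidalCategory.snd] at this
  exact this

lemma id_tenHom_castHom {ι : Type*} (A : ι → D) (i : ι) {l l' : List ι} (h : l = l') :
    (𝟙 (A i) ⊠ₘ castHom (itens A) h) = castHom (itens A) (congrArg (List.cons i) h) := by
  subst h
  simp only [castHom_rfl, ten_id]

lemma itensAppend_castHom {ι : Type*} (A : ι → D) (k : List ι) {l l' : List ι} (h : l = l') :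
    (𝟙 (itens A k) ⊠ₘ castHom (itens A) h) ≫ itensAppend A k l' =
      itensAppend A k l ≫ castHom (itens A) (congrArg (fun t => k ++ t) h) := by
  subst h
  simp

lemma itensAppend_nil {ι : Type*} (A : ι → D) (l : List ι) :
    itensAppend A l [] = (right₁ (itens A l)).hom ≫ castHom (itens A) (List.append_nil l).symm := by
  induction l with
  | nil =>
    refine left₁_unit.trans (Category.comp_id _).symm
  | cons i l ih =>
    simp only [itensAppend]
    rw [ih, tenHom_comp_right, ← Category.assoc, right₁_assoc₁, id_tenHom_castHom]

lemma itensFlatten_singleton {ι : Type*} (A : ι → D) (l : List ι) :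
    itensFlatten A [l] = (right₁ (itens A l)).hom ≫
      castHom (itens A) (show l = [l].flatten by simp) := by
  simp only [itensFlatten]
  refine (congrArg (fun f => f ≫ itensAppend A l []) (ten_id (itens A l) (vUnit D))).trans ?_
  refine (Category.id_comp _).trans (itensAppend_nil A l)

lemma itensFlatten_pair {ι : Type*} (A : ι → D) (k l : List ι) :
    itensFlatten A [k, l] = (𝟙 (itens A k) ⊠ₘ (right₁ (itens A l)).hom) ≫ itensAppend A k l ≫
      castHom (itens A) (show k ++ l = [k, l].flatten by simp) := by
  change (𝟙 (itens A k) ⊠ₘ itensFlatten A [l]) ≫ itensAppend A k [l].flatten = _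
  rw [itensFlatten_singleton, tenHom_comp_right, Category.assoc, itensAppend_castHom]

/-- By `vMul_right`, a vacuous factor v can be introduced before an interchange. In `act_rmul` it is
this factor that gets replaced by m_1. -/
lemma right₁_inv_inter {X Y Z : D} (f : X ⊗ Y ⟶ Z) :
    ((right₁ X).inv ⊗ₘ (right₁ Y).inv) ≫ inter X (vUnit D) Y (vUnit D) ≫ (f ⊠ₘ vMul) =
      f ≫ (right₁ Z).inv := by
  rw [Iso.eq_comp_inv, show (f ⊠ₘ vMul (D := D)) = (𝟙 _ ⊠ₘ vMul) ≫ (f ⊠ₘ 𝟙 _) by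
    rw [ten_comp, Category.id_comp, Category.comp_id]]
  simp only [Category.assoc]
  rw [right₁_nat, reassoc_of% vMul_right X Y, tensorHom_comp_tensorHom_assoc]
  simp

lemma left₁_inv_inter {X Y Z : D} (f : X ⊗ Y ⟶ Z) :
    ((left₁ X).inv ⊗ₘ (left₁ Y).inv) ≫ inter (vUnit D) X (vUnit D) Y ≫ (vMul ⊠ₘ f) =
      f ≫ (left₁ Z).inv := by
  rw [Iso.eq_comp_inv, show (vMul (D := D) ⊠ₘ f) = (vMul ⊠ₘ 𝟙 _) ≫ (𝟙 _ ⊠ₘ f) by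
    rw [ten_comp, Category.id_comp, Category.comp_id]]
  simp only [Category.assoc]
  rw [left₁_nat, reassoc_of% vMul_left X Y, tensorHom_comp_tensorHom_assoc]
  simp

lemma right₁_inv_triangle (X Y : D) :
    ((right₁ X).inv ⊠ₘ 𝟙 Y) ≫ (assoc₁ X (vUnit D) Y).hom = 𝟙 X ⊠ₘ (left₁ Y).inv := by
  have h := congrArg (fun f => ((right₁ X).inv ⊠ₘ 𝟙 Y) ≫ f ≫ (𝟙 X ⊠ₘ (left₁ Y).inv))
    (triangle₁ X Y)
  simpa using h

lemma left₁_inv_assoc₁ (X Y : D) :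
    ((left₁ X).inv ⊠ₘ 𝟙 Y) ≫ (assoc₁ (vUnit D) X Y).hom = (left₁ (X ⊠ Y)).inv := by
  rw [← cancel_mono (left₁ (X ⊠ Y)).hom, Category.assoc, ← left₁_assoc₁]
  simp

lemma right₁_inv_assoc₁ (X Y : D) :
    (right₁ (X ⊠ Y)).inv ≫ (assoc₁ X Y (vUnit D)).hom = 𝟙 X ⊠ₘ (right₁ Y).inv := by
  rw [Iso.inv_comp_eq, ← right₁_assoc₁, Category.assoc, ten_comp]
  simp

lemma itensTo_singleton {ι κ : Type*} {A : ι → D} {B : κ → D} {σ : ι → κ}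
    (f : ∀ i, A i ⟶ B (σ i)) (i : ι) :
    (right₁ (A i)).inv ≫ itensTo f [i] = f i ≫ (right₁ (B (σ i))).inv :=
  (right₁_inv_nat (f i)).symm

lemma itensTo_pair {ι κ : Type*} {A : ι → D} {B : κ → D} {σ : ι → κ}
    (f : ∀ i, A i ⟶ B (σ i)) (i j : ι) :
    (𝟙 (A i) ⊠ₘ (right₁ (A j)).inv) ≫ itensTo f [i, j] =
      (f i ⊠ₘ f j) ≫ (𝟙 (B (σ i)) ⊠ₘ (right₁ (B (σ j))).inv) := by
  refine (ten_comp _ _ _ _).trans ?_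
  rw [ten_comp, Category.id_comp, Category.comp_id, itensTo_singleton]

lemma itensInter_singleton {ι κ : Type*} {A B : ι → D} {C : κ → D} {σ : ι → κ}
    (f : ∀ i, A i ⊗ B i ⟶ C (σ i)) (i : ι) :
    ((right₁ (A i)).inv ⊗ₘ (right₁ (B i)).inv) ≫ itensInter A B [i] ≫ itensTo f [i] =
      f i ≫ (right₁ (C (σ i))).inv := by
  rw [← right₁_inv_inter]
  simp only [itensInter, Category.assoc]
  refine congrArg (fun g => _ ≫ inter _ _ _ _ ≫ g) ((ten_comp _ _ _ _).trans ?_)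
  rw [Category.id_comp]
  exact congrArg (fun g => f i ⊠ₘ g) (Category.comp_id _)

lemma itensInter_pair {ι κ : Type*} {A B : ι → D} {C : κ → D} {σ : ι → κ}
    (f : ∀ i, A i ⊗ B i ⟶ C (σ i)) (i j : ι) :
    ((𝟙 (A i) ⊠ₘ (right₁ (A j)).inv) ⊗ₘ (𝟙 (B i) ⊠ₘ (right₁ (B j)).inv)) ≫
        itensInter A B [i, j] ≫ itensTo f [i, j] =
      inter _ _ _ _ ≫ (f i ⊠ₘ f j) ≫ (𝟙 (C (σ i)) ⊠ₘ (right₁ (C (σ j))).inv) := by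
  have h := itensInter_singleton f j
  rw [ten_comp, Category.comp_id, ← h]
  simp only [itensInter, Category.assoc]
  rw [← Category.assoc (_ ⊗ₘ _) (inter _ _ _ _), inter_nat, Category.assoc]
  refine congrArg (fun g => inter _ _ _ _ ≫ g) ?_
  refine (congrArg (fun g => _ ≫ g) (ten_comp _ _ _ _)).trans ((ten_comp _ _ _ _).trans ?_)
  rw [Category.id_comp, id_tensorHom_id, Category.id_comp]
  simp only [Category.assoc]

end Append

/-! ### The right action of A(1) and the binary product -/

section Binary

variable {D : Type u} [Category.{v} D] [DuoidalCategory D] {A : OneOperad D}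

lemma OneOperad.castHom_gam (A : OneOperad D) {l l' : List ℕ} (h : l = l') {n s : ℕ}
    (hn : n = l'.length) (hs : l'.sum = s) :
    (castHom (itens A.obj) h ⊗ₘ 𝟙 (A.obj n)) ≫ A.gam l' hn hs =
      A.gam l (h ▸ hn) (h ▸ hs) := by
  subst h
  simp

/-- The right action `A a ⊗ A 1 ⟶ A a`. -/
def OneOperad.act (A : OneOperad D) (a : ℕ) : A.obj a ⊗ A.obj 1 ⟶ A.obj a :=
  ((right₁ (A.obj a)).inv ⊗ₘ 𝟙 _) ≫ A.gam [a] rfl (by simp)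

/-- Associativity for a single block L = [k], whose root lies in A(1) and whose only middle vertex
has arity the length of k. -/
lemma OneOperad.gam_act (A : OneOperad D) (k : List ℕ) {n s : ℕ} (hn : n = k.length)
    (hs : k.sum = s) :
    (𝟙 _ ⊗ₘ A.act n) ≫ A.gam k hn hs =
      (α_ _ _ _).inv ≫ (A.gam k hn hs ⊗ₘ 𝟙 _) ≫ A.act s := by
  subst hn hs
  have h := A.gam_assoc [k] (n := 1) (q := k.length) (s := k.sum) rfl (by simp) (by simp)
    (by simp) rfl (by simp)
  rw [itensFlatten_singleton, show itensReindex A.obj List.length [k] = 𝟙 _ from ten_id _ _] at h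
  have h' := congrArg (fun f => ((right₁ _).inv ⊗ₘ ((right₁ _).inv ⊗ₘ 𝟙 _)) ≫ f) h
  dsimp only at h'
  rw [tensorHom_comp_tensorHom_assoc, Iso.inv_hom_id_assoc,
    tensorHom_comp_tensorHom_assoc, Category.comp_id, associator_inv_naturality_assoc] at h'
  have h₁ := h'.trans (congrArg (fun f => (α_ _ _ _).inv ≫ f)
    (tensorHom_comp_tensorHom_assoc _ _ _ _ _))
  rw [Category.comp_id] at h₁
  have h₂ := h₁.trans (congrArg (fun f => (α_ _ _ _).inv ≫ (f ⊗ₘ _) ≫ A.gam _ _ _)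
    (itensInter_singleton A.γ k))
  rw [tensorHom_split', Category.assoc, A.castHom_gam] at h₂
  refine h₂.trans ?_
  rw [tensorHom_comp_left, OneOperad.gam_rfl, Category.assoc]
  rfl

/-- The product `A a ⊠ A b ⟶ A c`, `c = a + b`, of a multiplicative operad. -/
def OperadHom.mu (m : OperadHom (assOperad D) A) (a b c : ℕ) (h : a + b = c) :
    A.obj a ⊠ A.obj b ⟶ A.obj c :=
  (𝟙 _ ⊠ₘ (right₁ _).inv) ≫ m.prod [a, b] (by simpa using h)

variable (m : OperadHom (assOperad D) A)

lemma OperadHom.castHom_prod {l l' : List ℕ} (h : l = l') {s : ℕ} (hs : l'.sum = s) :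
    castHom (itens A.obj) h ≫ m.prod l' hs = m.prod l (h ▸ hs) := by
  subst h
  simp

/-- `prod_flatten` for the two blocks k and l. The associativity and the unit laws of `mu` are its
instances with short k and l. -/
lemma OperadHom.prod_mu (k l : List ℕ) {p q r : ℕ} (hp : k.sum = p) (hq : l.sum = q)
    (hr : (k ++ l).sum = r) (h : p + q = r) :
    (m.prod k hp ⊠ₘ m.prod l hq) ≫ m.mu p q r h = itensAppend A.obj k l ≫ m.prod (k ++ l) hr := by
  subst hp hq
  have h' := m.prod_flatten [k, l] (s := r) (by simpa using hr) (by simpa using h)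
  rw [itensFlatten_pair] at h'
  simp only [Category.assoc, m.castHom_prod] at h'
  have h'' := congrArg (fun f => (𝟙 _ ⊠ₘ (right₁ _).inv) ≫ f) h'
  dsimp only at h''
  rw [ten_comp_assoc, Iso.inv_hom_id, Category.id_comp, ten_id, Category.id_comp] at h''
  rw [h'', OperadHom.mu]
  refine ((reassoc_of% (itensTo_pair (B := A.obj) (fun l => m.prod l rfl) k l)) _).symm

lemma OperadHom.mu_inner (k l : List ℕ) {p q r a b c : ℕ} (ha : a = k.length) (hb : b = l.length)
    (hp : k.sum = p) (hq : l.sum = q) (hr : (k ++ l).sum = r) (hc : c = (k ++ l).length)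
    (h : p + q = r) (h' : a + b = c) :
    m.mu a b c h' ≫ m.inner (k ++ l) hc hr =
      (m.inner k ha hp ⊠ₘ m.inner l hb hq) ≫ m.mu p q r h := by
  subst ha hb hp hq
  have h₁ := m.prod_inner [k, l] (q := c) (s := r) (by simpa using h') (by simpa using hc)
    (by simpa using hr) (by simpa using h)
  have e₁ : itensReindex A.obj List.length [k, l] = 𝟙 _ := by
    refine (congrArg (fun f => 𝟙 _ ⊠ₘ f) (ten_id _ _)).trans (ten_id _ _)
  rw [e₁] at h₁
  simp only [List.flatten_cons, List.flatten_nil, List.append_nil] at h₁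
  rw [OperadHom.mu, Category.assoc]
  refine (congrArg (fun f => (𝟙 _ ⊠ₘ (right₁ _).inv) ≫ f)
    ((Category.id_comp _).symm.trans h₁)).trans ?_
  exact (reassoc_of% (itensTo_pair (B := A.obj) (fun l => m.inner l rfl rfl) k l)) _

/-- `inter_prod` for two blocks: a product of two composites is the composite of the joined leaves
with the product of the two middle vertices. -/
lemma OperadHom.inter_mu (k l : List ℕ) {p q r a b c : ℕ} (ha : a = k.length) (hb : b = l.length)
    (hp : k.sum = p) (hq : l.sum = q) (hr : (k ++ l).sum = r) (hc : c = (k ++ l).length)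
    (h : p + q = r) (h' : a + b = c) :
    inter _ _ _ _ ≫ (A.gam k ha hp ⊠ₘ A.gam l hb hq) ≫ m.mu p q r h =
      (itensAppend A.obj k l ⊗ₘ m.mu a b c h') ≫ A.gam (k ++ l) hc hr := by
  subst ha hb hp hq
  have h₁ := m.inter_prod [k, l] (q := c) (s := r) (by simpa using h') (by simpa using hc)
    (by simpa using hr) (by simpa using h)
  have e₁ : itensReindex A.obj List.length [k, l] = 𝟙 _ := by
    refine (congrArg (fun f => 𝟙 _ ⊠ₘ f) (ten_id _ _)).trans (ten_id _ _)
  rw [e₁, itensFlatten_pair] at h₁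
  have h₂ := congrArg (fun f => ((𝟙 _ ⊠ₘ (right₁ _).inv) ⊗ₘ (𝟙 _ ⊠ₘ (right₁ _).inv)) ≫ f) h₁
  dsimp only at h₂
  have h₃ := (reassoc_of% (itensInter_pair (C := A.obj) A.γ k l)) (m.prod [k.sum, l.sum] h)
  have h₄ := h₃.symm.trans h₂
  rw [tensorHom_comp_tensorHom_assoc, ten_comp_assoc (𝟙 (itens A.obj k)) (𝟙 _)
    (right₁ (itens A.obj l)).inv (right₁ (itens A.obj l)).hom, Iso.inv_hom_id, Category.id_comp,
    ten_id, Category.id_comp, tensorHom_split', tensorHom_comp_left, Category.assoc, Category.assoc,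
    A.castHom_gam] at h₄
  rw [OneOperad.gam_rfl, OneOperad.gam_rfl, OperadHom.mu]
  refine h₄.trans ?_
  rw [← Category.assoc (𝟙 _ ⊗ₘ _), ← tensorHom_split']
  exact congrArg (fun f => (itensAppend A.obj k l ⊗ₘ _ ≫ f) ≫ A.gam (k ++ l) hc hr)
    (Category.id_comp _)

/-- `flatten_inner_gam` for one block. Composing leaves with an inflated element of A(1) amounts to
multiplying the leaves first and then acting by the element itself. -/
lemma OperadHom.inner_singleton_gam (k : List ℕ) {q s : ℕ} (hk : [k.length].sum = q)
    (hq : q = k.length) (hs : k.sum = s) :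
    (𝟙 _ ⊗ₘ m.inner [k.length] rfl hk) ≫ A.gam k hq hs = (m.prod k hs ⊗ₘ 𝟙 _) ≫ A.act s := by
  subst hs
  have h := m.flatten_inner_gam [k] (n := 1) (q := q) (s := k.sum) rfl hk (by simpa using hq)
    (by simp) rfl (by simp)
  rw [itensFlatten_singleton] at h
  have h' := congrArg (fun f => ((right₁ _).inv ⊗ₘ 𝟙 _) ≫ f) h
  dsimp only at h'
  rw [tensorHom_comp_tensorHom_assoc, Iso.inv_hom_id_assoc, Category.id_comp, tensorHom_split',
    Category.assoc, A.castHom_gam] at h'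
  refine h'.trans ((tensorHom_comp_tensorHom_assoc _ _ _ _ _).trans ?_)
  refine (congrArg (fun f => (f ⊗ₘ _) ≫ A.gam [k.sum] _ _)
    (itensTo_singleton (B := A.obj) (fun l => m.prod l rfl) k)).trans ?_
  rw [OneOperad.act, tensorHom_comp_tensorHom_assoc]

lemma OperadHom.inner_act (k : List ℕ) {a s : ℕ} (ha : a = k.length) (hs : k.sum = s) :
    (m.inner k ha hs ⊗ₘ 𝟙 _) ≫ A.act s = A.act a ≫ m.inner k ha hs := by
  subst ha hs
  have h := m.inner_gam [k] (n := 1) (q := k.length) (s := k.sum) rfl (by simp) (by simp)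
    (by simp) rfl (by simp)
  rw [show itensReindex A.obj List.length [k] = 𝟙 _ from ten_id _ _] at h
  simp only [List.flatten_cons, List.flatten_nil, List.append_nil] at h
  have h' := congrArg (fun f => ((right₁ _).inv ⊗ₘ 𝟙 _) ≫ f) h
  dsimp only at h'
  rw [id_tensorHom_id, tensorHom_comp_tensorHom_assoc] at h'
  have h₁ := (congrArg (fun f => (f ⊗ₘ _) ≫ A.gam [k.sum] _ _)
    (itensTo_singleton (B := A.obj) (fun l => m.inner l rfl rfl) k)).symm.trans h'
  rw [OneOperad.act, OneOperad.act, tensorHom_comp_tensorHom_assoc]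
  refine h₁.trans ?_
  rw [Category.assoc]
  exact congrArg (fun f => _ ≫ f) (Category.id_comp _)

end Binary

end DuoidalCenter

namespace DuoidalCenter

open DuoidalCategory

/-! ### The graded product and multiplication by m_k -/

section Product

variable {D : Type u} [Category.{v} D] [DuoidalCategory D] {A : OneOperad D}
  (m : OperadHom (assOperad D) A)

lemma itensAppend_triple {ι : Type*} (B : ι → D) (a b c : ι) :
    ((𝟙 (B a) ⊠ₘ (right₁ (B b)).inv) ⊠ₘ (right₁ (B c)).inv) ≫ itensAppend B [a, b] [c] =
      (assoc₁ _ _ _).hom ≫ ((right₁ (B a)).inv ⊠ₘ (𝟙 (B b) ⊠ₘ (right₁ (B c)).inv)) ≫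
        itensAppend B [a] [b, c] :=
  @unitors_coherence D _ DoubleMonoidalCategory.snd (B a) (B b) (B c)

/-- By `prod_mu` both bracketings are the product of the list [a, b, c]; the two ways of forming
that list agree by `itensAppend_triple`. -/
lemma OperadHom.mu_assoc (a b c p q s : ℕ) (h₁ : a + b = p) (h₂ : p + c = s) (h₃ : b + c = q)
    (h₄ : a + q = s) :
    (m.mu a b p h₁ ⊠ₘ 𝟙 (A.obj c)) ≫ m.mu p c s h₂ =
      (assoc₁ _ _ _).hom ≫ (𝟙 (A.obj a) ⊠ₘ m.mu b c q h₃) ≫ m.mu a q s h₄ := by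
  have e₁ := m.prod_mu [a, b] [c] (p := p) (q := c) (r := s) (by simpa using h₁) (by simp)
    (by simp; omega) h₂
  have e₂ := m.prod_mu [a] [b, c] (p := a) (q := q) (r := s) (by simp) (by simpa using h₃)
    (by simp; omega) h₄
  have u : ∀ k, (right₁ (A.obj k)).inv ≫ m.prod [k] (by simp) = 𝟙 _ :=
    fun k => m.prod_singleton k _
  -- The bare outer factor is rewritten as the product of a one-term list, so that `prod_mu` applies
  -- to each side.
  conv_lhs => rw [← u c]
  conv_rhs => rw [← u a]
  rw [show m.mu a b p h₁ = (𝟙 _ ⊠ₘ (right₁ _).inv) ≫ m.prod [a, b] (by simpa using h₁) from rfl,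
    show m.mu b c q h₃ = (𝟙 _ ⊠ₘ (right₁ _).inv) ≫ m.prod [b, c] (by simpa using h₃) from rfl,
    ← ten_comp_assoc, ← ten_comp_assoc]
  refine (congrArg (fun f => _ ≫ f) e₁).trans (Eq.trans ?_
    (congrArg (fun f => (assoc₁ _ _ _).hom ≫ _ ≫ f) e₂).symm)
  have h := congrArg (fun f => f ≫ m.prod [a, b, c] (s := s) (by simp; omega))
    (itensAppend_triple A.obj a b c)
  simp only [Category.assoc] at h
  exact h

lemma OperadHom.mulMap_zero_mu (a : ℕ) (h : 0 + a = a) :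
    (m.mulMap 0 ⊠ₘ 𝟙 (A.obj a)) ≫ m.mu 0 a a h = (left₁ (A.obj a)).hom := by
  have e := m.prod_mu [] [a] (p := 0) (q := a) (r := a) (by simp) (by simp) (by simp) h
  have u : (right₁ (A.obj a)).inv ≫ m.prod [a] (by simp) = 𝟙 _ := m.prod_singleton a _
  rw [← u, ← m.prod_nil (by simp), tenHom_comp_right, Category.assoc, e]
  have k := reassoc_of% left₁_nat (right₁ (A.obj a)).inv
  refine (k (m.prod [a] _)).trans ?_
  rw [u, Category.comp_id]

lemma OperadHom.mu_mulMap_zero (a : ℕ) (h : a + 0 = a) :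
    (𝟙 (A.obj a) ⊠ₘ m.mulMap 0) ≫ m.mu a 0 a h = (right₁ (A.obj a)).hom := by
  have e := m.prod_mu [a] [] (p := a) (q := 0) (r := a) (by simp) (by simp) (by simp) h
  have u : (right₁ (A.obj a)).inv ≫ m.prod [a] (by simp) = 𝟙 _ := m.prod_singleton a _
  rw [← u, ← m.prod_nil (by simp), tenHom_comp_left, Category.assoc, e]
  rw [itensAppend_nil, Category.assoc, m.castHom_prod,
    reassoc_of% right₁_nat (right₁ (A.obj a)).inv, u, Category.comp_id]

lemma OperadHom.mulMap_mu (a b c : ℕ) (h : a + b = c) :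
    (m.mulMap a ⊠ₘ m.mulMap b) ≫ m.mu a b c h = (left₁ (vUnit D)).hom ≫ m.mulMap c := by
  have e := m.mulMap_prod [a, b] (s := c) (by simpa using h)
  have k := congrArg (fun f => (𝟙 _ ⊠ₘ (right₁ _).inv) ≫ f) e
  dsimp only at k
  have e₁ : (𝟙 _ ⊠ₘ (right₁ _).inv) ≫ itensMap m.mulMap [a, b] =
      (m.mulMap a ⊠ₘ m.mulMap b) ≫ (𝟙 _ ⊠ₘ (right₁ _).inv) :=
    (ten_comp _ _ _ _).trans (by
      rw [ten_comp, Category.id_comp, Category.comp_id, right₁_inv_nat]; rfl)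
  rw [OperadHom.mu, ← reassoc_of% e₁, k]
  have e₂ : (𝟙 _ ⊠ₘ (right₁ _).inv) ≫ vCollapse [a, b] = (left₁ (vUnit D)).hom := by
    simp only [vCollapse]
    refine (ten_comp_assoc _ _ _ _ _).trans ?_
    rw [show ∀ f : vUnit D ⊠ vUnit D ⟶ vUnit D, (𝟙 _ ⊠ₘ 𝟙 _) ≫ f = f by simp, left₁_unit]
    simp
  rw [reassoc_of% e₂]

/-- Left multiplication by `v ⟶ A k`. -/
def OperadHom.lmul (k n s : ℕ) (h : k + n = s) : A.obj n ⟶ A.obj s :=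
  (left₁ _).inv ≫ (m.mulMap k ⊠ₘ 𝟙 _) ≫ m.mu k n s h

/-- Right multiplication by `v ⟶ A k`. -/
def OperadHom.rmul (n k s : ℕ) (h : n + k = s) : A.obj n ⟶ A.obj s :=
  (right₁ _).inv ≫ (𝟙 _ ⊠ₘ m.mulMap k) ≫ m.mu n k s h

lemma OperadHom.lmul_zero (n : ℕ) (h : 0 + n = n) : m.lmul 0 n n h = 𝟙 _ := by
  rw [OperadHom.lmul, mulMap_zero_mu, Iso.inv_hom_id]

lemma OperadHom.rmul_zero (n : ℕ) (h : n + 0 = n) : m.rmul n 0 n h = 𝟙 _ := by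
  rw [OperadHom.rmul, mu_mulMap_zero, Iso.inv_hom_id]

lemma OperadHom.mulMap_lmul (k n s : ℕ) (h : k + n = s) :
    m.mulMap n ≫ m.lmul k n s h = m.mulMap s := by
  rw [OperadHom.lmul, reassoc_of% left₁_inv_nat (m.mulMap n), ten_comp_assoc, Category.id_comp,
    Category.comp_id, mulMap_mu, Iso.inv_hom_id_assoc]

lemma OperadHom.mulMap_rmul (n k s : ℕ) (h : n + k = s) :
    m.mulMap n ≫ m.rmul n k s h = m.mulMap s := by
  rw [OperadHom.rmul, reassoc_of% right₁_inv_nat (m.mulMap n), ten_comp_assoc, Category.id_comp,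
    Category.comp_id, mulMap_mu, left₁_unit, Iso.inv_hom_id_assoc]

lemma OperadHom.lmul_mu (k a a' b c t : ℕ) (h₁ : k + a = a') (h₂ : a' + b = t) (h₃ : a + b = c)
    (h₄ : k + c = t) :
    (m.lmul k a a' h₁ ⊠ₘ 𝟙 (A.obj b)) ≫ m.mu a' b t h₂ = m.mu a b c h₃ ≫ m.lmul k c t h₄ := by
  rw [OperadHom.lmul, OperadHom.lmul, reassoc_of% left₁_inv_nat (m.mu a b c h₃), ten_comp_assoc,
    Category.id_comp, Category.comp_id, tenHom_comp_left, tenHom_comp_left, Category.assoc,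
    Category.assoc, m.mu_assoc k a b a' c t h₁ h₂ h₃ h₄, reassoc_of% assoc₁_nat,
    reassoc_of% left₁_inv_assoc₁, ten_id, ten_comp_assoc, Category.comp_id, Category.id_comp]

lemma OperadHom.mu_rmul (a b b' k c t : ℕ) (h₁ : b + k = b') (h₂ : a + b' = t) (h₃ : a + b = c)
    (h₄ : c + k = t) :
    (𝟙 (A.obj a) ⊠ₘ m.rmul b k b' h₁) ≫ m.mu a b' t h₂ = m.mu a b c h₃ ≫ m.rmul c k t h₄ := by
  rw [OperadHom.rmul, OperadHom.rmul, reassoc_of% right₁_inv_nat (m.mu a b c h₃), ten_comp_assoc,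
    Category.id_comp, Category.comp_id, tenHom_split' (m.mu a b c h₃), Category.assoc,
    m.mu_assoc a b k c b' t h₃ h₄ h₁ h₂, tenHom_comp_right, tenHom_comp_right, Category.assoc,
    Category.assoc, ← ten_id, reassoc_of% assoc₁_nat, reassoc_of% right₁_inv_assoc₁]

/-- In elements, (x m_k) y = x (m_k y): associativity and the triangle identity let m_k pass from
one factor to the other. -/
lemma OperadHom.rmul_mu (a k a' b b' t : ℕ) (h₁ : a + k = a') (h₂ : a' + b = t) (h₃ : k + b = b')
    (h₄ : a + b' = t) :
    (m.rmul a k a' h₁ ⊠ₘ 𝟙 (A.obj b)) ≫ m.mu a' b t h₂ =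
      (𝟙 (A.obj a) ⊠ₘ m.lmul k b b' h₃) ≫ m.mu a b' t h₄ := by
  rw [OperadHom.rmul, OperadHom.lmul, tenHom_comp_left, tenHom_comp_left, Category.assoc,
    Category.assoc, m.mu_assoc a k b a' b' t h₁ h₂ h₃ h₄, reassoc_of% assoc₁_nat,
    reassoc_of% right₁_inv_triangle, ten_comp_assoc, ten_comp_assoc]
  simp

/-- Associativity together with m_j m_k = m_{j+k}, which is `mulMap_lmul`. -/
lemma OperadHom.lmul_lmul (j k n s t l : ℕ) (h₁ : k + n = s) (h₂ : j + s = t) (h₃ : j + k = l)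
    (h₄ : l + n = t) :
    m.lmul k n s h₁ ≫ m.lmul j s t h₂ = m.lmul l n t h₄ := by
  rw [OperadHom.lmul, Category.assoc, Category.assoc, ← m.lmul_mu j k l n s t h₃ h₄ h₁ h₂,
    ten_comp_assoc, mulMap_lmul, Category.comp_id, OperadHom.lmul]

lemma OperadHom.rmul_rmul (n k j s t l : ℕ) (h₁ : n + k = s) (h₂ : s + j = t) (h₃ : k + j = l)
    (h₄ : n + l = t) :
    m.rmul n k s h₁ ≫ m.rmul s j t h₂ = m.rmul n l t h₄ := by
  rw [OperadHom.rmul, Category.assoc, Category.assoc, ← m.mu_rmul n k l j s t h₃ h₄ h₁ h₂,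
    ten_comp_assoc, mulMap_rmul, Category.comp_id, OperadHom.rmul]

lemma OperadHom.rmul_lmul (j n k s s' t : ℕ) (h₁ : n + k = s) (h₂ : j + s = t) (h₃ : j + n = s')
    (h₄ : s' + k = t) :
    m.rmul n k s h₁ ≫ m.lmul j s t h₂ = m.lmul j n s' h₃ ≫ m.rmul s' k t h₄ := by
  rw [OperadHom.rmul, Category.assoc, Category.assoc, ← m.lmul_mu j n s' k s t h₃ h₄ h₁ h₂,
    OperadHom.rmul, reassoc_of% right₁_inv_nat (m.lmul j n s' h₃), ten_comp_assoc, ten_comp_assoc,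
    Category.id_comp, Category.comp_id, Category.comp_id, Category.id_comp]

/-- Apply `mu_inner` to the blocks [a] and l: the inner operator of [a] carries m_1 to m_a. -/
lemma OperadHom.lmul_inner (a : ℕ) (l : List ℕ) {n n' p p' : ℕ} (hn : n = l.length)
    (hp : l.sum = p) (hn' : n' = (a :: l).length) (hp' : (a :: l).sum = p') (h₁ : 1 + n = n')
    (h₂ : a + p = p') :
    m.lmul 1 n n' h₁ ≫ m.inner (a :: l) hn' hp' = m.inner l hn hp ≫ m.lmul a p p' h₂ := by
  have h := m.mu_inner [a] l (a := 1) (b := n) (p := a) (q := p) rfl hn (by simp) hp hp' hn' h₂ h₁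
  rw [OperadHom.lmul, Category.assoc, Category.assoc]
  refine (congrArg (fun f => _ ≫ _ ≫ f) h).trans ?_
  rw [ten_comp_assoc, mulMap_inner, Category.id_comp, OperadHom.lmul,
    reassoc_of% left₁_inv_nat (m.inner l hn hp), ten_comp_assoc, Category.comp_id,
    Category.id_comp]

lemma OperadHom.rmul_inner (l : List ℕ) (a : ℕ) {n n' p p' : ℕ} (hn : n = l.length)
    (hp : l.sum = p) (hn' : n' = (l ++ [a]).length) (hp' : (l ++ [a]).sum = p') (h₁ : n + 1 = n')
    (h₂ : p + a = p') :
    m.rmul n 1 n' h₁ ≫ m.inner (l ++ [a]) hn' hp' = m.inner l hn hp ≫ m.rmul p a p' h₂ := by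
  have h := m.mu_inner l [a] (a := n) (b := 1) (p := p) (q := a) hn rfl hp (by simp) hp' hn' h₂ h₁
  rw [OperadHom.rmul, Category.assoc, Category.assoc, h, ten_comp_assoc, mulMap_inner,
    Category.id_comp, OperadHom.rmul, reassoc_of% right₁_inv_nat (m.inner l hn hp),
    ten_comp_assoc, Category.comp_id, Category.id_comp]

lemma OperadHom.inner_eq_id {l : List ℕ} (n : ℕ) (h : l = List.replicate n 1) (hp : n = l.length)
    (hq : l.sum = n) : m.inner l hp hq = 𝟙 _ := by
  subst h
  exact m.inner_replicate_one n _ _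

lemma OperadHom.comp_prod {X : D} (ks : List ℕ) {s : ℕ} (hs : ks.sum = s)
    (f : X ⟶ itens A.obj ks) :
    f ≫ m.prod ks hs = (ρ_ X).inv ≫ (f ⊗ₘ (unitMap ≫ m.mulMap ks.length)) ≫ A.γ ks ≫
      castHom A.obj hs := by
  rw [OperadHom.prod, OneOperad.gam, castHom_rfl, id_tensorHom_id, Category.id_comp,
    rightUnitor_inv_naturality_assoc, ← tensorHom_id, tensorHom_comp_tensorHom_assoc,
    Category.comp_id, Category.id_comp]
  rfl

lemma OperadHom.cofaceFirst_eq (n : ℕ) : m.cofaceFirst n = m.lmul 1 n (n + 1) (by omega) := by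
  have h := m.comp_prod [1, n] (s := n + 1) (by simp [add_comm])
    ((left₁ (A.obj n)).inv ≫ (m.mulMap 1 ⊠ₘ (right₁ (A.obj n)).inv))
  refine h.symm.trans ?_
  rw [tenHom_split, OperadHom.lmul, OperadHom.mu]
  simp only [Category.assoc]

lemma OperadHom.cofaceLast_eq (n : ℕ) : m.cofaceLast n = m.rmul n 1 (n + 1) (by omega) := by
  have h := m.comp_prod [n, 1] (s := n + 1) (by simp)
    ((right₁ (A.obj n)).inv ≫ (𝟙 (A.obj n) ⊠ₘ (m.mulMap 1 ≫ (right₁ (A.obj 1)).inv)))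
  refine h.symm.trans ?_
  rw [tenHom_comp_right, OperadHom.rmul, OperadHom.mu]
  simp only [Category.assoc]

end Product

end DuoidalCenter

namespace DuoidalCenter

open DuoidalCategory

/-! ### Lists of gaps and their partial sums -/

section Lists

/-- Consecutive partial sums differ by one entry. Lists can therefore be compared through their
partial-sum functions, which for `gaps f` are the values of f. -/
lemma List.eq_of_sum_take {l l' : List ℕ} (h : l.length = l'.length)
    (hs : ∀ i ≤ l.length, (l.take i).sum = (l'.take i).sum) : l = l' := by
  refine List.ext_getElem h fun i h₁ h₂ => ?_
  have a := hs i h₁.le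
  have b := hs (i + 1) h₁
  rw [List.sum_take_succ _ _ h₁, List.sum_take_succ _ _ h₂] at b
  omega

lemma List.sum_take_cons (a : ℕ) (l : List ℕ) (i : ℕ) :
    ((a :: l).take i).sum = if i = 0 then 0 else a + (l.take (i - 1)).sum := by
  cases i <;> simp

lemma List.flatten_splitLengths_eq_take (ks ls : List ℕ) :
    (ks.splitLengths ls).flatten = ls.take ks.sum := by
  induction ks generalizing ls with
  | nil => simp
  | cons k ks ih => simp [List.splitLengths_cons, ih, List.take_add]

/-- Summing ls over consecutive blocks of sizes ks composes the two partial-sum functions. -/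
lemma List.sum_take_map_splitLengths (ks ls : List ℕ) (i : ℕ) :
    (((ks.splitLengths ls).map List.sum).take i).sum = (ls.take (ks.take i).sum).sum := by
  rw [← List.map_take, List.take_splitLength, ← List.flatten_splitLengths_eq_take,
    List.sum_flatten]

/-- The list of increments of a function on `{0, …, n}`. -/
def increments (F : ℕ → ℕ) (n : ℕ) : List ℕ := (List.range n).map fun i => F (i + 1) - F i

@[simp] lemma length_increments (F : ℕ → ℕ) (n : ℕ) : (increments F n).length = n := by
  simp [increments]

lemma sum_increments {F : ℕ → ℕ} (hF : Monotone F) (h₀ : F 0 = 0) (n : ℕ) :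
    (increments F n).sum = F n := by
  induction n with
  | zero => simp [increments, h₀]
  | succ n ih =>
    have := hF (Nat.le_succ n)
    rw [increments, List.range_succ, List.map_append, List.sum_append, ← increments, ih]
    simp at *
    omega

lemma sum_take_increments {F : ℕ → ℕ} (hF : Monotone F) (h₀ : F 0 = 0) {n i : ℕ} (hi : i ≤ n) :
    ((increments F n).take i).sum = F i := by
  rw [increments, ← List.map_take, List.take_range, min_eq_left hi, ← increments,
    sum_increments hF h₀]

/-- The extension of a map `f : [p] ⟶ [q]` to a map `{0, …, p + 2} ⟶ {0, …, q}` with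
`0 ↦ 0`, `i + 1 ↦ f i` and `p + 2 ↦ q`. -/
def extend {X Y : SimplexCategory} (f : X ⟶ Y) : ℕ → ℕ
  | 0 => 0
  | i + 1 => if h : i < X.len + 1 then (f.toOrderHom ⟨i, h⟩).val else Y.len

lemma extend_succ {X Y : SimplexCategory} (f : X ⟶ Y) (i : ℕ) (h : i < X.len + 1) :
    extend f (i + 1) = (f.toOrderHom ⟨i, h⟩).val := dif_pos h

lemma extend_last {X Y : SimplexCategory} (f : X ⟶ Y) : extend f (X.len + 2) = Y.len :=
  dif_neg (by omega)

lemma extend_monotone {X Y : SimplexCategory} (f : X ⟶ Y) : Monotone (extend f) := by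
  refine monotone_nat_of_le_succ fun i => ?_
  cases i with
  | zero => exact Nat.zero_le _
  | succ i =>
    by_cases h : i + 1 < X.len + 1
    · rw [extend_succ f i (by omega), extend_succ f (i + 1) h]
      exact f.toOrderHom.monotone (by simp)
    · by_cases h' : i < X.len + 1
      · rw [extend_succ f i h', extend, dif_neg h]
        exact Nat.lt_succ_iff.1 (f.toOrderHom _).isLt
      · rw [extend, extend, dif_neg h, dif_neg h']

/-- The list of gaps of the values of a map `f : [p] ⟶ [q]`, of length `p + 2` and sum `q`. -/
def gaps {X Y : SimplexCategory} (f : X ⟶ Y) : List ℕ := increments (extend f) (X.len + 2)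

lemma length_gaps {X Y : SimplexCategory} (f : X ⟶ Y) : (gaps f).length = X.len + 2 :=
  length_increments _ _

lemma sum_gaps {X Y : SimplexCategory} (f : X ⟶ Y) : (gaps f).sum = Y.len := by
  rw [gaps, sum_increments (extend_monotone f) rfl, extend_last]

lemma sum_take_gaps {X Y : SimplexCategory} (f : X ⟶ Y) {i : ℕ} (hi : i ≤ X.len + 2) :
    ((gaps f).take i).sum = extend f i :=
  sum_take_increments (extend_monotone f) rfl hi

lemma eq_gaps {X Y : SimplexCategory} (f : X ⟶ Y) (l : List ℕ) (hl : l.length = X.len + 2)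
    (h₁ : ∀ i (h : i < X.len + 1), (l.take (i + 1)).sum = (f.toOrderHom ⟨i, h⟩).val)
    (h₂ : l.sum = Y.len) : l = gaps f := by
  refine List.eq_of_sum_take (hl.trans (length_gaps f).symm) fun i hi => ?_
  rw [sum_take_gaps f (by omega)]
  cases i with
  | zero => rfl
  | succ i =>
    by_cases h : i < X.len + 1
    · rw [h₁ i h, extend_succ f i h]
    · obtain rfl : i = X.len + 1 := by omega
      rw [extend_last, ← h₂, List.take_of_length_le hl.le]

end Lists

/-! ### The cosimplicial object of a multiplicative operad -/

section Functor

variable {D : Type u} [Category.{v} D] [DuoidalCategory D] {A : OneOperad D}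
  (m : OperadHom (assOperad D) A)

/-- `inner_inner` for ls cut into blocks of lengths ks. The condition on ms says that its
partial-sum function is the composite of the other two. -/
lemma OperadHom.inner_comp (ks ls ms : List ℕ) {p q r : ℕ} (hp : p = ks.length)
    (hq : ks.sum = q) (hq' : q = ls.length) (hr : ls.sum = r) (hp' : p = ms.length)
    (hr' : ms.sum = r)
    (h : ∀ i ≤ p, (ms.take i).sum = (ls.take (ks.take i).sum).sum) :
    m.inner ks hp hq ≫ m.inner ls hq' hr = m.inner ms hp' hr' := by
  have e₁ : (ks.splitLengths ls).map List.length = ks :=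
    List.map_splitLengths_length _ _ (by omega)
  have e₂ : (ks.splitLengths ls).flatten = ls := List.flatten_splitLengths _ _ (by omega)
  have e₃ : (ks.splitLengths ls).map List.sum = ms := by
    refine List.eq_of_sum_take (by simp; omega) fun i hi => ?_
    rw [List.sum_take_map_splitLengths, h i (by simpa [hp] using hi)]
  have := m.inner_inner (ks.splitLengths ls) (n := p) (q := q) (s := r) (by rwa [e₁])
    (by rwa [e₁]) (by rwa [e₂]) (by rwa [e₂]) (by rwa [e₃]) (by rwa [e₃])
  simpa only [e₁, e₂, e₃] using this

lemma OperadHom.inner_comp₃ (ks ls ns ms : List ℕ) {p q r t : ℕ} (hp : p = ks.length)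
    (hq : ks.sum = q) (hq' : q = ls.length) (hr : ls.sum = r) (hr' : r = ns.length)
    (ht : ns.sum = t) (hp' : p = ms.length) (ht' : ms.sum = t)
    (h : ∀ i ≤ p, (ms.take i).sum = (ns.take (ls.take (ks.take i).sum).sum).sum) :
    m.inner ks hp hq ≫ m.inner ls hq' hr ≫ m.inner ns hr' ht = m.inner ms hp' ht' := by
  have e : ((ks.splitLengths ls).map List.sum).sum = r := by
    rw [← List.sum_flatten, List.flatten_splitLengths_eq_take,
      List.take_of_length_le (by omega), hr]
  rw [← Category.assoc, m.inner_comp ks ls ((ks.splitLengths ls).map List.sum) hp hq hq' hr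
    (by simp [hp]) e fun i _ => List.sum_take_map_splitLengths ks ls i]
  refine m.inner_comp _ _ _ _ _ _ _ _ _ fun i hi => ?_
  rw [h i hi, List.sum_take_map_splitLengths]

/-- The composite `A p ⟶ A (p + 2) ⟶ A q` of the multiplication on both sides with `v ⟶ A 1`
and an inner operator. -/
def OperadHom.framed (ks : List ℕ) {p q : ℕ} (hp : p + 2 = ks.length) (hq : ks.sum = q) :
    A.obj p ⟶ A.obj q :=
  m.rmul p 1 (p + 1) rfl ≫ m.lmul 1 (p + 1) (p + 2) (by omega) ≫ m.inner ks hp hq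

/-- The outermost entries of the list meet only the two adjoined factors m_1, which they turn into
m_a and m_b. -/
lemma OperadHom.framed_eq (l : List ℕ) (a b : ℕ) {p q q' s : ℕ}
    (hp : p + 2 = (a :: (l ++ [b])).length) (hq : (a :: (l ++ [b])).sum = q)
    (hp' : p = l.length) (hq' : l.sum = q') (hs : q' + b = s) (ht : a + s = q) :
    m.framed (a :: (l ++ [b])) hp hq = m.inner l hp' hq' ≫ m.rmul q' b s hs ≫ m.lmul a s q ht := by
  rw [OperadHom.framed, m.lmul_inner a (l ++ [b]) (n := p + 1) (p := s) (by simp [hp'])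
    (by simp [hq', hs]) hp hq _ ht, reassoc_of% m.rmul_inner l b hp' hq' _ _ _ hs]

/-- The two factors m_1 adjoined for g are moved in front of the inner operator of f, whose list
then gains an outer entry 1 at each end. Framing twice by m_1 equals framing once and doubling the
outer factors. Three inner operators remain, and they are composed by comparing partial sums. -/
lemma OperadHom.framed_comp {X Y Z : SimplexCategory} (f : X ⟶ Y) (g : Y ⟶ Z) :
    m.framed (gaps f) (length_gaps f).symm (sum_gaps f) ≫
        m.framed (gaps g) (length_gaps g).symm (sum_gaps g) =
      m.framed (gaps (f ≫ g)) (length_gaps _).symm (sum_gaps _) := by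
  have h₁ := m.framed_eq (gaps f) 1 1 (p := X.len + 2) (q := Y.len + 2) (by simp [length_gaps])
    (by simp [sum_gaps]; omega) (length_gaps f).symm (sum_gaps f) (s := Y.len + 1) rfl
    (by omega)
  -- The outer entries 2 turn each adjoined m_1 into m_2 = m_1 m_1, which accounts for two
  -- successive framings.
  have h₂ := m.framed_eq (List.replicate X.len 1) 2 2 (p := X.len) (q := X.len + 4) (by simp)
    (by simp; omega) (by simp) (q' := X.len) (by simp)
    (s := X.len + 2) rfl (by omega)
  rw [m.inner_replicate_one, Category.id_comp] at h₂
  have h₃ : m.rmul X.len 2 (X.len + 2) rfl ≫ m.lmul 2 (X.len + 2) (X.len + 4) (by omega) =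
      m.rmul X.len 1 (X.len + 1) rfl ≫ m.lmul 1 (X.len + 1) (X.len + 2) (by omega) ≫
      m.rmul (X.len + 2) 1 (X.len + 3) rfl ≫ m.lmul 1 (X.len + 3) (X.len + 4) (by omega) := by
    rw [← reassoc_of% m.rmul_lmul 1 (X.len + 1) 1 (X.len + 2) (X.len + 2) (X.len + 3) rfl
      (by omega) (by omega) rfl, reassoc_of% m.rmul_rmul X.len 1 1 _ _ 2 _ _ rfl rfl,
      m.lmul_lmul 1 1 (X.len + 2) (X.len + 3) (X.len + 4) 2 _ _ rfl]
  rw [← h₂] at h₃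
  simp only [OperadHom.framed, Category.assoc] at h₁ h₃ ⊢
  rw [← reassoc_of% h₁, ← reassoc_of% h₃]
  congr 2
  -- At i + 1 ≤ p + 1 the partial sums are successively i + 2, f(i) + 1 and g(f(i)): the entry 2 and
  -- then the entry 1 at the front supply exactly the shifts needed to evaluate f and g. At p + 2
  -- all three lists are exhausted.
  refine m.inner_comp₃ _ _ _ _ _ _ _ _ _ _ _ _ fun i hi => ?_
  rw [sum_take_gaps _ hi]
  cases i with
  | zero => simp [extend]
  | succ i =>
    by_cases h : i < X.len + 1
    · have a : ((2 :: (List.replicate X.len 1 ++ [2])).take (i + 1)).sum = i + 2 := by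
        simp [List.take_append, List.take_replicate, List.sum_take_cons]
        split_ifs <;> omega
      have b : ((1 :: (gaps f ++ [1])).take (i + 2)).sum = (f.toOrderHom ⟨i, h⟩).val + 1 := by
        rw [List.take_succ_cons, List.sum_cons,
          List.take_append_of_le_length (by rw [length_gaps]; omega), sum_take_gaps f (by omega),
          extend_succ f i h, add_comm]
      have hf := (f.toOrderHom ⟨i, h⟩).isLt
      rw [a, b, sum_take_gaps g (by omega), extend_succ _ i h, extend_succ _ _ hf]
      rfl
    · obtain rfl : i = X.len + 1 := by omega
      rw [extend_last, List.take_of_length_le (l := 2 :: _) (by simp),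
        List.take_of_length_le (l := 1 :: _) (by simp [length_gaps]; omega),
        List.take_of_length_le (l := gaps g) (by simp [length_gaps, sum_gaps]; omega), sum_gaps]

/-- The cosimplicial object with `A n` at `[n]` of a multiplicative operad. -/
def OperadHom.cosimplicial : CosimplicialObject D where
  obj X := A.obj X.len
  map f := m.framed (gaps f) (length_gaps f).symm (sum_gaps f)
  map_id X := by
    -- The identity has outer gaps 0, and so its two adjoined factors become the unit m_0.
    have h : 0 :: (List.replicate X.len 1 ++ [0]) = gaps (𝟙 X) := by
      refine eq_gaps _ _ (by simp) (fun i hi => ?_) (by simp)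
      simp [List.take_append, List.take_replicate, List.sum_take_cons]
      omega
    have h' := m.framed_eq (List.replicate X.len 1) 0 0 (p := X.len) (q := X.len) (by simp)
      (by simp) (by simp) (q' := X.len) (by simp) (s := X.len) rfl (by simp)
    simp only [h] at h'
    rw [h', m.lmul_zero, m.rmul_zero, m.inner_replicate_one]
    simp
  map_comp f g := (m.framed_comp f g).symm

lemma OperadHom.framed_zero_zero (l : List ℕ) {p q : ℕ}
    (hp : p + 2 = (0 :: (l ++ [0])).length) (hq : (0 :: (l ++ [0])).sum = q)
    (hp' : p = l.length) (hq' : l.sum = q) :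
    m.framed (0 :: (l ++ [0])) hp hq = m.inner l hp' hq' := by
  rw [m.framed_eq l 0 0 hp hq hp' hq' (s := q) rfl (zero_add _), m.rmul_zero, m.lmul_zero]
  simp

/-- Read off the gaps: δ_0 has outer gaps 1 and 0, the last coface 0 and 1, and an inner coface 0
and 0 with one entry 2 in between. Only the two outer cofaces therefore keep a multiplication by
m_1. -/
lemma OperadHom.cosimplicial_δ (n : ℕ) (i : Fin (n + 2)) :
    m.cosimplicial.δ i = m.coface n i := by
  change m.framed (gaps (SimplexCategory.δ i)) _ _ = _
  rw [OperadHom.coface]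
  split_ifs with h₀ h₁
  · obtain rfl : i = 0 := Fin.ext h₀
    have h : 1 :: (List.replicate n 1 ++ [0]) = gaps (SimplexCategory.δ (0 : Fin (n + 2))) := by
      refine eq_gaps _ _ (by simp) (fun j hj => ?_) (by simp [add_comm])
      simp [SimplexCategory.δ, List.take_append, List.take_replicate, List.sum_take_cons] at hj ⊢
      omega
    have h' := m.framed_eq (List.replicate n 1) 1 0 (p := n) (q := n + 1) (by simp)
      (by simp [add_comm]) (by simp) (q' := n) (by simp) (s := n) rfl (by omega)
    simp only [h] at h'
    rw [m.cofaceFirst_eq]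
    refine h'.trans ?_
    rw [m.rmul_zero, m.inner_replicate_one]
    simp
  · obtain rfl : i = Fin.last _ := Fin.ext h₁
    have h : 0 :: (List.replicate n 1 ++ [1]) = gaps (SimplexCategory.δ (Fin.last (n + 1))) := by
      refine eq_gaps _ _ (by simp) (fun j hj => ?_) (by simp)
      simp [SimplexCategory.δ, List.take_append, List.take_replicate, List.sum_take_cons] at hj ⊢
      split_ifs <;> omega
    have h' := m.framed_eq (List.replicate n 1) 0 1 (p := n) (q := n + 1) (by simp)
      (by simp) (by simp) (q' := n) (by simp) (s := n + 1) rfl (by omega)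
    simp only [h] at h'
    rw [m.cofaceLast_eq]
    refine h'.trans ?_
    rw [m.lmul_zero, m.inner_replicate_one]
    simp
  · have hi := i.isLt
    have h : 0 :: ((List.replicate (i.val - 1) 1 ++ 2 :: List.replicate (n - i.val) 1) ++ [0]) =
        gaps (SimplexCategory.δ i) := by
      refine eq_gaps _ _ (by simp; omega) (fun j hj => ?_) (by simp; omega)
      simp [SimplexCategory.δ, List.take_append, List.take_replicate, List.sum_take_cons,
        Fin.succAbove, Fin.lt_def] at hj ⊢
      split_ifs <;> simp <;> omega
    have h' := m.framed_zero_zero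
      (List.replicate (i.val - 1) 1 ++ 2 :: List.replicate (n - i.val) 1)
      (p := n) (q := n + 1) (by simp; omega) (by simp; omega) (by simp; omega) (by simp; omega)
    simp only [h] at h'
    exact h'

lemma OperadHom.cosimplicial_σ (n : ℕ) (i : Fin (n + 1)) :
    m.cosimplicial.σ i = m.codegeneracy n i := by
  change m.framed (gaps (SimplexCategory.σ i)) _ _ = _
  have hi := i.isLt
  have h : 0 :: ((List.replicate i.val 1 ++ 0 :: List.replicate (n - i.val) 1) ++ [0]) =
      gaps (SimplexCategory.σ i) := by
    refine eq_gaps _ _ (by simp; omega) (fun j hj => ?_) (by simp; omega)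
    simp [SimplexCategory.σ, List.take_append, List.take_replicate, List.sum_take_cons,
      Fin.predAbove, Fin.lt_def] at hj ⊢
    split_ifs <;> simp <;> omega
  have h' := m.framed_zero_zero (List.replicate i.val 1 ++ 0 :: List.replicate (n - i.val) 1)
    (p := n + 1) (q := n) (by simp; omega) (by simp; omega) (by simp; omega) (by simp; omega)
  simp only [h] at h'
  exact h'

/-- The cosimplicial object induced by a multiplicative operad. -/
def OperadHom.inducedCosimplicial : InducedCosimplicial m where
  X := m.cosimplicial
  iso n := Iso.refl _
  δ_iso n i := by
    rw [m.cosimplicial_δ]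
    exact (Category.comp_id _).trans (Category.id_comp _).symm
  σ_iso n i := by
    rw [m.cosimplicial_σ]
    exact (Category.comp_id _).trans (Category.id_comp _).symm

end Functor

end DuoidalCenter

namespace DuoidalCenter

/-! ### Limits detected by enriched representables; the cotensor by I -/

section Enriched

variable (V : Type u') [Category.{v'} V] [MonoidalCategory V] {D : Type u} [Category.{v} D]
  [EnrichedOrdinaryCategory V D]

lemma eHomEquiv_eHomWhiskerRight {X Y Z : D} (g : X ⟶ Y) (f : Y ⟶ Z) :
    eHomEquiv V f ≫ eHomWhiskerRight V g Z = eHomEquiv V (g ≫ f) := by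
  rw [eHomWhiskerRight, eHomEquiv_comp, leftUnitor_inv_naturality_assoc,
    ← tensorHom_def'_assoc]

lemma eHomEquiv_eHomWhiskerLeft {X Y Z : D} (g : X ⟶ Y) (f : Y ⟶ Z) :
    eHomEquiv V g ≫ eHomWhiskerLeft V X f = eHomEquiv V (g ≫ f) := by
  rw [eHomWhiskerLeft, eHomEquiv_comp, rightUnitor_inv_naturality_assoc,
    ← tensorHom_def_assoc, unitors_inv_equal]

variable {V} in
lemma hom_ext_of_isLimit_eCoyoneda {I : Type*} [Category* I] {K : I ⥤ D} {c : Cone K} {Y : D}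
    (hc : IsLimit ((eCoyoneda V Y).mapCone c)) {g g' : Y ⟶ c.pt}
    (h : ∀ j, g ≫ c.π.app j = g' ≫ c.π.app j) : g = g' := by
  apply (eHomEquiv V).injective
  refine hc.hom_ext fun j => ?_
  refine (eHomEquiv_eHomWhiskerLeft V g (c.π.app j)).trans ?_
  rw [h]
  exact (eHomEquiv_eHomWhiskerLeft V g' (c.π.app j)).symm

variable {V} in
-- A cone s is the same as a cone with apex 𝟙_ V over the hom-objects out of its own apex. The
-- universal property in V, tested only on 𝟙_ V, produces an ordinary morphism.
lemma exists_lift_of_isLimit_eCoyoneda {I : Type*} [Category* I] {K : I ⥤ D} {c : Cone K}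
    {s : Cone K} (hc : IsLimit ((eCoyoneda V s.pt).mapCone c)) :
    ∃ l : s.pt ⟶ c.pt, ∀ j, l ≫ c.π.app j = s.π.app j := by
  let t : Cone (K ⋙ eCoyoneda V s.pt) :=
    { pt := 𝟙_ V
      π :=
        { app j := eHomEquiv V (s.π.app j)
          naturality i j f := by
            rw [← s.w f]
            exact (Category.id_comp _).trans
              (eHomEquiv_eHomWhiskerLeft V (s.π.app i) (K.map f)).symm } }
  refine ⟨(eHomEquiv V).symm (hc.lift t), fun j => ?_⟩
  apply (eHomEquiv V).injective
  refine (eHomEquiv_eHomWhiskerLeft V _ (c.π.app j)).symm.trans (Eq.trans ?_ (hc.fac t j))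
  exact congrArg (fun k => k ≫ eHomWhiskerLeft V s.pt (c.π.app j)) (Equiv.apply_symm_apply _ _)

lemma exists_preserved_limitCone [Enriched.HasConicalLimitsOfSize.{0, 0} V D]
    (φ : SimplexCategory ⥤ D) :
    ∃ c : Cone φ, ∀ x : D, Nonempty (IsLimit ((eCoyoneda V x).mapCone c)) := by
  have := Enriched.HasConicalLimitsOfShape.hasConicalLimit (V := V) φ
  exact ⟨limit.cone φ, fun x => ⟨isLimitOfPreserves (eCoyoneda V x) (limit.isLimit φ)⟩⟩

variable [SymmetricCategory V] [MonoidalClosed V]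

/-- The canonical morphism `y ^ I ⟶ y`. -/
def Cotensor.toBase {V} [Category.{v'} V] [MonoidalCategory V] [EnrichedOrdinaryCategory V D]
    [SymmetricCategory V] [MonoidalClosed V] {y : D} (c : Cotensor (𝟙_ V) y) : c.obj ⟶ y :=
  (eHomEquiv V).symm c.ev

lemma Cotensor.comp_toBase {y x : D} (c : Cotensor (𝟙_ V) y) (k : x ⟶ c.obj) :
    eHomEquiv V (k ≫ c.toBase) = c.ev ≫ eHomWhiskerRight V k y := by
  rw [← eHomEquiv_eHomWhiskerRight, Cotensor.toBase, Equiv.apply_symm_apply]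

/-- The inverse is the lift of the identity element of D(y, y); it is two-sided because, by
`comp_toBase`, maps into the cotensor are determined after `toBase`. -/
instance Cotensor.isIso_toBase {y : D} (c : Cotensor (𝟙_ V) y) : IsIso c.toBase := by
  have h : c.lift V (eHomEquiv V (𝟙 y)) ≫ c.toBase = 𝟙 y := by
    apply (eHomEquiv V).injective
    rw [Cotensor.comp_toBase, Cotensor.lift_ev]
  refine ⟨c.lift V (eHomEquiv V (𝟙 y)), c.hom_ext V ?_, h⟩
  rw [← Cotensor.comp_toBase, ← Cotensor.comp_toBase, Category.assoc, h, Category.comp_id,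
    Category.id_comp]

end Enriched

/-! ### Ends of bifunctors constant in the contravariant variable -/

section ConstantEnd

variable {J : Type*} [Category* J] {D : Type u} [Category.{v} D] {F : Jᵒᵖ ⥤ J ⥤ D} {φ : J ⥤ D}
  (e : F ≅ (Functor.const Jᵒᵖ).obj φ)

lemma constEnd_map_app {a b : J} (f : a ⟶ b) (c : J) :
    (F.map f.op).app c ≫ (e.hom.app (op a)).app c = (e.hom.app (op b)).app c := by
  exact (NatTrans.congr_app (e.hom.naturality f.op) c).trans (Category.comp_id _)

/-- For such a bifunctor the wedge condition is the naturality of a cone, transported along `e`.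
With a general G the computation serves both wedges in D (G the identity) and their images under
representables. -/
lemma constEnd_balanced {C : Type*} [Category* C] (G : D ⥤ C) {a b : J} (f : a ⟶ b) {s : C}
    (x : s ⟶ G.obj ((F.obj (op a)).obj a)) (y : s ⟶ G.obj ((F.obj (op b)).obj b))
    (h : x ≫ G.map ((F.obj (op a)).map f) = y ≫ G.map ((F.map f.op).app b)) :
    (x ≫ G.map ((e.hom.app (op a)).app a)) ≫ G.map (φ.map f) =
      y ≫ G.map ((e.hom.app (op b)).app b) := by
  have h' := (e.hom.app (op a)).naturality f
  have h'' : (e.hom.app (op a)).app a ≫ φ.map f =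
    (F.obj (op a)).map f ≫ (e.hom.app (op a)).app b := h'.symm
  rw [Category.assoc, ← G.map_comp, h'', G.map_comp, reassoc_of% h, ← G.map_comp,
    constEnd_map_app]

lemma constEnd_inv_map {a b : J} (f : a ⟶ b) :
    (e.inv.app (op a)).app a ≫ (F.obj (op a)).map f =
      φ.map f ≫ (e.inv.app (op b)).app b ≫ (F.map f.op).app b := by
  have h := (e.inv.app (op a)).naturality f
  have h' := NatTrans.congr_app (e.inv.naturality f.op) b
  simp only [Functor.const_obj_obj, Functor.const_obj_map, NatTrans.comp_app,
    Category.id_comp] at h h'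
  rw [← h, h']

/-- The leg at `a` of the cone given by a wedge for a functor constant in the first variable. -/
def wedgeLeg (W : Wedge F) (a : J) : W.pt ⟶ φ.obj a :=
  W.ι a ≫ (e.hom.app (op a)).app a

lemma wedgeLeg_naturality (W : Wedge F) {a b : J} (f : a ⟶ b) :
    wedgeLeg e W a ≫ φ.map f = wedgeLeg e W b :=
  constEnd_balanced e (𝟭 D) f (W.ι a) (W.ι b) (W.condition f)

/-- The wedge given by a cone. -/
def coneWedge (c : Cone φ) : Wedge F :=
  Wedge.mk c.pt (fun a => c.π.app a ≫ (e.inv.app (op a)).app a) fun a b f => by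
    rw [Category.assoc, Category.assoc, constEnd_inv_map, ← c.w f, Category.assoc]

variable {C : Type*} [Category* C] (G : D ⥤ C)

lemma wedgeCone_balanced (s : Cone ((multicospanIndexEnd F).multicospan ⋙ G)) {a b : J}
    (f : a ⟶ b) :
    (show s.pt ⟶ G.obj ((F.obj (op a)).obj a) from s.π.app (WalkingMulticospan.left a)) ≫
        G.map ((F.obj (op a)).map f) =
      (show s.pt ⟶ G.obj ((F.obj (op b)).obj b) from s.π.app (WalkingMulticospan.left b)) ≫
        G.map ((F.map f.op).app b) :=
  (s.w (WalkingMulticospan.Hom.fst (J := multicospanShapeEnd J) (Arrow.mk f))).trans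
    (s.w (WalkingMulticospan.Hom.snd (J := multicospanShapeEnd J) (Arrow.mk f))).symm

/-- A cone on the image of the diagram of wedges gives a cone on the image of `φ`. -/
def coneOfWedgeCone (s : Cone ((multicospanIndexEnd F).multicospan ⋙ G)) : Cone (φ ⋙ G) where
  pt := s.pt
  π :=
    { app a := (show s.pt ⟶ G.obj ((F.obj (op a)).obj a) from
        s.π.app (WalkingMulticospan.left a)) ≫ G.map ((e.hom.app (op a)).app a)
      naturality _ _ f := (Category.id_comp _).trans
        (constEnd_balanced e G f _ _ (wedgeCone_balanced G s f)).symm }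

/-- The legs at the off-diagonal objects are composites of diagonal legs with the first structure
maps, so only the diagonal ones need checking. -/
lemma wedgeCone_fac (s t : Cone ((multicospanIndexEnd F).multicospan ⋙ G)) {f : s.pt ⟶ t.pt}
    (h : ∀ a, f ≫ t.π.app (WalkingMulticospan.left a) = s.π.app (WalkingMulticospan.left a))
    (j : WalkingMulticospan (multicospanShapeEnd J)) : f ≫ t.π.app j = s.π.app j := by
  cases j with
  | left a => exact h a
  | right r =>
    refine (congrArg (fun g => f ≫ g)
      (t.w (WalkingMulticospan.Hom.fst (J := multicospanShapeEnd J) r)).symm).trans ?_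
    refine (Category.assoc _ _ _).symm.trans ?_
    exact (congrArg (fun k => k ≫ _) (h _)).trans
      (s.w (WalkingMulticospan.Hom.fst (J := multicospanShapeEnd J) r))

lemma comp_map_inv_app {s : C} {a : J} (x : s ⟶ G.obj ((F.obj (op a)).obj a)) :
    (x ≫ G.map ((e.hom.app (op a)).app a)) ≫ G.map ((e.inv.app (op a)).app a) = x := by
  rw [Category.assoc, ← G.map_comp, ← NatTrans.comp_app, ← NatTrans.comp_app, e.hom_inv_id]
  simp

lemma comp_map_hom_app {s : C} {a : J} (x : s ⟶ G.obj (φ.obj a)) :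
    (x ≫ G.map ((e.inv.app (op a)).app a)) ≫ G.map ((e.hom.app (op a)).app a) = x := by
  have h := NatTrans.congr_app (NatTrans.congr_app e.inv_hom_id (op a)) a
  have h' : (e.inv.app (op a)).app a ≫ (e.hom.app (op a)).app a = 𝟙 (φ.obj a) := h
  rw [Category.assoc, ← G.map_comp, h', G.map_id, Category.comp_id]

/-- A functor which preserves a limit of `φ` sends the associated wedge to an end. -/
def isLimitConeWedge (c : Cone φ) (hc : IsLimit (G.mapCone c)) :
    IsLimit (G.mapCone (coneWedge e c)) where
  lift s := hc.lift (coneOfWedgeCone e G s)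
  fac s := wedgeCone_fac G s (G.mapCone (coneWedge e c)) (f := hc.lift (coneOfWedgeCone e G s))
      fun a => by
    refine (congrArg (fun g => hc.lift (coneOfWedgeCone e G s) ≫ g)
      (G.map_comp (c.π.app a) ((e.inv.app (op a)).app a))).trans ?_
    refine (Category.assoc _ _ _).symm.trans ?_
    refine (congrArg (fun g => g ≫ _) (hc.fac (coneOfWedgeCone e G s) a)).trans ?_
    exact comp_map_inv_app e G _
  uniq s k hk := by
    refine hc.hom_ext fun a => Eq.trans ?_ (hc.fac (coneOfWedgeCone e G s) a).symm
    refine (comp_map_hom_app e G (k ≫ G.map (c.π.app a))).symm.trans ?_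
    refine congrArg (fun g => g ≫ G.map ((e.hom.app (op a)).app a)) ?_
    refine Eq.trans ?_ (hk (WalkingMulticospan.left a))
    exact (Category.assoc _ _ _).trans
      (congrArg (fun g => k ≫ g) (G.map_comp (c.π.app a) _)).symm

lemma wedge_ext {V : Type u'} [Category.{v'} V] [MonoidalCategory V]
    [EnrichedOrdinaryCategory V D] {W : Wedge F} {Y : D} {g g' : Y ⟶ W.pt}
    (hW : IsLimit ((eCoyoneda V Y).mapCone W))
    (h : ∀ a, g ≫ W.ι a = g' ≫ W.ι a) : g = g' := by
  refine hom_ext_of_isLimit_eCoyoneda hW fun j => ?_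
  cases j with
  | left a => exact h a
  | right r =>
    have hw := W.w (WalkingMulticospan.Hom.fst (J := multicospanShapeEnd J) r)
    rw [← hw]
    refine (Category.assoc _ _ _).symm.trans (Eq.trans ?_ (Category.assoc _ _ _))
    exact congrArg (fun k => k ≫ _) (h _)

end ConstantEnd

/-! ### The totalization for δ = I as the equalizer of two cofaces -/

section Totalization

variable {V : Type u'} [Category.{v'} V] [MonoidalCategory V] {D : Type u} [Category.{v} D]
  [EnrichedOrdinaryCategory V D] [SymmetricCategory V] [MonoidalClosed V] [Cotensored V D]

variable (V) in
/-- The canonical isomorphism from the cotensor `φ([b]) ^ I` to `φ([b])`. -/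
noncomputable def unitCotensorIso (φ : CosimplicialObject D) :
    cotensorBifunctor V (unitCosimplicial V) φ ≅ (Functor.const SimplexCategoryᵒᵖ).obj φ :=
  NatIso.ofComponents (fun a => NatIso.ofComponents
    (fun b => @asIso _ _ _ _ _ (Cotensor.isIso_toBase V (Cotensored.cot (𝟙_ V) (φ.obj b))))
    (fun {b b'} f => by
      apply (eHomEquiv V).injective
      refine (Cotensor.comp_toBase V _ _).trans ((Cotensor.lift_ev V _ _).trans ?_)
      refine Eq.trans ?_ (eHomEquiv_eHomWhiskerLeft V _ (φ.map f))
      exact congrArg (fun g => g ≫ eHomWhiskerLeft V _ (φ.map f))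
        (Equiv.apply_symm_apply _ _).symm)) (fun {a a'} f => by
    ext b
    -- δ is constant, so the contravariant variable acts through the identity of 𝟙_ V.
    have h : ((cotensorBifunctor V (unitCosimplicial V) φ).map f).app b = 𝟙 _ := by
      change ((cotensorFunctor V D).map (𝟙 (op (𝟙_ V)))).app (φ.obj b) = _
      rw [CategoryTheory.Functor.map_id]
      rfl
    rw [NatTrans.comp_app, h]
    exact (Category.id_comp _).trans (Category.comp_id _).symm)

lemma nonempty_totalization [Enriched.HasConicalLimitsOfSize.{0, 0} V D]
    (φ : CosimplicialObject D) : Nonempty (Totalization V (unitCosimplicial V) φ) := by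
  obtain ⟨c, hc⟩ := exists_preserved_limitCone V φ
  exact ⟨⟨coneWedge (unitCotensorIso V φ) c, fun x => (hc x).map fun h =>
    isLimitConeWedge (unitCotensorIso V φ) _ c h⟩⟩

variable {φ : SimplexCategory ⥤ D} (T : Totalization V (unitCosimplicial V) φ)

lemma Totalization.proj_eq (n : ℕ) : T.proj n =
    wedgeLeg (unitCotensorIso V φ) T.wedge (SimplexCategory.mk n) := rfl

lemma Totalization.hom_ext_legs {Y : D} {g g' : Y ⟶ T.wedge.pt}
    (h : ∀ a, g ≫ wedgeLeg (unitCotensorIso V φ) T.wedge a =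
      g' ≫ wedgeLeg (unitCotensorIso V φ) T.wedge a) : g = g' := by
  obtain ⟨hT⟩ := T.isEnd Y
  refine wedge_ext hT fun a => ?_
  have h' := congrArg (fun k => k ≫ ((unitCotensorIso V φ).inv.app (op a)).app a) (h a)
  have key := fun k : Y ⟶ T.wedge.pt => comp_map_inv_app (unitCotensorIso V φ) (𝟭 D)
    (k ≫ T.wedge.ι a)
  refine (key g).symm.trans (Eq.trans ?_ (key g'))
  refine (congrArg (fun k => k ≫ _) (Category.assoc _ _ _)).trans (h'.trans ?_)
  exact (congrArg (fun k => k ≫ _) (Category.assoc _ _ _)).symm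

lemma Totalization.exists_lift {Y : D} (f : ∀ a, Y ⟶ φ.obj a)
    (hf : ∀ {a b : SimplexCategory} (g : a ⟶ b), f a ≫ φ.map g = f b) :
    ∃ l : Y ⟶ T.wedge.pt, ∀ a, l ≫ wedgeLeg (unitCotensorIso V φ) T.wedge a = f a := by
  obtain ⟨hT⟩ := T.isEnd Y
  let s : Cone φ :=
    ⟨Y, { app := f, naturality := fun a b g => (Category.id_comp _).trans (hf g).symm }⟩
  obtain ⟨l, hl⟩ := exists_lift_of_isLimit_eCoyoneda (s := coneWedge (unitCotensorIso V φ) s) hT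
  refine ⟨l, fun a => ?_⟩
  refine (Category.assoc _ _ _).symm.trans ?_
  refine (congrArg (fun k => k ≫ ((unitCotensorIso V φ).hom.app (op a)).app a)
    (hl (WalkingMulticospan.left a))).trans ?_
  exact comp_map_hom_app (unitCotensorIso V φ) (𝟭 D) (f a)

lemma Totalization.proj_δ : T.proj 0 ≫ φ.map (SimplexCategory.δ (0 : Fin 2)) =
    T.proj 0 ≫ φ.map (SimplexCategory.δ (1 : Fin 2)) := by
  rw [T.proj_eq, wedgeLeg_naturality,
    wedgeLeg_naturality]

/-- Every leg is the leg at [0] followed by the image of the vertex 0 of [n], which makes `T.proj 0`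
monic. -/
lemma Totalization.hom_ext {Y : D} {g g' : Y ⟶ T.wedge.pt}
    (h : g ≫ T.proj 0 = g' ≫ T.proj 0) : g = g' := by
  refine T.hom_ext_legs fun a => ?_
  rw [← wedgeLeg_naturality (unitCotensorIso V φ) T.wedge
      (SimplexCategory.const (SimplexCategory.mk 0) a 0),
    ← T.proj_eq, reassoc_of% h]

/-- For i ≤ j the vertices i and j are the two faces of an edge [1] → [n], along which the
hypothesis is pushed. -/
lemma comp_map_const {Y : D} {f : Y ⟶ φ.obj (SimplexCategory.mk 0)}
    (hf : f ≫ φ.map (SimplexCategory.δ (0 : Fin 2)) = f ≫ φ.map (SimplexCategory.δ (1 : Fin 2)))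
    (a : SimplexCategory)
    (i j : Fin (a.len + 1)) :
    f ≫ φ.map (SimplexCategory.const (SimplexCategory.mk 0) a i) =
      f ≫ φ.map (SimplexCategory.const (SimplexCategory.mk 0) a j) := by
  wlog h : i ≤ j generalizing i j
  · exact (this j i (le_of_not_ge h)).symm
  · have h₀ : SimplexCategory.δ (0 : Fin 2) ≫ SimplexCategory.mkOfLe (n := a.len) i j h =
        SimplexCategory.const (SimplexCategory.mk 0) a j := by
      refine SimplexCategory.Hom.ext_zero_left _ _ rfl
    have h₁ : SimplexCategory.δ (1 : Fin 2) ≫ SimplexCategory.mkOfLe (n := a.len) i j h =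
        SimplexCategory.const (SimplexCategory.mk 0) a i := by
      refine SimplexCategory.Hom.ext_zero_left _ _ rfl
    rw [← h₀, ← h₁, φ.map_comp, φ.map_comp]
    exact ((reassoc_of% hf) (φ.map (SimplexCategory.mkOfLe (n := a.len) i j h))).symm

/-- The legs are defined through the vertex 0. A map [n] → [k] sends it to some vertex, and by
`comp_map_const` the choice of vertex is immaterial. -/
lemma Totalization.exists_lift_proj {Y : D} (f : Y ⟶ φ.obj (SimplexCategory.mk 0))
    (hf : f ≫ φ.map (SimplexCategory.δ (0 : Fin 2)) = f ≫ φ.map (SimplexCategory.δ (1 : Fin 2))) :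
    ∃ l : Y ⟶ T.wedge.pt, l ≫ T.proj 0 = f := by
  obtain ⟨l, hl⟩ := T.exists_lift
    (fun a => f ≫ φ.map (SimplexCategory.const (SimplexCategory.mk 0) a 0)) (fun {a b} g => by
      rw [Category.assoc, ← φ.map_comp, SimplexCategory.const_comp]
      exact comp_map_const hf b _ _)
  refine ⟨l, (hl (SimplexCategory.mk 0)).trans ?_⟩
  rw [SimplexCategory.const_eq_id, φ.map_id, Category.comp_id]

end Totalization

end DuoidalCenter

namespace DuoidalCenter

open DuoidalCategory

/-! ### Composition with A(1), the middle coface and balanced elements -/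

section Action

variable {D : Type u} [Category.{v} D] [DuoidalCategory D] {A : OneOperad D}

lemma OneOperad.act_unit (A : OneOperad D) (a : ℕ) :
    (𝟙 (A.obj a) ⊗ₘ A.unit) ≫ A.act a = (ρ_ _).hom := by
  rw [OneOperad.act, tensorHom_comp_tensorHom_assoc, Category.id_comp, Category.comp_id]
  refine Eq.trans ?_ (A.comp_unit a)
  rw [OneOperad.gam]
  simp only [castHom_rfl, id_tensorHom_id, Category.id_comp]
  exact congrArg (fun f => _ ≫ f) (Category.comp_id _)

lemma comp_associative_action {X X' Y Z W : D} (r : X ⟶ X') (g : X' ⊗ Y ⟶ Z)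
    (k : Y ⊗ W ⟶ Y) (l : Z ⊗ W ⟶ Z) (h : (𝟙 X' ⊗ₘ k) ≫ g = (α_ _ _ _).inv ≫ (g ⊗ₘ 𝟙 W) ≫ l) :
    (((r ⊗ₘ 𝟙 Y) ≫ g) ⊗ₘ 𝟙 W) ≫ l = (α_ _ _ _).hom ≫ (𝟙 X ⊗ₘ k) ≫ (r ⊗ₘ 𝟙 Y) ≫ g := by
  rw [tensorHom_comp_tensorHom_assoc, Category.id_comp, Category.comp_id, tensorHom_split r k,
    Category.assoc, h, ← id_tensorHom_id, associator_inv_naturality_assoc,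
    Iso.hom_inv_id_assoc, tensorHom_comp_tensorHom_assoc, Category.id_comp]

lemma OneOperad.act_act (A : OneOperad D) (a : ℕ) :
    (A.act a ⊗ₘ 𝟙 _) ≫ A.act a = (α_ _ _ _).hom ≫ (𝟙 _ ⊗ₘ A.act 1) ≫ A.act a :=
  comp_associative_action (right₁ (A.obj a)).inv (A.gam [a] (n := 1) rfl (by simp)) (A.act 1)
    (A.act a) (A.gam_act [a] rfl (by simp))

lemma OneOperad.unit_act_one (A : OneOperad D) : (A.unit ⊗ₘ 𝟙 _) ≫ A.act 1 = (λ_ _).hom := by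
  have e : unitList A.obj A.unit 1 = A.unit ≫ (right₁ (A.obj 1)).inv := by
    have h : eComul (D := D) ≫ (𝟙 _ ⊠ₘ unitMap) = (right₁ _).inv := by
      rw [← cancel_mono (right₁ _).hom, Category.assoc, eComul_counit, Iso.inv_hom_id]
    change eComul ≫ (A.unit ⊠ₘ unitMap) = _
    rw [tenHom_split', ← Category.assoc, h, right₁_inv_nat]
  have h := A.unit_comp 1
  rw [e] at h
  refine Eq.trans ?_ h
  rw [OneOperad.act, OneOperad.gam, tensorHom_comp_tensorHom_assoc, Category.id_comp,
    ← Category.assoc]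
  exact congrArg (fun f => f ≫ A.γ [1] ≫ castHom A.obj (by simp))
    ((tensorHom_comp_tensorHom _ _ _ _).trans (by rw [Category.comp_id, Category.id_comp]))

variable (m : OperadHom (assOperad D) A)

lemma OperadHom.unitMap_mulMap_one : unitMap ≫ m.mulMap 1 = A.unit := m.app_unit

/-- In elements m_a ∘ m_1 = m_a, up to v ⊗ v → v: this is m being an operad map, for the list [a].
-/
lemma OperadHom.vMul_mulMap (a : ℕ) :
    vMul ≫ m.mulMap a = (m.mulMap a ⊗ₘ m.mulMap 1) ≫ A.act a := by
  have h := m.mulMap_gam [a] (n := 1) (s := a) rfl (by simp)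
  have h' := congrArg (fun f => ((right₁ (vUnit D)).inv ⊗ₘ 𝟙 _) ≫ f) h
  simp only [tensorHom_comp_tensorHom_assoc, Category.id_comp, Category.comp_id] at h'
  have e : (right₁ (vUnit D)).inv ≫ itensMap m.mulMap [a] =
      m.mulMap a ≫ (right₁ (A.obj a)).inv := (right₁_inv_nat (m.mulMap a)).symm
  have e' : (right₁ (vUnit D)).inv ≫ vCollapse [a] = 𝟙 _ := by
    simp [vCollapse, left₁_unit]
  rw [OneOperad.act, tensorHom_comp_tensorHom_assoc, Category.comp_id]
  refine Eq.trans ?_ ((h'.symm).trans ?_)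
  · refine Eq.symm ((congrArg (fun f => (f ⊗ₘ 𝟙 _) ≫ vMul ≫ m.mulMap a) e').trans ?_)
    rw [id_tensorHom_id, Category.id_comp]
  · exact congrArg (fun f => (f ⊗ₘ m.mulMap 1) ≫ A.gam [a] rfl (by simp)) e

lemma right₁_inv_left₁ (X Y : D) :
    ((right₁ X).inv ⊠ₘ 𝟙 Y) ≫ (assoc₁ X (vUnit D) Y).hom ≫ (𝟙 X ⊠ₘ (left₁ Y).hom) = 𝟙 _ := by
  rw [triangle₁, ten_comp, Iso.inv_hom_id, Category.comp_id, ten_id]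

/-- The action `(A a ⊠ A b) ⊗ A 2 ⟶ A c`, `c = a + b`. -/
def OneOperad.act₂ (A : OneOperad D) (a b c : ℕ) (h : a + b = c) :
    (A.obj a ⊠ A.obj b) ⊗ A.obj 2 ⟶ A.obj c :=
  ((𝟙 _ ⊠ₘ (right₁ (A.obj b)).inv) ⊗ₘ 𝟙 _) ≫ A.gam [a, b] rfl (by simpa using h)

/-- The case [a], [b] of `inter_mu`. In elements, (x ∘ y)(x' ∘ y') = (x, x') ∘ (y y'). -/
lemma OperadHom.inter_act (a b c : ℕ) (h : a + b = c) :
    inter _ _ _ _ ≫ (A.act a ⊠ₘ A.act b) ≫ m.mu a b c h =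
      (𝟙 _ ⊗ₘ m.mu 1 1 2 rfl) ≫ A.act₂ a b c h := by
  have h' := m.inter_mu [a] [b] (p := a) (q := b) (r := c) (a := 1) (b := 1) (c := 2) rfl rfl
    (by simp) (by simp) (by simpa using h) rfl h rfl
  have e : ((right₁ (A.obj a)).inv ⊠ₘ (right₁ (A.obj b)).inv) ≫ itensAppend A.obj [a] [b] =
      𝟙 _ ⊠ₘ (right₁ (A.obj b)).inv := by
    rw [tenHom_split']
    refine (Category.assoc _ _ _).trans ?_
    refine (congrArg (fun f => _ ≫ f) (right₁_inv_left₁ (A.obj a) (itens A.obj [b]))).trans ?_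
    exact Category.comp_id _
  have e' : (((right₁ (A.obj a)).inv ⊠ₘ (right₁ (A.obj b)).inv) ⊗ₘ
      (𝟙 (A.obj 1) ⊠ₘ 𝟙 (A.obj 1))) ≫ inter (itens A.obj [a]) (itens A.obj [b]) _ _ ≫
      (A.gam [a] (s := a) rfl (by simp) ⊠ₘ A.gam [b] (s := b) rfl (by simp)) =
      inter _ _ _ _ ≫ (A.act a ⊠ₘ A.act b) := by
    refine (reassoc_of% (inter_nat (right₁ (A.obj a)).inv (right₁ (A.obj b)).inv
      (𝟙 (A.obj 1)) (𝟙 (A.obj 1)))) _ |>.trans ?_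
    exact congrArg (fun f => _ ≫ f) (ten_comp _ _ _ _)
  rw [← reassoc_of% e']
  refine (congrArg (fun f => _ ≫ f) h').trans ?_
  rw [ten_id, OneOperad.act₂]
  refine Eq.trans ?_ (congrArg (fun f => (𝟙 _ ⊗ₘ m.mu 1 1 2 rfl) ≫ (f ⊗ₘ 𝟙 _) ≫
    A.gam [a, b] rfl (by simpa using h)) e)
  rw [tensorHom_comp_tensorHom_assoc, tensorHom_comp_tensorHom_assoc]
  simp only [Category.id_comp, Category.comp_id]
  rfl

/-- The middle coface `A 1 ⟶ A 2`. -/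
def OperadHom.doubling (m : OperadHom (assOperad D) A) : A.obj 1 ⟶ A.obj 2 := m.inner [2] rfl rfl

/-- The codegeneracy `A 1 ⟶ A 0`. -/
def OperadHom.counit (m : OperadHom (assOperad D) A) : A.obj 1 ⟶ A.obj 0 := m.inner [0] rfl rfl

/-- The composite codegeneracy `A 2 ⟶ A 0`. -/
def OperadHom.counit₂ (m : OperadHom (assOperad D) A) : A.obj 2 ⟶ A.obj 0 :=
  m.inner [0, 0] rfl rfl

lemma OperadHom.doubling_counit₂ : m.doubling ≫ m.counit₂ = m.counit :=
  m.inner_inner [[0, 0]] (n := 1) (q := 2) (s := 0) rfl rfl rfl rfl rfl rfl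

lemma OperadHom.doubling_inner_one_zero :
    m.doubling ≫ (m.inner [1, 0] rfl rfl : A.obj 2 ⟶ A.obj 1) = 𝟙 _ :=
  (m.inner_inner [[1, 0]] (n := 1) (q := 2) (s := 1) rfl rfl rfl rfl rfl rfl).trans
    (m.inner_eq_id 1 rfl rfl rfl)

lemma OperadHom.doubling_inner_zero_one :
    m.doubling ≫ (m.inner [0, 1] rfl rfl : A.obj 2 ⟶ A.obj 1) = 𝟙 _ :=
  (m.inner_inner [[0, 1]] (n := 1) (q := 2) (s := 1) rfl rfl rfl rfl rfl rfl).trans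
    (m.inner_eq_id 1 rfl rfl rfl)

lemma OperadHom.counit_lmul :
    m.counit ≫ m.lmul 1 0 1 rfl = m.lmul 1 1 2 rfl ≫ (m.inner [1, 0] rfl rfl : _ ⟶ A.obj 1) :=
  (m.lmul_inner 1 [0] (n := 1) (p := 0) (n' := 2) (p' := 1) rfl rfl rfl rfl rfl rfl).symm

lemma OperadHom.counit_rmul :
    m.counit ≫ m.rmul 0 1 1 rfl = m.rmul 1 1 2 rfl ≫ (m.inner [0, 1] rfl rfl : _ ⟶ A.obj 1) :=
  (m.rmul_inner [0] 1 (n := 1) (p := 0) (n' := 2) (p' := 1) rfl rfl rfl rfl rfl rfl).symm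

lemma OperadHom.lmul_counit : m.lmul 1 0 1 rfl ≫ m.counit = 𝟙 _ :=
  (m.lmul_inner 0 [] (n := 0) (p := 0) (n' := 1) (p' := 0) rfl rfl rfl rfl rfl rfl).trans (by
    rw [m.lmul_zero, Category.comp_id]
    exact m.inner_eq_id 0 rfl rfl rfl)

lemma OperadHom.lmul_doubling : m.lmul 1 0 1 rfl ≫ m.doubling = m.lmul 2 0 2 rfl :=
  (m.lmul_inner 2 [] (n := 0) (p := 0) (n' := 1) (p' := 2) rfl rfl rfl rfl rfl rfl).trans (by
    refine (congrArg (fun f => f ≫ _) (m.inner_eq_id 0 rfl rfl rfl)).trans ?_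
    exact Category.id_comp _)

lemma OperadHom.rmul_doubling : m.rmul 0 1 1 rfl ≫ m.doubling = m.rmul 0 2 2 rfl :=
  (m.rmul_inner [] 2 (n := 0) (p := 0) (n' := 1) (p' := 2) rfl rfl rfl rfl rfl rfl).trans (by
    refine (congrArg (fun f => f ≫ _) (m.inner_eq_id 0 rfl rfl rfl)).trans ?_
    exact Category.id_comp _)

lemma OperadHom.mu_counit₂ :
    m.mu 1 1 2 rfl ≫ m.counit₂ = (m.counit ⊠ₘ m.counit) ≫ m.mu 0 0 0 rfl :=
  m.mu_inner [0] [0] (p := 0) (q := 0) (r := 0) (a := 1) (b := 1) (c := 2) rfl rfl rfl rfl rfl rfl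
    rfl rfl

lemma OperadHom.act_doubling : (m.doubling ⊗ₘ 𝟙 _) ≫ A.act 2 = A.act 1 ≫ m.doubling :=
  m.inner_act [2] (a := 1) (s := 2) rfl rfl

lemma OperadHom.mulMap_counit : m.mulMap 1 ≫ m.counit = m.mulMap 0 := m.mulMap_inner _ _ _

/-- In elements, (x, x') ∘ d y = (x x') ∘ y; it is `inner_singleton_gam` for the list [a, b]. -/
lemma OperadHom.doubling_act₂ (a b c : ℕ) (h : a + b = c) :
    (𝟙 _ ⊗ₘ m.doubling) ≫ A.act₂ a b c h = (m.mu a b c h ⊗ₘ 𝟙 _) ≫ A.act c := by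
  have h' := m.inner_singleton_gam [a, b] (q := 2) (s := c) rfl rfl (by simpa using h)
  have e := congrArg (fun f => ((𝟙 _ ⊠ₘ (right₁ (A.obj b)).inv) ⊗ₘ 𝟙 _) ≫ f) h'
  simp only [tensorHom_comp_tensorHom_assoc, Category.comp_id, Category.id_comp] at e
  rw [OneOperad.act₂, tensorHom_comp_tensorHom_assoc, Category.id_comp, Category.comp_id]
  exact e

/-- Write m_1 as m_1 ∘ m_1 and apply the interchange: m_1 (x ∘ y) = (m_1, x) ∘ (m_1 y). -/
lemma OperadHom.act_lmul (c s : ℕ) (h : 1 + c = s) :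
    A.act c ≫ m.lmul 1 c s h =
      (((left₁ (A.obj c)).inv ≫ (m.mulMap 1 ⊠ₘ 𝟙 _)) ⊗ₘ m.lmul 1 1 2 rfl) ≫
        A.act₂ 1 c s h := by
  have e : ((left₁ (A.obj c)).inv ⊗ₘ (left₁ (A.obj 1)).inv) ≫
      inter _ _ _ _ ≫ (((m.mulMap 1 ⊗ₘ m.mulMap 1) ≫ A.act 1) ⊠ₘ ((𝟙 _ ⊗ₘ 𝟙 _) ≫ A.act c)) =
      (((left₁ (A.obj c)).inv ≫ (m.mulMap 1 ⊠ₘ 𝟙 _)) ⊗ₘ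
        ((left₁ (A.obj 1)).inv ≫ (m.mulMap 1 ⊠ₘ 𝟙 _))) ≫ inter _ _ _ _ ≫
        (A.act 1 ⊠ₘ A.act c) := by
    rw [← ten_comp, ← reassoc_of% inter_nat, tensorHom_comp_tensorHom_assoc]
  have e' : ∀ {X Y : D} (x : X ⟶ A.obj 1 ⊠ A.obj c) (y : Y ⟶ A.obj 1 ⊠ A.obj 1),
      (x ⊗ₘ (y ≫ m.mu 1 1 2 rfl)) ≫ A.act₂ 1 c s h =
      (x ⊗ₘ y) ≫ inter _ _ _ _ ≫ (A.act 1 ⊠ₘ A.act c) ≫ m.mu 1 c s h := by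
    intro X Y x y
    rw [m.inter_act, tensorHom_comp_tensorHom_assoc, Category.comp_id]
  conv_lhs => rw [OperadHom.lmul, ← reassoc_of% left₁_inv_inter (A.act c), ten_comp_assoc,
    Category.comp_id, m.vMul_mulMap]
  rw [OperadHom.lmul, ← Category.assoc (left₁ (A.obj 1)).inv, e', ← reassoc_of% e,
    id_tensorHom_id, Category.id_comp]

lemma OperadHom.act_rmul (c s : ℕ) (h : c + 1 = s) :
    A.act c ≫ m.rmul c 1 s h =
      (((right₁ (A.obj c)).inv ≫ (𝟙 _ ⊠ₘ m.mulMap 1)) ⊗ₘ m.rmul 1 1 2 rfl) ≫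
        A.act₂ c 1 s h := by
  have e : ((right₁ (A.obj c)).inv ⊗ₘ (right₁ (A.obj 1)).inv) ≫
      inter _ _ _ _ ≫ (((𝟙 _ ⊗ₘ 𝟙 _) ≫ A.act c) ⊠ₘ ((m.mulMap 1 ⊗ₘ m.mulMap 1) ≫ A.act 1)) =
      (((right₁ (A.obj c)).inv ≫ (𝟙 _ ⊠ₘ m.mulMap 1)) ⊗ₘ
        ((right₁ (A.obj 1)).inv ≫ (𝟙 _ ⊠ₘ m.mulMap 1))) ≫ inter _ _ _ _ ≫
        (A.act c ⊠ₘ A.act 1) := by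
    rw [← ten_comp, ← reassoc_of% inter_nat, tensorHom_comp_tensorHom_assoc]
  have e' : ∀ {X Y : D} (x : X ⟶ A.obj c ⊠ A.obj 1) (y : Y ⟶ A.obj 1 ⊠ A.obj 1),
      (x ⊗ₘ (y ≫ m.mu 1 1 2 rfl)) ≫ A.act₂ c 1 s h =
      (x ⊗ₘ y) ≫ inter _ _ _ _ ≫ (A.act c ⊠ₘ A.act 1) ≫ m.mu c 1 s h := by
    intro X Y x y
    rw [m.inter_act, tensorHom_comp_tensorHom_assoc, Category.comp_id]
  conv_lhs => rw [OperadHom.rmul, ← reassoc_of% right₁_inv_inter (A.act c), ten_comp_assoc,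
    Category.comp_id, m.vMul_mulMap]
  rw [OperadHom.rmul, ← Category.assoc (right₁ (A.obj 1)).inv, e', ← reassoc_of% e,
    id_tensorHom_id, Category.id_comp]

/-- A morphism `X ⟶ A 1` whose composites with the three cofaces `A 1 ⟶ A 2` agree. -/
structure OperadHom.Balanced {X : D} (x : X ⟶ A.obj 1) : Prop where
  lmul : x ≫ m.lmul 1 1 2 rfl = x ≫ m.doubling
  rmul : x ≫ m.rmul 1 1 2 rfl = x ≫ m.doubling

variable {m}

/-- Both m_1 (m_1 f) and d(m_1 f) equal m_2 f. For the other side, replace m_1 f by f m_1 and argue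
symmetrically. -/
lemma OperadHom.balanced_of_eq {X : D} {f : X ⟶ A.obj 0}
    (hf : f ≫ m.lmul 1 0 1 rfl = f ≫ m.rmul 0 1 1 rfl) :
    m.Balanced (f ≫ m.lmul 1 0 1 rfl) := by
  constructor
  · rw [Category.assoc, Category.assoc, m.lmul_lmul 1 1 0 1 2 2 rfl rfl rfl rfl, m.lmul_doubling]
  · rw [hf, Category.assoc, Category.assoc, m.rmul_rmul 0 1 1 1 2 2 rfl rfl rfl rfl,
      m.rmul_doubling]

/-- m_1 (x ∘ y) = (m_1, x) ∘ (m_1 y) = (m_1, x) ∘ d y = (m_1 x) ∘ y = d x ∘ y = d(x ∘ y), and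
likewise on the right. -/
lemma OperadHom.Balanced.act {X Y : D} {x : X ⟶ A.obj 1} {y : Y ⟶ A.obj 1} (hx : m.Balanced x)
    (hy : m.Balanced y) : m.Balanced ((x ⊗ₘ y) ≫ A.act 1) := by
  have key : ∀ {Z : D} (z : Z ⟶ A.obj 1 ⊠ A.obj 1), (z ⊗ₘ (y ≫ m.doubling)) ≫ A.act₂ 1 1 2 rfl =
      ((z ≫ m.mu 1 1 2 rfl) ⊗ₘ y) ≫ A.act 2 := by
    intro Z z
    rw [← Category.comp_id z, ← tensorHom_comp_tensorHom, Category.assoc, m.doubling_act₂,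
      tensorHom_comp_tensorHom_assoc, Category.comp_id, Category.comp_id]
  have key' : ((x ≫ m.doubling) ⊗ₘ y) ≫ A.act 2 = (x ⊗ₘ y) ≫ A.act 1 ≫ m.doubling := by
    rw [← m.act_doubling, tensorHom_comp_tensorHom_assoc, Category.comp_id]
  constructor
  · rw [Category.assoc, Category.assoc, m.act_lmul, tensorHom_comp_tensorHom_assoc, hy.lmul, key,
      ← key', ← hx.lmul, OperadHom.lmul, Category.assoc, Category.assoc]
  · rw [Category.assoc, Category.assoc, m.act_rmul, tensorHom_comp_tensorHom_assoc, hy.rmul, key,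
      ← key', ← hx.rmul, OperadHom.rmul, Category.assoc, Category.assoc]

/-- m_1 · s_0(x) is a codegeneracy of m_1 x = d x, and that codegeneracy is a retraction of d. -/
lemma OperadHom.Balanced.counit_lmul {X : D} {x : X ⟶ A.obj 1} (hx : m.Balanced x) :
    x ≫ m.counit ≫ m.lmul 1 0 1 rfl = x := by
  rw [m.counit_lmul, reassoc_of% hx.lmul, m.doubling_inner_one_zero, Category.comp_id]

lemma OperadHom.Balanced.counit_rmul {X : D} {x : X ⟶ A.obj 1} (hx : m.Balanced x) :
    x ≫ m.counit ≫ m.rmul 0 1 1 rfl = x := by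
  rw [m.counit_rmul, reassoc_of% hx.rmul, m.doubling_inner_zero_one, Category.comp_id]

end Action

end DuoidalCenter

namespace DuoidalCenter

open DuoidalCategory

/-! ### The duoid structure on the equalizer -/

section Center

variable {D : Type u} [Category.{v} D] [DuoidalCategory D] {A : OneOperad D}
  {m : OperadHom (assOperad D) A}

variable (m) in
/-- The morphism `p` is an equalizer of the two cofaces `A 0 ⟶ A 1`. -/
structure OperadHom.IsCenter {Z : D} (p : Z ⟶ A.obj 0) : Prop where
  condition : p ≫ m.lmul 1 0 1 rfl = p ≫ m.rmul 0 1 1 rfl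
  hom_ext {Y : D} {g g' : Y ⟶ Z} (h : g ≫ p = g' ≫ p) : g = g'
  exists_lift {Y : D} (f : Y ⟶ A.obj 0) (hf : f ≫ m.lmul 1 0 1 rfl = f ≫ m.rmul 0 1 1 rfl) :
    ∃ l : Y ⟶ Z, l ≫ p = f

lemma OperadHom.Balanced.counit_eq {X : D} {x : X ⟶ A.obj 1} (hx : m.Balanced x) :
    (x ≫ m.counit) ≫ m.lmul 1 0 1 rfl = (x ≫ m.counit) ≫ m.rmul 0 1 1 rfl := by
  rw [Category.assoc, Category.assoc, hx.counit_lmul, hx.counit_rmul]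

/-- m_1 (f g) = (m_1 f) g = (f m_1) g = f (m_1 g) = f (g m_1) = (f g) m_1. -/
lemma OperadHom.mu_eq {X Y : D} {f : X ⟶ A.obj 0} {g : Y ⟶ A.obj 0}
    (hf : f ≫ m.lmul 1 0 1 rfl = f ≫ m.rmul 0 1 1 rfl)
    (hg : g ≫ m.lmul 1 0 1 rfl = g ≫ m.rmul 0 1 1 rfl) :
    ((f ⊠ₘ g) ≫ m.mu 0 0 0 rfl) ≫ m.lmul 1 0 1 rfl =
      ((f ⊠ₘ g) ≫ m.mu 0 0 0 rfl) ≫ m.rmul 0 1 1 rfl := by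
  rw [Category.assoc, Category.assoc, ← m.lmul_mu 1 0 1 0 0 1 rfl rfl rfl rfl,
    ← m.mu_rmul 0 0 1 1 0 1 rfl rfl rfl rfl, ten_comp_assoc, ten_comp_assoc, hf, ← hg,
    Category.comp_id, Category.comp_id, ← Category.comp_id g, ← ten_comp_assoc,
    m.rmul_mu 0 1 1 0 1 1 rfl rfl rfl rfl, ten_comp_assoc, Category.comp_id, Category.comp_id]

/-- (m_1 f)(m_1 g) = (f m_1)(m_1 g) = f (m_2 g) = (f m_2) g = (m_2 f) g = m_2 (f g) = d(m_1 f g).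
Only f has to be central. -/
lemma OperadHom.mu_lmul_doubling {X Y : D} {f : X ⟶ A.obj 0} {g : Y ⟶ A.obj 0}
    (hf : f ≫ m.lmul 1 0 1 rfl = f ≫ m.rmul 0 1 1 rfl) :
    ((f ≫ m.lmul 1 0 1 rfl) ⊠ₘ (g ≫ m.lmul 1 0 1 rfl)) ≫ m.mu 1 1 2 rfl =
      (f ⊠ₘ g) ≫ m.mu 0 0 0 rfl ≫ m.lmul 1 0 1 rfl ≫ m.doubling := by
  have h₂ : f ≫ m.lmul 2 0 2 rfl = f ≫ m.rmul 0 2 2 rfl := by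
    rw [← m.lmul_doubling, ← m.rmul_doubling, reassoc_of% hf]
  have e : ((f ≫ m.rmul 0 1 1 rfl) ⊠ₘ (g ≫ m.lmul 1 0 1 rfl)) =
      (f ⊠ₘ (g ≫ m.lmul 1 0 1 rfl)) ≫ (m.rmul 0 1 1 rfl ⊠ₘ 𝟙 _) := by
    rw [ten_comp, Category.comp_id]
  have e' : (f ⊠ₘ (g ≫ m.lmul 2 0 2 rfl)) = (f ⊠ₘ g) ≫ (𝟙 _ ⊠ₘ m.lmul 2 0 2 rfl) := by
    rw [ten_comp, Category.comp_id]
  rw [hf, e, Category.assoc, m.rmul_mu 0 1 1 1 2 2 rfl rfl rfl rfl, ten_comp_assoc,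
    Category.comp_id, Category.assoc, m.lmul_lmul 1 1 0 1 2 2 rfl rfl rfl rfl, e', Category.assoc,
    ← m.rmul_mu 0 2 2 0 2 2 rfl rfl rfl rfl, ten_comp_assoc, Category.comp_id, ← h₂,
    m.lmul_doubling, ← m.lmul_mu 2 0 2 0 0 2 rfl rfl rfl rfl, ten_comp_assoc, Category.comp_id]

variable {Z : D} {p : Z ⟶ A.obj 0}

lemma OperadHom.IsCenter.hom_ext' (hp : m.IsCenter p) {Y : D} {g g' : Y ⟶ Z}
    (h : g ≫ p ≫ m.lmul 1 0 1 rfl = g' ≫ p ≫ m.lmul 1 0 1 rfl) : g = g' := by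
  refine hp.hom_ext ?_
  have e : p = p ≫ m.lmul 1 0 1 rfl ≫ m.counit := by
    rw [m.lmul_counit, Category.comp_id]
  rw [e, reassoc_of% h]

/-- Two monic maps out of Z are used: p into the ⊠-monoid A(0), and q = m_1 p into the ⊗-monoid
A(1). Each axiom is verified through whichever of them makes it a law of A. -/
theorem OperadHom.IsCenter.existsUnique_duoidStruct (hp : m.IsCenter p) :
    ∃! S : DuoidStruct Z,
      S.mul₀ ≫ p = ((p ≫ m.lmul 1 0 1 rfl) ⊗ₘ (p ≫ m.lmul 1 0 1 rfl)) ≫ A.act 1 ≫ m.counit ∧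
      S.mul₁ ≫ p = (p ⊠ₘ p) ≫ m.mu 0 0 0 rfl ∧
      S.one₁ ≫ p = m.mulMap 0 ∧ S.one₀ = unitMap ≫ S.one₁ := by
  have hb := m.balanced_of_eq hp.condition
  obtain ⟨q, hq⟩ : ∃ q, q = p ≫ m.lmul 1 0 1 rfl := ⟨_, rfl⟩
  rw [← hq] at hb ⊢
  have ext : ∀ {Y : D} {g g' : Y ⟶ Z}, g ≫ q = g' ≫ q → g = g' := fun h =>
    hp.hom_ext' (by rwa [← hq])
  obtain ⟨μ₀, h₀⟩ := hp.exists_lift (((q ⊗ₘ q) ≫ A.act 1) ≫ m.counit) (hb.act hb).counit_eq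
  obtain ⟨μ₁, h₁⟩ := hp.exists_lift ((p ⊠ₘ p) ≫ m.mu 0 0 0 rfl) (m.mu_eq hp.condition hp.condition)
  obtain ⟨ι, hι⟩ := hp.exists_lift (m.mulMap 0) (by rw [m.mulMap_lmul, m.mulMap_rmul])
  -- Balancedness of the composite q ∘ q makes s_0 invertible on it; hence q is multiplicative, and
  -- the ⊗-monoid axioms for Z reduce to those of A(1).
  have k₀ : μ₀ ≫ q = (q ⊗ₘ q) ≫ A.act 1 := by
    rw [hq, reassoc_of% h₀, ← hq]
    have := (hb.act hb).counit_lmul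
    rwa [Category.assoc] at this
  have k₁ : μ₁ ≫ q = (p ⊠ₘ p) ≫ m.mu 0 0 0 rfl ≫ m.lmul 1 0 1 rfl := by
    rw [hq, reassoc_of% h₁]
  have kι : ι ≫ q = m.mulMap 1 := by rw [hq, reassoc_of% hι, m.mulMap_lmul]
  have ku : (unitMap ≫ ι) ≫ q = A.unit := by rw [Category.assoc, kι, m.unitMap_mulMap_one]
  let S : DuoidStruct Z :=
    { mul₀ := μ₀
      one₀ := unitMap ≫ ι
      mul₁ := μ₁
      one₁ := ι
      one_mul₀ := ext (by
        rw [Category.assoc, k₀, tensorHom_comp_tensorHom_assoc, ku, Category.id_comp,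
          tensorHom_split', Category.assoc, A.unit_act_one, id_tensorHom,
          leftUnitor_naturality])
      mul_one₀ := ext (by
        rw [Category.assoc, k₀, tensorHom_comp_tensorHom_assoc, ku, Category.id_comp,
          tensorHom_split, Category.assoc, A.act_unit, tensorHom_id, rightUnitor_naturality])
      mul_assoc₀ := ext (by
        have e₁ : (μ₀ ⊗ₘ 𝟙 Z) ≫ (q ⊗ₘ q) = ((q ⊗ₘ q) ⊗ₘ q) ≫ (A.act 1 ⊗ₘ 𝟙 _) := by
          rw [tensorHom_comp_tensorHom, tensorHom_comp_tensorHom, k₀, Category.id_comp,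
            Category.comp_id]
        have e₂ : (𝟙 Z ⊗ₘ μ₀) ≫ (q ⊗ₘ q) = (q ⊗ₘ (q ⊗ₘ q)) ≫ (𝟙 _ ⊗ₘ A.act 1) := by
          rw [tensorHom_comp_tensorHom, tensorHom_comp_tensorHom, k₀, Category.id_comp,
            Category.comp_id]
        simp only [Category.assoc]
        rw [k₀, reassoc_of% e₁, reassoc_of% e₂, A.act_act, associator_naturality_assoc])
      one_mul₁ := hp.hom_ext (by
        rw [Category.assoc, h₁, ten_comp_assoc, hι, Category.id_comp, tenHom_split', Category.assoc,
          m.mulMap_zero_mu, left₁_nat])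
      mul_one₁ := hp.hom_ext (by
        rw [Category.assoc, h₁, ten_comp_assoc, hι, Category.id_comp, tenHom_split, Category.assoc,
          m.mu_mulMap_zero, right₁_nat])
      mul_assoc₁ := hp.hom_ext (by
        have e₁ : (μ₁ ⊠ₘ 𝟙 Z) ≫ (p ⊠ₘ p) = ((p ⊠ₘ p) ⊠ₘ p) ≫ (m.mu 0 0 0 rfl ⊠ₘ 𝟙 _) := by
          rw [ten_comp, ten_comp, h₁, Category.id_comp, Category.comp_id]
        have e₂ : (𝟙 Z ⊠ₘ μ₁) ≫ (p ⊠ₘ p) = (p ⊠ₘ (p ⊠ₘ p)) ≫ (𝟙 _ ⊠ₘ m.mu 0 0 0 rfl) := by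
          rw [ten_comp, ten_comp, h₁, Category.id_comp, Category.comp_id]
        simp only [Category.assoc]
        rw [h₁, reassoc_of% e₁, reassoc_of% e₂, m.mu_assoc 0 0 0 0 0 0 rfl rfl rfl rfl,
          reassoc_of% assoc₁_nat])
      unitMap_one₁ := rfl
      vMul_one₁ := ext (by
        rw [Category.assoc, Category.assoc, k₀, kι, tensorHom_comp_tensorHom_assoc, kι,
          m.vMul_mulMap])
      interchange := hp.hom_ext (by
        have e : ∀ {Y W : D} (y : Y ⟶ A.obj 1 ⊠ A.obj 1) (w : W ⟶ A.obj 1),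
            (y ⊗ₘ (w ≫ m.doubling)) ≫ A.act₂ 1 1 2 rfl =
              ((y ≫ m.mu 1 1 2 rfl) ⊗ₘ w) ≫ A.act 2 := by
          intro Y W y w
          rw [← Category.comp_id y, ← tensorHom_comp_tensorHom, Category.assoc, m.doubling_act₂,
            tensorHom_comp_tensorHom_assoc, Category.comp_id, Category.comp_id]
        have hd : (q ⊠ₘ q) ≫ m.mu 1 1 2 rfl = (μ₁ ≫ q) ≫ m.doubling := by
          rw [k₁, hq, m.mu_lmul_doubling hp.condition]
          simp only [Category.assoc]
        -- The interchange produces (q, q) ∘ (q q). Here `hd` rewrites the product q q as d(μ₁ q),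
        -- first in the second factor and then, once d has been traded for a product in the first,
        -- there too.
        have e₁ : inter Z Z Z Z ≫ (((q ⊗ₘ q) ≫ A.act 1) ⊠ₘ ((q ⊗ₘ q) ≫ A.act 1)) ≫
            m.mu 1 1 2 rfl = ((((μ₁ ≫ q) ≫ m.doubling) ⊗ₘ (μ₁ ≫ q)) ≫ A.act 2) := by
          rw [← ten_comp_assoc, ← reassoc_of% inter_nat, m.inter_act,
            tensorHom_comp_tensorHom_assoc, Category.comp_id, hd, e, hd]
        -- The d comes out of the composite and is cancelled by the double codegeneracy A(2) → A(0),
        -- leaving s_0.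
        have e₂ : (((μ₁ ≫ q) ≫ m.doubling) ⊗ₘ (μ₁ ≫ q)) ≫ A.act 2 ≫ m.counit₂ =
            ((μ₁ ≫ q) ⊗ₘ (μ₁ ≫ q)) ≫ A.act 1 ≫ m.counit := by
          rw [← Category.comp_id (μ₁ ≫ q), ← tensorHom_comp_tensorHom, Category.comp_id,
            Category.assoc, reassoc_of% m.act_doubling, m.doubling_counit₂]
        simp only [Category.assoc] at e₂ ⊢
        rw [h₁, h₀, ten_comp_assoc, h₀, ← ten_comp_assoc, ← m.mu_counit₂, reassoc_of% e₁,
          e₂, ← tensorHom_comp_tensorHom_assoc, Category.assoc]) }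
  refine ⟨S, ⟨h₀.trans (Category.assoc _ _ _), h₁, hι, rfl⟩, ?_⟩
  rintro S' ⟨e₀, e₁, eι, eu⟩
  have f : S'.one₁ = ι := hp.hom_ext (eι.trans hι.symm)
  refine DuoidStruct.ext (hp.hom_ext (e₀.trans ?_)) (eu.trans ?_) (hp.hom_ext (e₁.trans h₁.symm)) f
  · exact (h₀.trans (Category.assoc _ _ _)).symm
  · rw [f]

end Center

/-! ### The Hochschild object as a centre, and the displayed formulas -/

section Hochschild

variable {V : Type u'} [Category.{v'} V] [MonoidalCategory V] [SymmetricCategory V]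
  [MonoidalClosed V] {D : Type u} [Category.{v} D] [DuoidalCategory D]
  [EnrichedOrdinaryCategory V D] [Cotensored V D] {A : OneOperad D}
  {m : OperadHom (assOperad D) A} {C : InducedCosimplicial m}
  (T : Totalization V (unitCosimplicial V) C.X)

lemma OneOperad.act_one (A : OneOperad D) :
    A.act 1 = ((right₁ (A.obj 1)).inv ⊗ₘ 𝟙 (A.obj 1)) ≫ A.γ [1] :=
  congrArg (fun f => _ ≫ f) (A.gam_rfl [1])

lemma OperadHom.coface_zero_zero : m.coface 0 0 = m.lmul 1 0 1 rfl := m.cofaceFirst_eq 0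

lemma OperadHom.coface_zero_one : m.coface 0 1 = m.rmul 0 1 1 rfl := m.cofaceLast_eq 0

lemma OperadHom.codegeneracy_zero_zero : m.codegeneracy 0 0 = m.counit := rfl

lemma OperadHom.comp_act_counit (m : OperadHom (assOperad D) A) {X Y : D} (f : X ⟶ Y)
    (g : Y ⟶ A.obj 0) :
    ((f ≫ g ≫ m.coface 0 0 ≫ (right₁ (A.obj 1)).inv) ⊗ₘ (f ≫ g ≫ m.coface 0 0)) ≫ A.γ [1] ≫
        m.codegeneracy 0 0 =
      (((f ≫ g) ≫ m.lmul 1 0 1 rfl) ⊗ₘ ((f ≫ g) ≫ m.lmul 1 0 1 rfl)) ≫ A.act 1 ≫ m.counit := by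
  have e : ((f ≫ g ≫ m.coface 0 0 ≫ (right₁ (A.obj 1)).inv) ⊗ₘ (f ≫ g ≫ m.coface 0 0)) =
      (((f ≫ g) ≫ m.lmul 1 0 1 rfl) ⊗ₘ ((f ≫ g) ≫ m.lmul 1 0 1 rfl)) ≫
        ((right₁ (A.obj 1)).inv ⊗ₘ 𝟙 (A.obj 1)) := by
    rw [m.coface_zero_zero, tensorHom_comp_tensorHom, Category.comp_id]
    simp only [Category.assoc]
  rw [e, A.act_one, m.codegeneracy_zero_zero]
  exact (Category.assoc _ _ _).trans (congrArg (fun h => _ ≫ h) (Category.assoc _ _ _).symm)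

/-- The isomorphisms of `C` carry the two lowest cofaces to left and right multiplication by m_1, so
the equalizer property of the totalization transfers. -/
lemma Totalization.isCenter : m.IsCenter (T.proj 0 ≫ (C.iso 0).hom) where
  condition := by
    have h₀ := C.δ_iso 0 0
    have h₁ := C.δ_iso 0 1
    have h := T.proj_δ
    rw [m.coface_zero_zero] at h₀
    rw [m.coface_zero_one] at h₁
    rw [Category.assoc, Category.assoc, ← h₀, ← h₁]
    exact (reassoc_of% h) _
  hom_ext h := T.hom_ext (by
    rwa [← cancel_mono (C.iso 0).hom, Category.assoc, Category.assoc])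
  exists_lift f hf := by
    have h₀ := C.δ_iso 0 0
    have h₁ := C.δ_iso 0 1
    rw [m.coface_zero_zero] at h₀
    rw [m.coface_zero_one] at h₁
    obtain ⟨l, hl⟩ := T.exists_lift_proj (f ≫ (C.iso 0).inv) (by
      change (f ≫ (C.iso 0).inv) ≫ C.X.δ 0 = (f ≫ (C.iso 0).inv) ≫ C.X.δ 1
      rw [← cancel_mono (C.iso 1).hom]
      simp only [Category.assoc]
      rw [h₀, h₁, Iso.inv_hom_id_assoc, Iso.inv_hom_id_assoc, hf])
    exact ⟨l, by rw [reassoc_of% hl, Iso.inv_hom_id, Category.comp_id]⟩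

lemma isCanonicalDuoid_iff (S : DuoidStruct T.wedge.pt) :
    IsCanonicalDuoid T S ↔
      S.mul₀ ≫ T.proj 0 ≫ (C.iso 0).hom =
        (((T.proj 0 ≫ (C.iso 0).hom) ≫ m.lmul 1 0 1 rfl) ⊗ₘ
          ((T.proj 0 ≫ (C.iso 0).hom) ≫ m.lmul 1 0 1 rfl)) ≫ A.act 1 ≫ m.counit ∧
      S.mul₁ ≫ T.proj 0 ≫ (C.iso 0).hom =
        ((T.proj 0 ≫ (C.iso 0).hom) ⊠ₘ (T.proj 0 ≫ (C.iso 0).hom)) ≫ m.mu 0 0 0 rfl ∧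
      S.one₁ ≫ T.proj 0 ≫ (C.iso 0).hom = m.mulMap 0 ∧ S.one₀ = unitMap ≫ S.one₁ := by
  have e₀ : ((T.proj 0 ≫ (C.iso 0).hom ≫ m.coface 0 0 ≫ (right₁ (A.obj 1)).inv) ⊗ₘ
        (T.proj 0 ≫ (C.iso 0).hom ≫ m.coface 0 0)) ≫ A.γ [1] ≫ m.codegeneracy 0 0 =
      (((T.proj 0 ≫ (C.iso 0).hom) ≫ m.lmul 1 0 1 rfl) ⊗ₘ
        ((T.proj 0 ≫ (C.iso 0).hom) ≫ m.lmul 1 0 1 rfl)) ≫ A.act 1 ≫ m.counit := by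
    exact m.comp_act_counit _ _
  have e₁ : (ρ_ (A.obj 0 ⊠ A.obj 0)).inv ≫ ((𝟙 (A.obj 0) ⊠ₘ (right₁ (A.obj 0)).inv) ⊗ₘ
      (unitMap ≫ m.mulMap 2)) ≫ A.γ [0, 0] = m.mu 0 0 0 rfl := by
    refine Eq.trans ?_ (m.comp_prod [0, 0] (s := 0) rfl (𝟙 _ ⊠ₘ (right₁ _).inv)).symm
    exact congrArg (fun f => _ ≫ _ ≫ f) (Category.comp_id _).symm
  have e₂ : m.mulMap 1 ≫ m.codegeneracy 0 0 = m.mulMap 0 := m.mulMap_counit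
  constructor
  · rintro ⟨h₀, h₁, hι, hu⟩
    exact ⟨h₀.trans e₀, h₁.trans (congrArg (fun f => _ ≫ f) e₁), hι.trans e₂, hu⟩
  · rintro ⟨h₀, h₁, hι, hu⟩
    exact ⟨h₀.trans e₀.symm, h₁.trans (congrArg (fun f => _ ≫ f) e₁.symm), hι.trans e₂.symm, hu⟩

theorem existsUnique_isCanonicalDuoid : ∃! S : DuoidStruct T.wedge.pt, IsCanonicalDuoid T S := by
  simpa only [isCanonicalDuoid_iff] using T.isCenter.existsUnique_duoidStruct

end Hochschild

end DuoidalCenter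
theorem mainTheorem1 {V : Type u'} [Category.{v'} V] [MonoidalCategory V] [SymmetricCategory V]
    [MonoidalClosed V] {D : Type u} [Category.{v} D] [DuoidalCategory D]
    [EnrichedOrdinaryCategory V D] [DuoidalVCategory V D] [Cotensored V D]
    [Enriched.HasConicalLimitsOfSize.{0, 0} V D] :
    (∀ (A : OneOperad D) (m : OperadHom (assOperad D) A),
      Nonempty (InducedCosimplicial m) ∧
      ∀ C : InducedCosimplicial m,
        Nonempty (Totalization V (unitCosimplicial V) C.X) ∧
        ∀ T : Totalization V (unitCosimplicial V) C.X,
          ∃! S : DuoidStruct T.wedge.pt, IsCanonicalDuoid T S) ∧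
    (∀ (K : Type w) [Category.{w'} K] [EnrichedOrdinaryCategory D K] [MonoidalCategory K]
        [MonoidalDCategory D K] (M : K) (S : DMonoid D M),
      Nonempty (InducedCosimplicial S.toOperadHom) ∧
      ∀ C : InducedCosimplicial S.toOperadHom,
        Nonempty (Totalization V (unitCosimplicial V) C.X) ∧
        ∀ Z : Totalization V (unitCosimplicial V) C.X,
          ∃! R : DuoidStruct Z.wedge.pt, IsCanonicalDuoid Z R) := by
  -- The second half is the first one applied to the multiplicative structure `S.toOperadHom` on the
  -- endomorphism operad.
  exact ⟨fun A m => ⟨⟨m.inducedCosimplicial⟩, fun C =>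
      ⟨nonempty_totalization C.X, fun T => existsUnique_isCanonicalDuoid T⟩⟩,
    fun K _ _ _ _ M S => ⟨⟨S.toOperadHom.inducedCosimplicial⟩, fun C =>
      ⟨nonempty_totalization C.X, fun Z => existsUnique_isCanonicalDuoid Z⟩⟩⟩
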